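/- Let $M$ be a compact Kähler manifold of complex dimension $n$ with a smooth Kähler metric $g=g_{i\bar j}\,dz^i\otimes d\bar z^j$ and volume form $dvol_g=\omega^n/n!$, where $\omega=\sqrt{-1}\,g_{i\bar j}\,dz^i\wedge d\bar z^j$, and let $p_0>2n$. For a smooth real function $f$ on $M$ write $f_i=\partial f/\partial z^i$, $f_{\bar j}=\partial f/\partial\bar z^j$, $f_{i\bar j}=\partial^2 f/\partial z^i\partial\bar z^j$, $|\nabla f|=(g^{i\bar j}f_if_{\bar j})^{1/2}$ and $\|f\|_{W^{1,p_0}}=\|f\|_{L^{p_0}}+\|\nabla f\|_{L^{p_0}}$, the norms being taken with respect to $g$ and $dvol_g$. Then for all real $K, L$ there is a constant $C=C(K,L,p_0,M,g,n)$ such that the following holds: if $\phi$ is a smooth real function on $M$ with $(g_{i\bar j}+\phi_{i\bar j})>0$ that solves the complex Monge–Ampère equation $$\log\left(\frac{\det(g_{i\bar j}+\phi_{i\bar j})}{\det(g_{i\bar j})}\right)=F \quad\text{on } M,$$ and if $\|\phi\|_{L^\infty}\le K$ and $\|F\|_{W^{1,p_0}}\le L$, then $$|\nabla\phi|\le C \quad\text{on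 } M.$$ In other words, $|\nabla\phi|\le C(\|\phi\|_{L^\infty},\|F\|_{W^{1,p_0}},p_0,M,g,n)$. -/

import Mathlib

open scoped Manifold ContDiff ComplexOrder

noncomputable section

namespace KahlerMA

open MeasureTheory

/-- The model space of complex manifolds of complex dimension `n`. -/
abbrev Cn (n : ℕ) : Type := Fin n → ℂ

/-- The Wirtinger derivative `∂f/∂z^i = (∂f/∂x^i - √-1 ∂f/∂y^i) / 2`. -/
def dz {n : ℕ} (i : Fin n) (f : Cn n → ℂ) (z : Cn n) : ℂ :=
  (fderiv ℝ f z (Pi.single i 1) - Complex.I * fderiv ℝ f z (Pi.single i Complex.I)) / 2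

/-- The Wirtinger derivative `∂f/∂z̄^i = (∂f/∂x^i + √-1 ∂f/∂y^i) / 2`. -/
def dzbar {n : ℕ} (i : Fin n) (f : Cn n → ℂ) (z : Cn n) : ℂ :=
  (fderiv ℝ f z (Pi.single i 1) + Complex.I * fderiv ℝ f z (Pi.single i Complex.I)) / 2

/-- The complex Hessian matrix `f_{i j̄} = ∂²f / ∂z^i ∂z̄^j`. -/
def complexHessian {n : ℕ} (f : Cn n → ℂ) (z : Cn n) : Matrix (Fin n) (Fin n) ℂ :=
  Matrix.of fun i j => dz i (dzbar j f) z

/-- The holomorphic Jacobian matrix `∂τ^a / ∂z^i` (row `a`, column `i`) of a holomorphic map `τ`. -/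
def jacobian {n : ℕ} (τ : Cn n → Cn n) (z : Cn n) : Matrix (Fin n) (Fin n) ℂ :=
  Matrix.of fun a i => fderiv ℂ τ z (Pi.single i 1) a

/-- A smooth Kähler metric `g = g_{i j̄} dz^i ⊗ dz̄^j` on a complex manifold, given by its components
in the holomorphic charts of the atlas (only their values on the target of the chart matter). -/
structure KahlerMetric (n : ℕ) (M : Type*) [TopologicalSpace M] [ChartedSpace (Cn n) M] where
  /-- The matrix `(g_{i j̄})` in a chart. -/
  coeff : OpenPartialHomeomorph M (Cn n) → Cn n → Matrix (Fin n) (Fin n) ℂ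
  /-- The components are smooth. -/
  smooth : ∀ e ∈ atlas (Cn n) M, ∀ i j, ContDiffOn ℝ ∞ (fun z => coeff e z i j) e.target
  /-- The components form a positive definite Hermitian matrix. -/
  posDef : ∀ e ∈ atlas (Cn n) M, ∀ z ∈ e.target, (coeff e z).PosDef
  /-- The components transform as a tensor: `g_{i j̄} = ∂_i τ^a · g'_{a b̄} · conj (∂_j τ^b)` for the
  change of coordinates `τ` from the chart `e` to the chart `e'`. -/
  transform : ∀ e ∈ atlas (Cn n) M, ∀ e' ∈ atlas (Cn n) M, ∀ z ∈ (e.symm.trans e').source,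
    coeff e z = (jacobian (e' ∘ e.symm) z).transpose * coeff e' (e' (e.symm z)) *
      (jacobian (e' ∘ e.symm) z).map (starRingEnd ℂ)
  /-- The Kähler form `√-1 g_{i j̄} dz^i ∧ dz̄^j` is closed. -/
  closed : ∀ e ∈ atlas (Cn n) M, ∀ z ∈ e.target, ∀ i j k,
    dz k (fun w => coeff e w i j) z = dz i (fun w => coeff e w k j) z

variable {n : ℕ} {M : Type*} [TopologicalSpace M] [ChartedSpace (Cn n) M]

/-- A real function on `M`, read in the chart `e` (as a complex valued function). -/
def inChart (e : OpenPartialHomeomorph M (Cn n)) (f : M → ℝ) : Cn n → ℂ :=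
  fun z => (f (e.symm z) : ℂ)

/-- `|∇f|_g = (g^{i j̄} f_i f_j̄)^{1/2}` at `x`, where `g^{i j̄} g_{k j̄} = δ^i_k`, computed in the
preferred chart at `x` (the value does not depend on the chart). -/
def gradNorm (g : KahlerMetric n M) (f : M → ℝ) (x : M) : ℝ :=
  Real.sqrt (∑ i, ∑ j, (g.coeff (chartAt (Cn n) x) (chartAt (Cn n) x x))⁻¹ j i *
    dz i (inChart (chartAt (Cn n) x) f) (chartAt (Cn n) x x) *
    dzbar j (inChart (chartAt (Cn n) x) f) (chartAt (Cn n) x x)).re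

/-- The volume measure `ω^n / n!` on the domain of the chart `e`: its density with respect to
Lebesgue measure in the coordinates of `e` is `2^n det (g_{i j̄})`. -/
def chartVol [MeasurableSpace M] (g : KahlerMetric n M) (e : OpenPartialHomeomorph M (Cn n)) :
    Measure M :=
  ((volume.restrict e.target).withDensity
    fun z => ENNReal.ofReal (2 ^ n * (g.coeff e z).det.re)).map e.symm

/-- The volume measure `dvol_g`: the least measure that dominates the volume measure on the domain
of every chart. As the latter agree on overlaps, it restricts to each of them. -/
def vol [MeasurableSpace M] (g : KahlerMetric n M) : Measure M :=
  ⨆ e ∈ atlas (Cn n) M, chartVol g e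

/-- The Sobolev norm `‖f‖_{L^p} + ‖∇f‖_{L^p}` of a smooth function `f` (in `[0, ∞]`). -/
def sobolevNorm [MeasurableSpace M] (g : KahlerMetric n M) (p : ℝ) (f : M → ℝ) : ENNReal :=
  eLpNorm f (ENNReal.ofReal p) (vol g) + eLpNorm (gradNorm g f) (ENNReal.ofReal p) (vol g)

/-- `φ` is a smooth solution of the complex Monge-Ampère equation
`log (det (g_{i j̄} + φ_{i j̄}) / det (g_{i j̄})) = F`: it is smooth, `g_{i j̄} + φ_{i j̄}` is positive
definite, and the equation holds in every chart. -/
structure IsSmoothSolution (g : KahlerMetric n M) (F φ : M → ℝ) : Prop where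
  smooth : ContMDiff 𝓘(ℝ, Cn n) 𝓘(ℝ, ℝ) ∞ φ
  posDef : ∀ e ∈ atlas (Cn n) M, ∀ z ∈ e.target,
    (g.coeff e z + complexHessian (inChart e φ) z).PosDef
  equation : ∀ e ∈ atlas (Cn n) M, ∀ z ∈ e.target,
    Real.log ((g.coeff e z + complexHessian (inChart e φ) z).det.re / (g.coeff e z).det.re) =
      F (e.symm z)

end KahlerMA

end

/-! Write g_φ for the metric g + ∂∂̄φ, Δ_φ for the trace of ∂∂̄ with respect to g_φ, and u = |∂φ|²
with respect to g. The proof is an integral maximum principle for v = e^{A(φ)} u with A(t) = t²/2 -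
D t. A pointwise maximum principle would need a bound for ∇F, but only an L^{p₀} bound with p₀ > 2n
is available, so the differential inequality is integrated and iterated.

Pointwise part. Since the equation is differentiated only once, the Bochner computation
(`laplacian_weighted_grad_ge`) involves F only through ⟨∂φ, ∂F⟩. As A' = φ - D is very negative, -A'
u tr_{g_φ} g beats the curvature of g and leaves u tr_{g_φ} g. As A'' = 1, there is also a term u
|∂φ|² measured by g_φ. Because det g_φ / det g = e^F is bounded above, these two together dominate
any multiple of u, up to a constant (`exists_absorption_const`). The outcome is
`exists_weightedGrad_bounds`: Δ_φ v ≥ c (tr_g g_φ + u) - c₁ (1 + √u |∇F|), with v comparable to u.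

Integral part. The measure e^F dvol_g is the volume of g_φ, for which Δ_φ f has mean zero
(`IsSmoothSolution.integral_laplacian_eq_zero`), because the cofactor matrix of a Kähler metric is
divergence free. Put w = v + 1 and take f = w^{p+1}: this bounds the integral of w^{p-1} |∂w|²_{g_φ}
+ w^p tr_g g_φ. From |∂w|²_g ≤ tr_g g_φ · |∂w|²_{g_φ} and the arithmetic-geometric inequality, this
integrand controls |∇ w^{p+1/2}|_g, although g_φ has not been bounded from either side. Hence the L¹
norm of ∇ w^q is at most C q ∫ (1 + |∇F|) w^q.

Iteration. The W^{1,1} Sobolev inequality gains the exponent χ = 2n/(2n-1), Hölder against |∇F| in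
L^{p₀} costs the conjugate exponent r, and r < χ exactly when p₀ > 2n. Moser iteration
(`exists_moser_bound`) then bounds w by its L¹ norm, which follows from integrating the differential
inequality itself. The bound for F used above comes from the same machine (`exists_sup_bound`),
applied to √(1 + F²). -/

noncomputable section

namespace KahlerMA

open MeasureTheory

/-! ### First-order calculus of Wirtinger derivatives. -/

section Wirtinger

variable {n : ℕ}

/-- The common form `(∂f/∂x^i + s ∂f/∂y^i) / 2` of the two Wirtinger derivatives: `s = -√-1` gives
`∂/∂z^i` and `s = √-1` gives `∂/∂z̄^i`. -/
def wirt (s : ℂ) (i : Fin n) (f : Cn n → ℂ) (z : Cn n) : ℂ :=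
  (fderiv ℝ f z (Pi.single i 1) + s * fderiv ℝ f z (Pi.single i Complex.I)) / 2

theorem dz_eq_wirt (i : Fin n) : dz i = wirt (-Complex.I) i := by
  funext f z
  simp [dz, wirt, sub_eq_add_neg]

theorem dzbar_eq_wirt (i : Fin n) : dzbar i = wirt Complex.I i := rfl

variable {s t : ℂ} {i j : Fin n} {f g : Cn n → ℂ} {z : Cn n}

theorem wirt_congr (h : f =ᶠ[nhds z] g) : wirt s i f z = wirt s i g z := by
  simp only [wirt, h.fderiv_eq]

theorem wirt_eventuallyEq (h : f =ᶠ[nhds z] g) : wirt s i f =ᶠ[nhds z] wirt s i g :=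
  h.eventuallyEq_nhds.mono fun _ hw => wirt_congr hw

theorem wirt_const (c : ℂ) : wirt s i (fun _ : Cn n => c) z = 0 := by
  simp [wirt]

theorem wirt_add (hf : DifferentiableAt ℝ f z) (hg : DifferentiableAt ℝ g z) :
    wirt s i (fun w => f w + g w) z = wirt s i f z + wirt s i g z := by
  simp only [wirt, fderiv_fun_add hf hg, _root_.add_apply]
  ring

theorem wirt_sub (hf : DifferentiableAt ℝ f z) (hg : DifferentiableAt ℝ g z) :
    wirt s i (fun w => f w - g w) z = wirt s i f z - wirt s i g z := by
  simp only [wirt, fderiv_fun_sub hf hg, _root_.sub_apply]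
  ring

theorem wirt_mul (hf : DifferentiableAt ℝ f z) (hg : DifferentiableAt ℝ g z) :
    wirt s i (fun w => f w * g w) z = wirt s i f z * g z + f z * wirt s i g z := by
  simp only [wirt, fderiv_fun_mul hf hg, _root_.add_apply,
    _root_.smul_apply, smul_eq_mul]
  ring

theorem wirt_const_mul (c : ℂ) (hf : DifferentiableAt ℝ f z) :
    wirt s i (fun w => c * f w) z = c * wirt s i f z := by
  rw [wirt_mul (differentiableAt_const c) hf, wirt_const]
  ring

theorem wirt_sum {ι : Type*} {S : Finset ι} {F : ι → Cn n → ℂ}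
    (hF : ∀ a ∈ S, DifferentiableAt ℝ (F a) z) :
    wirt s i (fun w => ∑ a ∈ S, F a w) z = ∑ a ∈ S, wirt s i (F a) z := by
  simp only [wirt, fderiv_fun_sum hF, _root_.sum_apply, Finset.mul_sum,
    ← Finset.sum_add_distrib, Finset.sum_div]

theorem wirt_finset_prod {ι : Type*} [DecidableEq ι] {S : Finset ι} {F : ι → Cn n → ℂ}
    (hF : ∀ a ∈ S, DifferentiableAt ℝ (F a) z) :
    wirt s i (fun w => ∏ a ∈ S, F a w) z =
      ∑ a ∈ S, (∏ b ∈ S.erase a, F b z) * wirt s i (F a) z := by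
  simp only [wirt, fderiv_finsetProd hF, _root_.sum_apply,
    _root_.smul_apply, smul_eq_mul, Finset.mul_sum,
    ← Finset.sum_add_distrib, Finset.sum_div]
  exact Finset.sum_congr rfl fun a _ => by ring

theorem wirt_star : wirt s i (fun w => star (f w)) z = star (wirt (star s) i f z) := by
  have h : fderiv ℝ (fun w => star (f w)) z = Complex.conjCLE.toContinuousLinearMap ∘L fderiv ℝ f z :=
    Complex.conjCLE.comp_fderiv
  simp only [wirt, h]
  simp

theorem dz_star : dz i (fun w => star (f w)) z = star (dzbar i f z) := by
  rw [dz_eq_wirt, dzbar_eq_wirt, wirt_star]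
  simp

theorem dzbar_star : dzbar i (fun w => star (f w)) z = star (dz i f z) := by
  rw [dz_eq_wirt, dzbar_eq_wirt, wirt_star]
  simp

theorem dzbar_ofReal (φ : Cn n → ℝ) :
    dzbar i (fun w => (φ w : ℂ)) z = star (dz i (fun w => (φ w : ℂ)) z) := by
  rw [← dzbar_star]
  simp

theorem wirt_ofReal_comp {φ : Cn n → ℝ} {ψ : ℝ → ℝ} {ψ' : ℝ} (hφ : DifferentiableAt ℝ φ z)
    (hψ : HasDerivAt ψ ψ' (φ z)) :
    wirt s i (fun w => (ψ (φ w) : ℂ)) z = ψ' * wirt s i (fun w => (φ w : ℂ)) z := by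
  have h1 : HasFDerivAt (fun w => (ψ (φ w) : ℂ))
      (Complex.ofRealCLM ∘L (ψ' • fderiv ℝ φ z)) z :=
    Complex.ofRealCLM.hasFDerivAt.comp z (hψ.comp_hasFDerivAt z hφ.hasFDerivAt)
  have h2 : HasFDerivAt (fun w => (φ w : ℂ)) (Complex.ofRealCLM ∘L (fderiv ℝ φ z)) z :=
    Complex.ofRealCLM.hasFDerivAt.comp z hφ.hasFDerivAt
  simp only [wirt, h1.fderiv, h2.fderiv]
  simp
  ring

theorem fderiv_eq_sum_wirt (v : Cn n) :
    fderiv ℝ f z v = ∑ a, (v a * dz a f z + star (v a) * dzbar a f z) := by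
  have hv : v = ∑ a, ((v a).re • (Pi.single a 1 : Cn n) + (v a).im • (Pi.single a Complex.I : Cn n)) := by
    funext b
    simp [Finset.sum_apply, Pi.single_apply, Finset.sum_add_distrib, Complex.re_add_im]
  conv_lhs => rw [hv]
  simp only [map_sum, map_add, map_smul, dz, dzbar]
  refine Finset.sum_congr rfl fun a _ => ?_
  have h1 : star (v a) = (v a).re - (v a).im * Complex.I := by
    apply Complex.ext <;> simp
  rw [h1]
  nth_rewrite 3 [← Complex.re_add_im (v a)]
  simp only [Complex.real_smul]
  ring_nf
  rw [Complex.I_sq]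
  ring

end Wirtinger
-- Second-order calculus of Wirtinger derivatives.
section Smooth

variable {n : ℕ} {s t : ℂ} {i j : Fin n} {f g : Cn n → ℂ} {z : Cn n}

theorem _root_.ContDiffAt.eventually_differentiableAt {E F : Type*} [NormedAddCommGroup E]
    [NormedSpace ℝ E] [NormedAddCommGroup F] [NormedSpace ℝ F] {f : E → F} {z : E}
    (hf : ContDiffAt ℝ ∞ f z) : ∀ᶠ w in nhds z, DifferentiableAt ℝ f w :=
  ((hf.of_le (show (1 : ℕ∞ω) ≤ ∞ by exact_mod_cast le_top)).eventually (by simp)).mono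
    fun _ h => h.differentiableAt (by simp)

theorem _root_.ContDiffAt.diff {E F : Type*} [NormedAddCommGroup E]
    [NormedSpace ℝ E] [NormedAddCommGroup F] [NormedSpace ℝ F] {f : E → F} {z : E}
    (hf : ContDiffAt ℝ ∞ f z) : DifferentiableAt ℝ f z :=
  hf.differentiableAt (by simp)

theorem ContDiffAt.wirt (hf : ContDiffAt ℝ ∞ f z) : ContDiffAt ℝ ∞ (wirt s i f) z := by
  have h : ContDiffAt ℝ ∞ (fderiv ℝ f) z := hf.fderiv_right (by simp)
  unfold KahlerMA.wirt
  exact ((h.clm_apply contDiffAt_const).add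
    (contDiffAt_const.mul (h.clm_apply contDiffAt_const))).div_const _

theorem ContDiffAt.dz (hf : ContDiffAt ℝ ∞ f z) : ContDiffAt ℝ ∞ (dz i f) z := by
  rw [dz_eq_wirt]; exact ContDiffAt.wirt hf

theorem ContDiffAt.dzbar (hf : ContDiffAt ℝ ∞ f z) : ContDiffAt ℝ ∞ (dzbar i f) z :=
  ContDiffAt.wirt hf

/-- Finite order is deliberate: being C² at a point persists on a neighbourhood, so the identity
also holds near `z`, as is needed when it is differentiated again. -/
theorem wirt_comm_of_contDiffAt_two (hf : ContDiffAt ℝ 2 f z) :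
    wirt s i (wirt t j f) z = wirt t j (wirt s i f) z := by
  have hd : DifferentiableAt ℝ (fderiv ℝ f) z :=
    (hf.fderiv_right (m := 1) (by norm_num)).differentiableAt (by simp)
  have key : ∀ (r : ℂ) (k : Fin n) (v : Cn n), fderiv ℝ (wirt r k f) z v =
      (fderiv ℝ (fderiv ℝ f) z v (Pi.single k 1) +
        r * fderiv ℝ (fderiv ℝ f) z v (Pi.single k Complex.I)) / 2 := by
    intro r k v
    have h1 : ∀ u : Cn n, HasFDerivAt (fun w => fderiv ℝ f w u)
        ((fderiv ℝ (fderiv ℝ f) z).flip u) z := fun u => by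
      simpa using hd.hasFDerivAt.clm_apply (hasFDerivAt_const u z)
    have h2 := (((h1 (Pi.single k 1)).add ((h1 (Pi.single k Complex.I)).const_mul r)).mul_const
      ((2 : ℂ)⁻¹))
    have h3 : wirt r k f = fun w => (fderiv ℝ f w (Pi.single k 1) +
      r * fderiv ℝ f w (Pi.single k Complex.I)) * (2 : ℂ)⁻¹ := by
      funext w; simp only [wirt, div_eq_mul_inv]
    rw [h3]
    refine (congrArg (fun T : Cn n →L[ℝ] ℂ => T v) h2.fderiv).trans ?_
    simp
    ring
  have hsymm : IsSymmSndFDerivAt ℝ f z := hf.isSymmSndFDerivAt (by simp)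
  rw [wirt, wirt, key, key, key, key, hsymm (Pi.single j 1) (Pi.single i 1),
    hsymm (Pi.single j 1) (Pi.single i Complex.I), hsymm (Pi.single j Complex.I) (Pi.single i 1),
    hsymm (Pi.single j Complex.I) (Pi.single i Complex.I)]
  ring

theorem wirt_comm_eventuallyEq (hf : ContDiffAt ℝ ∞ f z) :
    wirt s i (wirt t j f) =ᶠ[nhds z] wirt t j (wirt s i f) :=
  ((hf.of_le (show ((2 : ℕ∞) : ℕ∞ω) ≤ ∞ by exact_mod_cast le_top)).eventually (by simp)).mono
    fun _ h => wirt_comm_of_contDiffAt_two h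

theorem wirt_comm (hf : ContDiffAt ℝ ∞ f z) :
    wirt s i (wirt t j f) z = wirt t j (wirt s i f) z :=
  (wirt_comm_eventuallyEq hf).self_of_nhds

theorem dz_dzbar_star (hf : ContDiffAt ℝ ∞ f z) :
    dz i (dzbar i (fun w => star (f w))) z = star (dz i (dzbar i f) z) := by
  have h : dzbar i (fun w => star (f w)) = fun w => star (dz i f w) := by
    funext w; exact dzbar_star
  rw [h, dz_star, dz_eq_wirt, dzbar_eq_wirt, wirt_comm hf]

theorem wirt_wirt_mul (hf : ContDiffAt ℝ ∞ f z) (hg : ContDiffAt ℝ ∞ g z) :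
    wirt s i (wirt t j (fun w => f w * g w)) z =
      wirt s i (wirt t j f) z * g z + wirt t j f z * wirt s i g z +
        wirt s i f z * wirt t j g z + f z * wirt s i (wirt t j g) z := by
  have h : wirt t j (fun w => f w * g w) =ᶠ[nhds z]
      fun w => wirt t j f w * g w + f w * wirt t j g w := by
    filter_upwards [hf.eventually_differentiableAt, hg.eventually_differentiableAt] with w h1 h2
    exact wirt_mul h1 h2
  have h1 := (ContDiffAt.wirt (s := t) (i := j) hf).diff
  have h2 := (ContDiffAt.wirt (s := t) (i := j) hg).diff
  rw [wirt_congr h, wirt_add (h1.fun_mul hg.diff) (hf.diff.fun_mul h2), wirt_mul h1 hg.diff,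
    wirt_mul hf.diff h2]
  ring

theorem wirt_wirt_add (hf : ContDiffAt ℝ ∞ f z) (hg : ContDiffAt ℝ ∞ g z) :
    wirt s i (wirt t j (fun w => f w + g w)) z =
      wirt s i (wirt t j f) z + wirt s i (wirt t j g) z := by
  have h : wirt t j (fun w => f w + g w) =ᶠ[nhds z]
      fun w => wirt t j f w + wirt t j g w := by
    filter_upwards [hf.eventually_differentiableAt, hg.eventually_differentiableAt] with w h1 h2
    exact wirt_add h1 h2
  rw [wirt_congr h, wirt_add (ContDiffAt.wirt hf).diff (ContDiffAt.wirt hg).diff]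

theorem wirt_wirt_sub (hf : ContDiffAt ℝ ∞ f z) (hg : ContDiffAt ℝ ∞ g z) :
    wirt s i (wirt t j (fun w => f w - g w)) z =
      wirt s i (wirt t j f) z - wirt s i (wirt t j g) z := by
  have h : wirt t j (fun w => f w - g w) =ᶠ[nhds z]
      fun w => wirt t j f w - wirt t j g w := by
    filter_upwards [hf.eventually_differentiableAt, hg.eventually_differentiableAt] with w h1 h2
    exact wirt_sub h1 h2
  rw [wirt_congr h, wirt_sub (ContDiffAt.wirt hf).diff (ContDiffAt.wirt hg).diff]

theorem wirt_wirt_const_mul (c : ℂ) (hf : ContDiffAt ℝ ∞ f z) :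
    wirt s i (wirt t j (fun w => c * f w)) z = c * wirt s i (wirt t j f) z := by
  have h : wirt t j (fun w => c * f w) =ᶠ[nhds z] fun w => c * wirt t j f w :=
    hf.eventually_differentiableAt.mono fun w h1 => wirt_const_mul c h1
  rw [wirt_congr h, wirt_const_mul c (ContDiffAt.wirt hf).diff]

theorem wirt_wirt_sum {ι : Type*} {S : Finset ι} {F : ι → Cn n → ℂ}
    (hF : ∀ a ∈ S, ContDiffAt ℝ ∞ (F a) z) :
    wirt s i (wirt t j (fun w => ∑ a ∈ S, F a w)) z = ∑ a ∈ S, wirt s i (wirt t j (F a)) z := by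
  have h : wirt t j (fun w => ∑ a ∈ S, F a w) =ᶠ[nhds z] fun w => ∑ a ∈ S, wirt t j (F a) w := by
    have h0 : ∀ᶠ w in nhds z, ∀ a ∈ S, DifferentiableAt ℝ (F a) w :=
      (Finset.eventually_all S).2 fun a ha => (hF a ha).eventually_differentiableAt
    exact h0.mono fun w h1 => wirt_sum h1
  rw [wirt_congr h, wirt_sum fun a ha => (ContDiffAt.wirt (hF a ha)).diff]

theorem wirt_wirt_ofReal_comp {φ : Cn n → ℝ} {ψ ψ' : ℝ → ℝ} {ψ'' : ℝ} (hφ : ContDiffAt ℝ ∞ φ z)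
    (hψ : ∀ᶠ r in nhds (φ z), HasDerivAt ψ (ψ' r) r) (hψ' : HasDerivAt ψ' ψ'' (φ z)) :
    wirt s i (wirt t j (fun w => (ψ (φ w) : ℂ))) z =
      ψ'' * wirt s i (fun w => (φ w : ℂ)) z * wirt t j (fun w => (φ w : ℂ)) z +
        ψ' (φ z) * wirt s i (wirt t j (fun w => (φ w : ℂ))) z := by
  have h : wirt t j (fun w => (ψ (φ w) : ℂ)) =ᶠ[nhds z]
      fun w => (ψ' (φ w) : ℂ) * wirt t j (fun w => (φ w : ℂ)) w := by
    filter_upwards [hφ.eventually_differentiableAt, hφ.continuousAt.eventually hψ] with w h1 h2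
    exact wirt_ofReal_comp h1 h2
  have h1 : ContDiffAt ℝ ∞ (fun w => (φ w : ℂ)) z :=
    Complex.ofRealCLM.contDiff.contDiffAt.comp z hφ
  have h2 : DifferentiableAt ℝ (fun w => (ψ' (φ w) : ℂ)) z :=
    Complex.ofRealCLM.differentiableAt.comp z (hψ'.differentiableAt.comp z hφ.diff)
  rw [wirt_congr h, wirt_mul h2 (ContDiffAt.wirt h1).diff, wirt_ofReal_comp hφ.diff hψ']

/-- Product rule for a product of three functions, two of which vanish at the point. -/
theorem wirt_wirt_mul_of_eq_zero {a : Cn n → ℂ} (ha : ContDiffAt ℝ ∞ a z) (hf : ContDiffAt ℝ ∞ f z)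
    (hg : ContDiffAt ℝ ∞ g z) (hf0 : f z = 0) (hg0 : g z = 0) :
    wirt s i (wirt t j (fun w => a w * (f w * g w))) z =
      a z * (wirt t j f z * wirt s i g z + wirt s i f z * wirt t j g z) := by
  rw [wirt_wirt_mul ha (hf.mul hg), wirt_mul hf.diff hg.diff, wirt_mul hf.diff hg.diff,
    wirt_wirt_mul hf hg, hf0, hg0]
  ring

end Smooth

/-! ### Holomorphic changes of coordinates. -/

section Holomorphic

variable {n : ℕ} {i j : Fin n} {f : Cn n → ℂ} {τ : Cn n → Cn n} {z : Cn n}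

theorem fderiv_comp_holomorphic (hτ : DifferentiableAt ℂ τ z) (hf : DifferentiableAt ℝ f (τ z))
    (v : Cn n) : fderiv ℝ (fun w => f (τ w)) z v =
      ∑ a, (fderiv ℂ τ z v a * dz a f (τ z) + star (fderiv ℂ τ z v a) * dzbar a f (τ z)) := by
  have h1 : HasFDerivAt τ ((fderiv ℂ τ z).restrictScalars ℝ) z :=
    hτ.hasFDerivAt.restrictScalars ℝ
  have h2 := hf.hasFDerivAt.comp z h1
  rw [show (fun w => f (τ w)) = f ∘ τ from rfl, h2.fderiv]
  exact fderiv_eq_sum_wirt _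

theorem single_I (i : Fin n) :
    (Pi.single i Complex.I : Cn n) = Complex.I • (Pi.single i 1 : Cn n) := by
  rw [← Pi.single_smul]; simp

theorem dz_comp_holomorphic (hτ : DifferentiableAt ℂ τ z) (hf : DifferentiableAt ℝ f (τ z)) :
    dz i (fun w => f (τ w)) z = ∑ a, jacobian τ z a i * dz a f (τ z) := by
  rw [dz, fderiv_comp_holomorphic hτ hf, fderiv_comp_holomorphic hτ hf, Finset.mul_sum,
    ← Finset.sum_sub_distrib, Finset.sum_div]
  refine Finset.sum_congr rfl fun a _ => ?_
  rw [single_I, map_smul]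
  simp only [jacobian, Matrix.of_apply, Pi.smul_apply, smul_eq_mul, star_mul', Complex.star_def,
    Complex.conj_I]
  ring_nf
  rw [Complex.I_sq]
  ring

theorem dzbar_comp_holomorphic (hτ : DifferentiableAt ℂ τ z) (hf : DifferentiableAt ℝ f (τ z)) :
    dzbar i (fun w => f (τ w)) z = ∑ a, star (jacobian τ z a i) * dzbar a f (τ z) := by
  rw [dzbar, fderiv_comp_holomorphic hτ hf, fderiv_comp_holomorphic hτ hf, Finset.mul_sum,
    ← Finset.sum_add_distrib, Finset.sum_div]
  refine Finset.sum_congr rfl fun a _ => ?_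
  rw [single_I, map_smul]
  simp only [jacobian, Matrix.of_apply, Pi.smul_apply, smul_eq_mul, star_mul', Complex.star_def,
    Complex.conj_I]
  ring_nf
  rw [Complex.I_sq]
  ring

/-- The Cauchy–Riemann equations; this is what removes second derivatives of coordinate changes
below. -/
theorem dz_star_of_holomorphic {u : Cn n → ℂ} (hu : DifferentiableAt ℂ u z) :
    dz i (fun w => star (u w)) z = 0 := by
  rw [dz_star, dzbar, (hu.hasFDerivAt.restrictScalars ℝ).fderiv, single_I]
  simp only [ContinuousLinearMap.coe_restrictScalars', map_smul, smul_eq_mul, ← mul_assoc,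
    Complex.I_mul_I]
  simp

/-- The factors of ∂_j̄ (f ∘ τ) that come from τ are conjugates of holomorphic functions, hence
killed by ∂_i. No second derivative of τ survives, and the complex Hessian is a tensor without any
connection. -/
theorem complexHessian_comp_holomorphic (hτ : ∀ᶠ w in nhds z, DifferentiableAt ℂ τ w)
    (hτ' : ContDiffAt ℂ ∞ τ z) (hf : ContDiffAt ℝ ∞ f (τ z)) :
    complexHessian (fun w => f (τ w)) z = (jacobian τ z).transpose * complexHessian f (τ z) *
      (jacobian τ z).map (starRingEnd ℂ) := by
  ext i j
  have hτz := hτ.self_of_nhds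
  have hjac : ∀ a, ContDiffAt ℂ ∞ (fun w => jacobian τ w a j) z := fun a => by
    have h : ContDiffAt ℂ ∞ (fderiv ℂ τ) z := hτ'.fderiv_right (by simp)
    exact contDiffAt_pi.1 (h.clm_apply contDiffAt_const) a
  have h1 : dzbar j (fun w => f (τ w)) =ᶠ[nhds z]
      fun w => ∑ a, star (jacobian τ w a j) * dzbar a f (τ w) := by
    filter_upwards [hτ, hτz.continuousAt.eventually hf.eventually_differentiableAt] with w h1 h2
    exact dzbar_comp_holomorphic h1 h2
  have hτR : DifferentiableAt ℝ τ z := hτz.restrictScalars ℝ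
  have hj2 : ∀ a, DifferentiableAt ℝ (fun w => star (jacobian τ w a j)) z := fun a =>
    Complex.conjCLE.differentiableAt.comp z
      (((hjac a).differentiableAt (by simp)).restrictScalars ℝ)
  have hf2 : ∀ a, DifferentiableAt ℝ (dzbar a f) (τ z) := fun a => (ContDiffAt.dzbar hf).diff
  have hf3 : ∀ a, DifferentiableAt ℝ (fun w => dzbar a f (τ w)) z := fun a =>
    (hf2 a).comp z hτR
  have key : ∀ a, dz i (fun w => star (jacobian τ w a j) * dzbar a f (τ w)) z =
      star (jacobian τ z a j) * ∑ b, jacobian τ z b i * dz b (dzbar a f) (τ z) := by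
    intro a
    rw [dz_eq_wirt, wirt_mul (hj2 a) (hf3 a), ← dz_eq_wirt,
      dz_star_of_holomorphic ((hjac a).differentiableAt (by simp)),
      dz_comp_holomorphic hτz (hf2 a)]
    simp
  rw [complexHessian, Matrix.of_apply, dz_eq_wirt, wirt_congr h1,
    wirt_sum fun a _ => (hj2 a).fun_mul (hf3 a)]
  simp only [← dz_eq_wirt, key, Matrix.mul_apply, Matrix.transpose_apply, Matrix.map_apply,
    complexHessian, Matrix.of_apply, Finset.sum_mul, Finset.mul_sum]
  refine Finset.sum_congr rfl fun a _ => Finset.sum_congr rfl fun b _ => ?_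
  simp only [starRingEnd_apply]
  ring

end Holomorphic

/-! ### Smoothness of determinants, cofactors and inverses. -/

section MatrixCalculus

variable {E : Type*} [NormedAddCommGroup E] [NormedSpace ℝ E] {m : ℕ}
  {A : E → Matrix (Fin m) (Fin m) ℂ} {z : E}

theorem contDiffAt_det (hA : ∀ a b, ContDiffAt ℝ ∞ (fun w => A w a b) z) :
    ContDiffAt ℝ ∞ (fun w => (A w).det) z := by
  simp only [Matrix.det_apply']
  exact ContDiffAt.sum fun σ _ => contDiffAt_const.mul (contDiffAt_prod fun a _ => hA _ _)

theorem contDiffAt_adjugate (hA : ∀ a b, ContDiffAt ℝ ∞ (fun w => A w a b) z) (i j : Fin m) :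
    ContDiffAt ℝ ∞ (fun w => (A w).adjugate i j) z := by
  simp only [Matrix.adjugate_apply]
  refine contDiffAt_det fun a b => ?_
  by_cases h : a = j
  · subst h; simpa using contDiffAt_const
  · simpa [Matrix.updateRow_ne h] using hA a b

theorem contDiffAt_inv_matrix (hA : ∀ a b, ContDiffAt ℝ ∞ (fun w => A w a b) z)
    (h0 : (A z).det ≠ 0) (i j : Fin m) : ContDiffAt ℝ ∞ (fun w => (A w)⁻¹ i j) z := by
  have h : (fun w => (A w)⁻¹ i j) = fun w => ((A w).det)⁻¹ * (A w).adjugate i j := by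
    funext w
    simp [Matrix.inv_def, Ring.inverse_eq_inv']
  rw [h]
  exact ((contDiffAt_det hA).inv h0).mul (contDiffAt_adjugate hA i j)

end MatrixCalculus

/-! ### Jacobi's formula and the divergence of the cofactor matrix. -/

section WirtingerMatrix

variable {n m : ℕ} {s : ℂ} {A : Cn n → Matrix (Fin m) (Fin m) ℂ} {z : Cn n}

/-- Jacobi's formula. -/
theorem wirt_det (i : Fin n) (hA : ∀ a b, DifferentiableAt ℝ (fun w => A w a b) z) :
    wirt s i (fun w => (A w).det) z =
      ((A z).adjugate * Matrix.of fun a b => wirt s i (fun w => A w a b) z).trace := by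
  set D : Matrix (Fin m) (Fin m) ℂ := Matrix.of fun a b => wirt s i (fun w => A w a b) z with hD
  have h1 : ∀ σ : Equiv.Perm (Fin m), DifferentiableAt ℝ (fun w => ∏ a, A w (σ a) a) z := fun σ =>
    (HasFDerivAt.finsetProd fun a _ => (hA (σ a) a).hasFDerivAt).differentiableAt
  -- Cramer's rule: a diagonal entry is the determinant with one column differentiated, which
  -- matches the product rule in the Leibniz expansion.
  have h2 : ∀ k : Fin m, ((A z).adjugate * D) k k = ((A z).updateCol k (fun a => D a k)).det := by
    intro k
    rw [← Matrix.cramer_apply, Matrix.cramer_eq_adjugate_mulVec]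
    rfl
  simp only [Matrix.trace, Matrix.diag, h2]
  simp only [Matrix.det_apply']
  rw [wirt_sum fun σ _ => (h1 σ).const_mul _, Finset.sum_comm]
  refine Finset.sum_congr rfl fun σ _ => ?_
  rw [wirt_const_mul _ (h1 σ), wirt_finset_prod fun a _ => hA _ _, Finset.mul_sum]
  refine Finset.sum_congr rfl fun k _ => ?_
  congr 1
  rw [← Finset.mul_prod_erase _ _ (Finset.mem_univ k), Matrix.updateCol_self, mul_comm]
  congr 1
  refine Finset.prod_congr rfl fun b hb => ?_
  rw [Matrix.updateCol_ne (Finset.ne_of_mem_erase hb)]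

/-- The cofactor matrix of a Kähler metric is divergence free. -/
theorem sum_dz_adjugate_eq_zero {A : Cn n → Matrix (Fin n) (Fin n) ℂ}
    (hA : ∀ a b, ContDiffAt ℝ ∞ (fun w => A w a b) z) (h0 : (A z).det ≠ 0)
    (hK : ∀ i j k, dz k (fun w => A w i j) z = dz i (fun w => A w k j) z) (j : Fin n) :
    ∑ i, dz i (fun w => (A w).adjugate j i) z = 0 := by
  set D : Fin n → Matrix (Fin n) (Fin n) ℂ := fun i =>
    Matrix.of fun a b => dz i (fun w => A w a b) z with hD
  set X : Fin n → Matrix (Fin n) (Fin n) ℂ := fun i =>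
    Matrix.of fun a b => dz i (fun w => (A w).adjugate a b) z with hX
  have hadj := fun a b => (contDiffAt_adjugate hA a b).diff
  have hA' := fun a b => (hA a b).diff
  have hu : IsUnit (A z).det := isUnit_iff_ne_zero.2 h0
  -- This is the derivative of adj(A) A = det(A) 1, with Jacobi's formula on the right; solving for
  -- the derivative of adj(A) gives `h4`.
  have h1 : ∀ i, X i * A z + (A z).adjugate * D i = (((A z).adjugate * D i).trace) • 1 := by
    intro i
    ext a b
    have h2 : (fun w => ∑ c, (A w).adjugate a c * A w c b) =
        fun w => (1 : Matrix (Fin n) (Fin n) ℂ) a b * (A w).det := by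
      funext w
      rw [← Matrix.mul_apply, Matrix.adjugate_mul, Matrix.smul_apply, smul_eq_mul, mul_comm]
    have h3 : wirt (-Complex.I) i (fun w => ∑ c, (A w).adjugate a c * A w c b) z =
        wirt (-Complex.I) i (fun w => (1 : Matrix (Fin n) (Fin n) ℂ) a b * (A w).det) z := by
      rw [h2]
    rw [wirt_sum fun c _ => (hadj a c).fun_mul (hA' c b),
      wirt_const_mul _ (contDiffAt_det hA).diff, wirt_det i hA'] at h3
    simp only [wirt_mul (hadj _ _) (hA' _ _), Finset.sum_add_distrib, ← dz_eq_wirt] at h3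
    rw [Matrix.add_apply, Matrix.mul_apply, Matrix.mul_apply, Matrix.smul_apply, smul_eq_mul,
      mul_comm (Matrix.trace _)]
    exact h3
  have h4 : ∀ i, X i = (A z).det • ((((A z)⁻¹ * D i).trace) • (A z)⁻¹ - (A z)⁻¹ * D i * (A z)⁻¹) := by
    intro i
    have h5 : (A z).adjugate = (A z).det • (A z)⁻¹ := by
      rw [Matrix.inv_def, smul_smul, Ring.mul_inverse_cancel _ hu, one_smul]
    have h6 : X i * A z = (((A z).adjugate * D i).trace) • 1 - (A z).adjugate * D i :=
      eq_sub_of_add_eq (h1 i)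
    have h7 : X i = (X i * A z) * (A z)⁻¹ := by
      rw [Matrix.mul_assoc, Matrix.mul_nonsing_inv _ hu, Matrix.mul_one]
    rw [h7, h6, h5]
    simp only [Matrix.smul_mul, Matrix.trace_smul, Matrix.sub_mul, Matrix.one_mul, smul_sub,
      smul_smul, smul_eq_mul]
  -- Closedness of the Kähler form. The two double traces in the divergence differ only by
  -- exchanging `i` and `a` in `D`, so they cancel.
  have h8 : ∀ i a b, D i a b = D a i b := fun i a b => hK a b i
  calc ∑ i, dz i (fun w => (A w).adjugate j i) z = ∑ i, X i j i := rfl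
    _ = (A z).det * (∑ i, ∑ b, ∑ a, (A z)⁻¹ b a * D i a b * (A z)⁻¹ j i -
          ∑ i, ∑ b, ∑ a, (A z)⁻¹ j a * D i a b * (A z)⁻¹ b i) := by
        simp only [h4, Matrix.smul_apply, Matrix.sub_apply, smul_eq_mul, ← Finset.mul_sum,
          Finset.sum_sub_distrib, Matrix.trace, Matrix.diag, Matrix.mul_apply, Finset.sum_mul]
    _ = 0 := by
        rw [mul_eq_zero]
        right
        rw [sub_eq_zero, Finset.sum_comm]
        conv_rhs => rw [Finset.sum_comm]
        refine Finset.sum_congr rfl fun b _ => ?_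
        rw [Finset.sum_comm]
        refine Finset.sum_congr rfl fun a _ => Finset.sum_congr rfl fun i _ => ?_
        rw [h8 i a b]
        ring

end WirtingerMatrix

/-! ### Pointwise algebra of the Bochner inequality. -/

section LocalInequality

variable {n : ℕ}

/-- The matrix `∂_i f ∂_j̄ f` of a real function `f`. -/
def gradMatrix (f : Cn n → ℂ) (z : Cn n) : Matrix (Fin n) (Fin n) ℂ :=
  Matrix.of fun i j => dz i f z * dzbar j f z

theorem trace_inv_mul_gradMatrix (G : Matrix (Fin n) (Fin n) ℂ) (φ : Cn n → ℝ) (z : Cn n) :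
    (G⁻¹ * gradMatrix (fun w => (φ w : ℂ)) z).trace =
      star (fun a => dz a (fun w => (φ w : ℂ)) z) ⬝ᵥ
        (G⁻¹.mulVec fun a => dz a (fun w => (φ w : ℂ)) z) := by
  simp only [Matrix.trace, Matrix.diag, Matrix.mul_apply, gradMatrix, Matrix.of_apply, dotProduct,
    Matrix.mulVec, Pi.star_apply, Finset.mul_sum, dzbar_ofReal]
  exact Finset.sum_congr rfl fun a _ => Finset.sum_congr rfl fun b _ => by ring

/-- Completing the square in `e^α |∂φ|²`. -/
theorem weighted_grad_decomposition {G : Matrix (Fin n) (Fin n) ℂ} (hG : G.PosDef)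
    (p c : Fin n → ℂ) {E E' : ℂ} (hE : E * E' = 1) (hE' : star E' = E') :
    E' * (star p ⬝ᵥ (G⁻¹.mulVec p)) =
      ∑ a, (star (p a) * c a + star (c a) * p a) - E * ∑ a, ∑ b, star (c a) * G a b * c b +
        ∑ a, ∑ b, (E * G⁻¹ a b) *
          (star (E' * p a - ∑ d, G a d * c d) * (E' * p b - ∑ d, G b d * c d)) := by
  have hu : IsUnit G.det := (Matrix.isUnit_iff_isUnit_det _).1 hG.isUnit
  -- The remainder is E times the G⁻¹-square of E' p - G c. Expanding it with E E' = 1 returns the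
  -- left side plus the linear and quadratic terms in c.
  have h1 : ∑ a, ∑ b, (E * G⁻¹ a b) *
      (star (E' * p a - ∑ d, G a d * c d) * (E' * p b - ∑ d, G b d * c d)) =
      E * (star (E' • p - G.mulVec c) ⬝ᵥ (G⁻¹.mulVec (E' • p - G.mulVec c))) := by
    simp only [dotProduct, Matrix.mulVec, Finset.mul_sum, Pi.star_apply, Pi.sub_apply,
      Pi.smul_apply, smul_eq_mul]
    exact Finset.sum_congr rfl fun a _ => Finset.sum_congr rfl fun b _ => by ring
  have h2 : ∑ a, ∑ b, star (c a) * G a b * c b = star c ⬝ᵥ G.mulVec c := by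
    simp only [dotProduct, Matrix.mulVec, Finset.mul_sum, Pi.star_apply, mul_assoc]
  have h3 : ∑ a, (star (p a) * c a + star (c a) * p a) = star p ⬝ᵥ c + star c ⬝ᵥ p := by
    simp only [dotProduct, Finset.sum_add_distrib, Pi.star_apply]
  have h4 : G⁻¹.mulVec (G.mulVec c) = c := by
    rw [Matrix.mulVec_mulVec, Matrix.nonsing_inv_mul _ hu, Matrix.one_mulVec]
  have h5 : star (G.mulVec c) ⬝ᵥ (G⁻¹.mulVec p) = star c ⬝ᵥ p := by
    rw [Matrix.star_mulVec, ← Matrix.dotProduct_mulVec, Matrix.mulVec_mulVec, hG.isHermitian.eq,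
      Matrix.mul_nonsing_inv _ hu, Matrix.one_mulVec]
  have h6 : star (G.mulVec c) ⬝ᵥ c = star c ⬝ᵥ G.mulVec c := by
    rw [Matrix.star_mulVec, ← Matrix.dotProduct_mulVec, hG.isHermitian.eq]
  rw [h1, h2, h3, Matrix.mulVec_sub, h4, Matrix.mulVec_smul, star_sub, star_smul, hE',
    sub_dotProduct, dotProduct_sub, dotProduct_sub, h6]
  simp only [smul_dotProduct, dotProduct_smul, smul_eq_mul, h5]
  linear_combination (star p ⬝ᵥ c + star c ⬝ᵥ p - E' * (star p ⬝ᵥ G⁻¹.mulVec p)) * hE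


/-- The contribution of one direction to the gradient estimate, in a frame in which both metrics are
diagonal. -/
theorem gradient_algebra_direction (p T S γ : Fin n → ℂ) (R : ℂ) (k : Fin n) (l u α' α'' : ℝ)
    (hu : u = ∑ a, Complex.normSq (p a)) :
    2 * (∑ a, star (p a) * T a).re + α'' * Complex.normSq (p k) * u + α' * (l - 1) * u - R.re +
        (l - 1) ^ 2 + 2 * (l - 1) * (α' * Complex.normSq (p k) - (γ k).re) ≤
      (∑ a, (star (T a) * p a + star (p a) * T a) -
        (((α' ^ 2 - α'' : ℝ) * (p k * star (p k)) - (α' * (l - 1) : ℝ)) * (u : ℂ) -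
          α' * (p k * ∑ a, star (p a) * γ a + star (p k * ∑ a, star (p a) * γ a)) + R) +
        ∑ a, (star (S a) * S a + star ((if a = k then ((l - 1 : ℝ) : ℂ) else 0) +
            α' * (p a * star (p k)) - γ a) * ((if a = k then ((l - 1 : ℝ) : ℂ) else 0) +
            α' * (p a * star (p k)) - γ a))).re := by
  have hN : ∀ z : ℂ, star z * z = (Complex.normSq z : ℂ) := fun z => by
    rw [Complex.star_def, ← Complex.normSq_eq_conj_mul_self]
  have hN' : ∀ z : ℂ, z * star z = (Complex.normSq z : ℂ) := fun z => by rw [mul_comm, hN]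
  have h1 : (∑ a, (star (T a) * p a + star (p a) * T a)).re = 2 * (∑ a, star (p a) * T a).re := by
    simp only [Complex.re_sum, Finset.mul_sum]
    refine Finset.sum_congr rfl fun a _ => ?_
    simp
    ring
  -- Expand the squares and discard only |γ a|². The α'² terms and the mixed α' γ terms produced
  -- here cancel those in the statement; the diagonal entry a = k contributes the terms with l - 1.
  have h2 : ∑ a, (α' ^ 2 * Complex.normSq (p a) * Complex.normSq (p k) -
      2 * α' * (p k * (star (p a) * γ a)).re) +
      2 * (l - 1) * (α' * Complex.normSq (p k) - (γ k).re) + (l - 1) ^ 2 ≤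
      ∑ a, Complex.normSq ((if a = k then ((l - 1 : ℝ) : ℂ) else 0) +
            α' * (p a * star (p k)) - γ a) := by
    have h3 : 2 * (l - 1) * (α' * Complex.normSq (p k) - (γ k).re) + (l - 1) ^ 2 =
        ∑ a, if a = k then 2 * (l - 1) * (α' * Complex.normSq (p a) - (γ a).re) + (l - 1) ^ 2
          else 0 := by simp
    rw [add_assoc, h3, ← Finset.sum_add_distrib]
    refine Finset.sum_le_sum fun a _ => ?_
    have h4 : 0 ≤ Complex.normSq (γ a) := Complex.normSq_nonneg _
    split_ifs with h
    · subst h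
      simp only [Complex.normSq_apply, Complex.sub_re, Complex.add_re, Complex.mul_re,
        Complex.ofReal_re, Complex.ofReal_im, Complex.star_def, Complex.conj_re, Complex.conj_im,
        Complex.sub_im, Complex.add_im, Complex.mul_im] at h4 ⊢
      nlinarith [h4]
    · simp only [Complex.normSq_apply, Complex.sub_re, Complex.add_re, Complex.mul_re,
        Complex.ofReal_re, Complex.ofReal_im, Complex.star_def, Complex.conj_re, Complex.conj_im,
        Complex.sub_im, Complex.add_im, Complex.mul_im, Complex.zero_re, Complex.zero_im] at h4 ⊢
      nlinarith [h4]
  -- The squares of the (2,0) second derivatives are simply dropped.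
  have h5 : 0 ≤ ∑ a, Complex.normSq (S a) := Finset.sum_nonneg fun a _ => Complex.normSq_nonneg _
  have h6 : ∑ a, (α' ^ 2 * Complex.normSq (p a) * Complex.normSq (p k) -
      2 * α' * (p k * (star (p a) * γ a)).re) =
      α' ^ 2 * u * Complex.normSq (p k) - 2 * α' * (p k * ∑ a, star (p a) * γ a).re := by
    have h8 : (p k * ∑ a, star (p a) * γ a).re = ∑ a, (p k * (star (p a) * γ a)).re := by
      rw [Finset.mul_sum, Complex.re_sum]
    rw [h8, Finset.sum_sub_distrib, ← Finset.sum_mul, ← Finset.mul_sum, ← Finset.mul_sum, ← hu]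
  rw [h6] at h2
  simp only [hN, hN', Finset.sum_add_distrib, ← Complex.ofReal_sum, Complex.add_re, Complex.sub_re,
    Complex.ofReal_re, Complex.re_ofReal_mul, ← Complex.ofReal_mul, ← Complex.ofReal_sub] at h1 ⊢
  have h7 : (star (p k * ∑ a, star (p a) * γ a)).re = (p k * ∑ a, star (p a) * γ a).re := by
    rw [Complex.star_def, Complex.conj_re]
  rw [h7]
  linarith

/-- The algebra behind the gradient estimate, in a frame in which both metrics are diagonal. -/
theorem gradient_algebra (p f : Fin n → ℂ) (T γ : Fin n → Fin n → ℂ) (R : Fin n → ℂ)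
    (l : Fin n → ℝ) (hl : ∀ k, 0 < l k) (u α' α'' : ℝ) (hu : u = ∑ a, Complex.normSq (p a))
    (hT : ∀ a, ∑ k, ((l k)⁻¹ : ℝ) * T k a =
      f a + ∑ k, (1 - ((l k)⁻¹ : ℝ) : ℂ) * γ k a)
    (g : Fin n → ℂ) (hg : ∀ k, ∑ a, star (p a) * γ k a = star (g k)) (b : Fin n → ℝ)
    (hb : ∀ k, 2 * (∑ a, star (p a) * T k a).re + α'' * Complex.normSq (p k) * u +
        α' * (l k - 1) * u - (R k).re + (l k - 1) ^ 2 +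
        2 * (l k - 1) * (α' * Complex.normSq (p k) - (g k).re) ≤ b k) :
    ∑ k, l k + ∑ k, (l k)⁻¹ - 2 * n + (n + 2) * α' * u +
        (α'' * u - 2 * α') * ∑ k, (l k)⁻¹ * Complex.normSq (p k) - α' * u * ∑ k, (l k)⁻¹ +
        2 * (∑ a, star (p a) * f a).re - ∑ k, (l k)⁻¹ * (R k).re ≤
      ∑ k, (l k)⁻¹ * b k := by
  -- Weighted by 1/l, the third derivatives turn into derivatives of F plus (1 - 1/l) g. The latter
  -- cancels exactly against -2 (l - 1) g in `hb`, so the first derivatives of the metric disappear.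
  have h1 : ∑ k, (l k)⁻¹ * (∑ a, star (p a) * T k a).re =
      (∑ a, star (p a) * f a).re + ∑ k, (1 - (l k)⁻¹) * (g k).re := by
    have h2 : ∑ k, (((l k)⁻¹ : ℝ) : ℂ) * ∑ a, star (p a) * T k a =
        ∑ a, star (p a) * f a + ∑ k, (1 - ((l k)⁻¹ : ℝ) : ℂ) * star (g k) := by
      calc ∑ k, (((l k)⁻¹ : ℝ) : ℂ) * ∑ a, star (p a) * T k a
          = ∑ a, star (p a) * ∑ k, (((l k)⁻¹ : ℝ) : ℂ) * T k a := by
            simp only [Finset.mul_sum]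
            rw [Finset.sum_comm]
            exact Finset.sum_congr rfl fun a _ => Finset.sum_congr rfl fun k _ => by ring
        _ = _ := by
            simp only [hT, mul_add, Finset.sum_add_distrib, ← hg, Finset.mul_sum]
            congr 1
            rw [Finset.sum_comm]
            exact Finset.sum_congr rfl fun a _ => Finset.sum_congr rfl fun k _ => by ring
    have h3 := congrArg Complex.re h2
    rw [Complex.re_sum, Complex.add_re, Complex.re_sum] at h3
    simp only [← Complex.ofReal_one, ← Complex.ofReal_sub, Complex.re_ofReal_mul] at h3
    simpa using h3
  have h4 : ∑ k, (l k)⁻¹ * (2 * (∑ a, star (p a) * T k a).re + α'' * Complex.normSq (p k) * u +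
        α' * (l k - 1) * u - (R k).re + (l k - 1) ^ 2 +
        2 * (l k - 1) * (α' * Complex.normSq (p k) - (g k).re)) ≤ ∑ k, (l k)⁻¹ * b k :=
    Finset.sum_le_sum fun k _ => mul_le_mul_of_nonneg_left (hb k) (inv_nonneg.2 (hl k).le)
  refine le_trans (le_of_eq ?_) h4
  have h5 : ∀ k, (l k)⁻¹ * (2 * (∑ a, star (p a) * T k a).re + α'' * Complex.normSq (p k) * u +
        α' * (l k - 1) * u - (R k).re + (l k - 1) ^ 2 +
        2 * (l k - 1) * (α' * Complex.normSq (p k) - (g k).re)) =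
      2 * ((l k)⁻¹ * (∑ a, star (p a) * T k a).re) +
        (α'' * u - 2 * α') * ((l k)⁻¹ * Complex.normSq (p k)) + α' * u - α' * u * (l k)⁻¹ -
        (l k)⁻¹ * (R k).re + l k - 2 + (l k)⁻¹ + 2 * α' * Complex.normSq (p k) -
        2 * ((1 - (l k)⁻¹) * (g k).re) := by
    intro k
    have := (hl k).ne'
    field_simp
    ring
  simp only [h5, Finset.sum_add_distrib, Finset.sum_sub_distrib, ← Finset.mul_sum, h1, ← hu]
  simp
  ring

end LocalInequality

/-! ### The differentiated equation, and the Hessian of the quadratic part. -/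

section LocalInequality

variable {n : ℕ}

theorem contDiffAt_ofReal {φ : Cn n → ℝ} {z : Cn n} (hφ : ContDiffAt ℝ ∞ φ z) :
    ContDiffAt ℝ ∞ (fun w => (φ w : ℂ)) z :=
  Complex.ofRealCLM.contDiff.contDiffAt.comp z hφ

theorem contDiffAt_star {f : Cn n → ℂ} {z : Cn n} (hf : ContDiffAt ℝ ∞ f z) :
    ContDiffAt ℝ ∞ (fun w => star (f w)) z :=
  Complex.conjCLE.contDiff.contDiffAt.comp z hf

/-- The contracted third derivatives of the potential are controlled by the first derivatives of the
volume ratio. -/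
theorem sum_inv_mul_third_derivative {G : Cn n → Matrix (Fin n) (Fin n) ℂ} {φ F : Cn n → ℝ}
    {z : Cn n} {l : Fin n → ℝ} (hG : ∀ a b, ContDiffAt ℝ ∞ (fun w => G w a b) z) (hG1 : G z = 1)
    (hφ : ContDiffAt ℝ ∞ φ z) (hF : DifferentiableAt ℝ F z) (hl : ∀ a, 0 < l a)
    (hH : G z + complexHessian (fun w => (φ w : ℂ)) z = Matrix.diagonal fun a => (l a : ℂ))
    (hdet : ∀ᶠ w in nhds z, (G w + complexHessian (fun w => (φ w : ℂ)) w).det =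
      (Real.exp (F w) : ℂ) * (G w).det) (a : Fin n) :
    ∑ k, ((l k)⁻¹ : ℝ) * dz k (dzbar k (dz a (fun w => (φ w : ℂ)))) z =
      dz a (fun w => (F w : ℂ)) z +
        ∑ k, (1 - ((l k)⁻¹ : ℝ) : ℂ) * dz a (fun w => G w k k) z := by
  set φc : Cn n → ℂ := fun w => (φ w : ℂ) with hφc
  have hφs : ContDiffAt ℝ ∞ φc z := contDiffAt_ofReal hφ
  have hHess : ∀ i j, ContDiffAt ℝ ∞ (fun w => complexHessian φc w i j) z := fun i j =>
    ContDiffAt.dz (ContDiffAt.dzbar hφs)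
  have hT : ∀ k, dz a (fun w => complexHessian φc w k k) z = dz k (dzbar k (dz a φc)) z := by
    intro k
    have h1 : wirt (-Complex.I) a (wirt Complex.I k φc) =ᶠ[nhds z]
      wirt Complex.I k (wirt (-Complex.I) a φc) := wirt_comm_eventuallyEq hφs
    have h2 : dz a (dz k (dzbar k φc)) z = dz k (dz a (dzbar k φc)) z := by
      simp only [dz_eq_wirt]
      exact wirt_comm (ContDiffAt.dzbar hφs)
    refine h2.trans ?_
    simp only [dz_eq_wirt, dzbar_eq_wirt]
    exact wirt_congr h1
  have hdetG : (G z).det = 1 := by rw [hG1, Matrix.det_one]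
  have hprod : (∏ k, (l k : ℂ)) = (Real.exp (F z) : ℂ) := by
    have := hdet.self_of_nhds
    rwa [hH, Matrix.det_diagonal, hdetG, mul_one] at this
  have hexp : DifferentiableAt ℝ (fun w => (Real.exp (F w) : ℂ)) z :=
    Complex.ofRealCLM.differentiableAt.comp z (Real.differentiable_exp.differentiableAt.comp z hF)
  have hdG : DifferentiableAt ℝ (fun w => (G w).det) z := (contDiffAt_det hG).diff
  -- Differentiate det(G + ∂∂̄φ) = e^F det G once, using Jacobi's formula on both sides; at `z` the
  -- matrices are diagonal and the identity.
  have h1 := wirt_congr (s := -Complex.I) (i := a) hdet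
  rw [wirt_det a (fun i j => by
      simpa using ((hG i j).add (hHess i j)).diff), wirt_mul hexp hdG,
    wirt_det a (fun i j => (hG i j).diff), wirt_ofReal_comp hF (Real.hasDerivAt_exp _), hH,
    Matrix.adjugate_diagonal, hG1, Matrix.adjugate_one, Matrix.one_mul, Matrix.det_one] at h1
  have h2 : ∀ k, ∏ j ∈ Finset.univ.erase k, (l j : ℂ) = (Real.exp (F z) : ℂ) * ((l k)⁻¹ : ℝ) := by
    intro k
    rw [← hprod, ← Finset.mul_prod_erase _ _ (Finset.mem_univ k)]
    have : (l k : ℂ) ≠ 0 := by exact_mod_cast (hl k).ne'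
    push_cast
    field_simp
  simp only [Matrix.trace, Matrix.diag, Matrix.diagonal_mul, Matrix.of_apply, h2,
    Matrix.add_apply] at h1
  simp only [wirt_add (hG _ _).diff (hHess _ _).diff, ← dz_eq_wirt, hT] at h1
  have h3 : (Real.exp (F z) : ℂ) ≠ 0 := by exact_mod_cast (Real.exp_pos _).ne'
  have h4 : ∑ k, (((l k)⁻¹ : ℝ) : ℂ) * (dz a (fun w => G w k k) z + dz k (dzbar k (dz a φc)) z) =
      dz a (fun w => (F w : ℂ)) z + ∑ k, dz a (fun w => G w k k) z := by
    refine mul_left_cancel₀ h3 ?_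
    rw [Finset.mul_sum, mul_add]
    simp only [← mul_assoc]
    simpa using h1
  simp only [mul_add, Finset.sum_add_distrib] at h4
  simp only [sub_mul, one_mul, Finset.sum_sub_distrib]
  linear_combination h4

/-- The complex Hessian of `e^{-α(φ)} G(c, c)` for a constant vector `c`. -/
theorem dz_dzbar_exp_mul_form {G : Cn n → Matrix (Fin n) (Fin n) ℂ} {φ : Cn n → ℝ}
    {z : Cn n} {α α' : ℝ → ℝ} {α'' : ℝ}
    (hG : ∀ a b, ContDiffAt ℝ ∞ (fun w => G w a b) z) (hφ : ContDiffAt ℝ ∞ φ z)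
    (hα : ContDiff ℝ ∞ α) (hα' : ∀ r, HasDerivAt α (α' r) r) (hα'' : HasDerivAt α' α'' (φ z))
    (c : Fin n → ℂ) (k : Fin n) :
    dz k (dzbar k fun w => (Real.exp (-α (φ w)) : ℂ) * ∑ a, ∑ b, star (c a) * G w a b * c b) z =
      (Real.exp (-α (φ z)) : ℂ) *
      (((α' (φ z) ^ 2 - α'' : ℝ) * (dz k (fun w => (φ w : ℂ)) z * dzbar k (fun w => (φ w : ℂ)) z) -
        α' (φ z) * complexHessian (fun w => (φ w : ℂ)) z k k) *
          ∑ a, ∑ b, star (c a) * G z a b * c b -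
        α' (φ z) * (dzbar k (fun w => (φ w : ℂ)) z *
            ∑ a, ∑ b, star (c a) * dz k (fun w => G w a b) z * c b +
          dz k (fun w => (φ w : ℂ)) z *
            ∑ a, ∑ b, star (c a) * dzbar k (fun w => G w a b) z * c b) +
        ∑ a, ∑ b, star (c a) * dz k (dzbar k fun w => G w a b) z * c b) := by
  have hE : ContDiffAt ℝ ∞ (fun w => Real.exp (-α (φ w))) z :=
    (hα.contDiffAt.comp z hφ).neg.exp
  have hEc := contDiffAt_ofReal hE
  have hψ : ∀ r, HasDerivAt (fun r => Real.exp (-α r)) (-α' r * Real.exp (-α r)) r := fun r => by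
    simpa [mul_comm] using (hα' r).neg.exp
  have hψ' : HasDerivAt (fun r => -α' r * Real.exp (-α r))
      ((α' (φ z) ^ 2 - α'') * Real.exp (-α (φ z))) (φ z) := by
    have h := hα''.neg.mul (hψ (φ z))
    refine h.congr_deriv ?_
    simp only [Pi.neg_apply]
    ring
  have hterm : ∀ a b, ContDiffAt ℝ ∞ (fun w => star (c a) * G w a b * c b) z := fun a b =>
    (contDiffAt_const.mul (hG a b)).mul contDiffAt_const
  have hq : ContDiffAt ℝ ∞ (fun w => ∑ a, ∑ b, star (c a) * G w a b * c b) z :=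
    ContDiffAt.sum fun a _ => ContDiffAt.sum fun b _ => hterm a b
  have hw : ∀ s : ℂ, wirt s k (fun w => ∑ a, ∑ b, star (c a) * G w a b * c b) z =
      ∑ a, ∑ b, star (c a) * wirt s k (fun w => G w a b) z * c b := by
    intro s
    rw [wirt_sum fun a _ => (ContDiffAt.sum fun b _ => hterm a b).diff]
    refine Finset.sum_congr rfl fun a _ => ?_
    rw [wirt_sum fun b _ => (hterm a b).diff]
    refine Finset.sum_congr rfl fun b _ => ?_
    have h : (fun w => star (c a) * G w a b * c b) = fun w => (star (c a) * c b) * G w a b := by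
      funext w; ring
    rw [h, wirt_const_mul _ (hG a b).diff]
    ring
  have hww : ∀ s t : ℂ, wirt s k (wirt t k (fun w => ∑ a, ∑ b, star (c a) * G w a b * c b)) z =
      ∑ a, ∑ b, star (c a) * wirt s k (wirt t k (fun w => G w a b)) z * c b := by
    intro s t
    rw [wirt_wirt_sum fun a _ => (ContDiffAt.sum fun b _ => hterm a b)]
    refine Finset.sum_congr rfl fun a _ => ?_
    rw [wirt_wirt_sum fun b _ => (hterm a b)]
    refine Finset.sum_congr rfl fun b _ => ?_
    have h : (fun w => star (c a) * G w a b * c b) = fun w => (star (c a) * c b) * G w a b := by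
      funext w; ring
    rw [h, wirt_wirt_const_mul _ (hG a b)]
    ring
  simp only [complexHessian, Matrix.of_apply, dz_eq_wirt, dzbar_eq_wirt]
  rw [wirt_wirt_mul hEc hq, hww, hw, hw,
    wirt_wirt_ofReal_comp (ψ := fun r => Real.exp (-α r)) hφ (Filter.Eventually.of_forall hψ) hψ',
    wirt_ofReal_comp (ψ := fun r => Real.exp (-α r)) hφ.diff (hψ _),
    wirt_ofReal_comp (ψ := fun r => Real.exp (-α r)) hφ.diff (hψ _)]
  push_cast
  ring

end LocalInequality

/-! ### The Bochner inequality in a diagonalizing frame. -/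

section LocalInequality

variable {n : ℕ}

/-- Bochner type inequality for `e^{α(φ)} |∂φ|²`, in a frame in which both metrics are diagonal. -/
theorem laplacian_weighted_grad_ge {G : Cn n → Matrix (Fin n) (Fin n) ℂ} {φ F : Cn n → ℝ}
    {z : Cn n} {l : Fin n → ℝ} {α α' : ℝ → ℝ} {α'' : ℝ}
    (hG : ∀ a b, ContDiffAt ℝ ∞ (fun w => G w a b) z) (hGpos : ∀ᶠ w in nhds z, (G w).PosDef)
    (hG1 : G z = 1)
    (hK : ∀ i j k, dz k (fun w => G w i j) z = dz i (fun w => G w k j) z)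
    (hφ : ContDiffAt ℝ ∞ φ z) (hF : DifferentiableAt ℝ F z)
    (hα : ContDiff ℝ ∞ α) (hα' : ∀ r, HasDerivAt α (α' r) r) (hα'' : HasDerivAt α' α'' (φ z))
    (hl : ∀ a, 0 < l a)
    (hH : G z + complexHessian (fun w => (φ w : ℂ)) z = Matrix.diagonal fun a => (l a : ℂ))
    (hdet : ∀ᶠ w in nhds z, (G w + complexHessian (fun w => (φ w : ℂ)) w).det =
      (Real.exp (F w) : ℂ) * (G w).det) {u : ℝ}
    (hu : u = ∑ a, Complex.normSq (dz a (fun w => (φ w : ℂ)) z)) :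
    Real.exp (α (φ z)) * (∑ k, l k + ∑ k, (l k)⁻¹ - 2 * n + (n + 2) * α' (φ z) * u +
        (α'' * u - 2 * α' (φ z)) *
          ∑ k, (l k)⁻¹ * Complex.normSq (dz k (fun w => (φ w : ℂ)) z) -
        α' (φ z) * u * ∑ k, (l k)⁻¹ +
        2 * (∑ a, star (dz a (fun w => (φ w : ℂ)) z) * dz a (fun w => (F w : ℂ)) z).re -
        ∑ k, (l k)⁻¹ * (∑ a, ∑ b, star (dz a (fun w => (φ w : ℂ)) z) *
          dz k (dzbar k fun w => G w a b) z * dz b (fun w => (φ w : ℂ)) z).re) ≤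
      ∑ k, (l k)⁻¹ * (dz k (dzbar k fun w => (Real.exp (α (φ w)) : ℂ) *
        ((G w)⁻¹ * gradMatrix (fun w => (φ w : ℂ)) w).trace) z).re := by
  set φc : Cn n → ℂ := fun w => (φ w : ℂ) with hφc
  set p : Fin n → ℂ := fun a => dz a φc z with hp
  set e : ℂ := (Real.exp (α (φ z)) : ℂ) with he
  set e' : ℂ := (Real.exp (-α (φ z)) : ℂ) with he'
  have hee : e * e' = 1 := by
    rw [he, he', ← Complex.ofReal_mul, ← Real.exp_add]; simp
  have hestar : star e = e := by rw [he, Complex.star_def, Complex.conj_ofReal]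
  -- Frozen at its value at `z`, this vector makes the remainder `W` = e^α ∂φ - G c vanish at `z`,
  -- where G = 1. The complex Hessian of the square of `W` then sees only first derivatives of `W`,
  -- and G⁻¹ is never differentiated.
  set c : Fin n → ℂ := fun a => e * p a with hc
  have hφs : ContDiffAt ℝ ∞ φc z := contDiffAt_ofReal hφ
  have hps : ∀ a, ContDiffAt ℝ ∞ (dz a φc) z := fun a => ContDiffAt.dz hφs
  have hE'r : ContDiffAt ℝ ∞ (fun w => Real.exp (α (φ w))) z := (hα.contDiffAt.comp z hφ).exp
  have hE' := contDiffAt_ofReal hE'r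
  have hEr : ContDiffAt ℝ ∞ (fun w => Real.exp (-α (φ w))) z := (hα.contDiffAt.comp z hφ).neg.exp
  have hE := contDiffAt_ofReal hEr
  set W : Fin n → Cn n → ℂ := fun a w =>
    (Real.exp (α (φ w)) : ℂ) * dz a φc w - ∑ d, G w a d * c d with hW
  have hGc : ∀ a d, ContDiffAt ℝ ∞ (fun w => G w a d * c d) z := fun a d =>
    (hG a d).mul contDiffAt_const
  have hWs : ∀ a, ContDiffAt ℝ ∞ (W a) z := fun a =>
    (hE'.mul (hps a)).sub (ContDiffAt.sum fun d _ => hGc a d)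
  have hW0 : ∀ a, W a z = 0 := fun a => by
    simp [hW, hG1, Matrix.one_apply, hc, he, hp]
  have hGinv : ∀ a b, ContDiffAt ℝ ∞ (fun w => (G w)⁻¹ a b) z :=
    contDiffAt_inv_matrix hG (by rw [hG1]; simp)
  -- decomposition of the function near `z`
  set Q1 : Cn n → ℂ := fun w => ∑ a, (star (dz a φc w) * c a + star (c a) * dz a φc w) with hQ1
  set Q2 : Cn n → ℂ := fun w =>
    (Real.exp (-α (φ w)) : ℂ) * ∑ a, ∑ b, star (c a) * G w a b * c b with hQ2
  set Q3 : Cn n → ℂ := fun w => ∑ a, ∑ b,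
    ((Real.exp (-α (φ w)) : ℂ) * (G w)⁻¹ a b) * (star (W a w) * W b w) with hQ3
  have hQ3t : ∀ a b, ContDiffAt ℝ ∞ (fun w =>
      ((Real.exp (-α (φ w)) : ℂ) * (G w)⁻¹ a b) * (star (W a w) * W b w)) z := fun a b =>
    (hE.mul (hGinv a b)).mul ((contDiffAt_star (hWs a)).mul (hWs b))
  have hQ1t : ∀ a, ContDiffAt ℝ ∞ (fun w => star (dz a φc w) * c a + star (c a) * dz a φc w) z :=
    fun a => ((contDiffAt_star (hps a)).mul contDiffAt_const).add (contDiffAt_const.mul (hps a))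
  have hQ1s : ContDiffAt ℝ ∞ Q1 z := ContDiffAt.sum fun a _ => hQ1t a
  have hQ2s : ContDiffAt ℝ ∞ Q2 z := hE.mul (ContDiffAt.sum fun a _ => ContDiffAt.sum fun b _ =>
    (contDiffAt_const.mul (hG a b)).mul contDiffAt_const)
  have hQ3s : ContDiffAt ℝ ∞ Q3 z := ContDiffAt.sum fun a _ => ContDiffAt.sum fun b _ => hQ3t a b
  have hV : (fun w => (Real.exp (α (φ w)) : ℂ) * ((G w)⁻¹ * gradMatrix φc w).trace) =ᶠ[nhds z]
      fun w => (Q1 w - Q2 w) + Q3 w := by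
    filter_upwards [hGpos] with w hw
    rw [trace_inv_mul_gradMatrix]
    refine weighted_grad_decomposition hw (fun a => dz a φc w) c ?_ ?_
    · rw [← Complex.ofReal_mul, ← Real.exp_add]; simp
    · rw [Complex.star_def, Complex.conj_ofReal]
  -- second derivatives of the three parts
  set γ : Fin n → Fin n → ℂ := fun k a => ∑ b, dzbar k (fun w => G w a b) z * p b with hγ
  set T : Fin n → Fin n → ℂ := fun k a => dz k (dzbar k (dz a φc)) z with hT
  set R : Fin n → ℂ := fun k => ∑ a, ∑ b, star (p a) * dz k (dzbar k fun w => G w a b) z * p b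
    with hR
  set S : Fin n → Fin n → ℂ := fun k a => e' * dz k (W a) z with hS
  have hHk : ∀ a b, complexHessian φc z a b = if a = b then ((l a - 1 : ℝ) : ℂ) else 0 := by
    intro a b
    have h := congrFun (congrFun hH a) b
    rw [hG1, Matrix.add_apply, Matrix.one_apply, Matrix.diagonal_apply] at h
    split_ifs at h ⊢ with hab
    · push_cast; linear_combination h
    · linear_combination h
  have hd1 : ∀ k, dz k (dzbar k Q1) z = e * ∑ a, (star (T k a) * p a + star (p a) * T k a) := by
    intro k
    have h1 : ∀ a, dz k (dzbar k fun w => star (dz a φc w) * c a + star (c a) * dz a φc w) z =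
        e * (star (T k a) * p a + star (p a) * T k a) := by
      intro a
      have h2 : (fun w => star (dz a φc w) * c a + star (c a) * dz a φc w) =
          fun w => c a * star (dz a φc w) + star (c a) * dz a φc w := by
        funext w; ring
      have h3 := dz_dzbar_star (i := k) (hps a)
      simp only [dz_eq_wirt, dzbar_eq_wirt] at h3 hT h2 ⊢
      simp only [dz_eq_wirt] at hps
      rw [h2, wirt_wirt_add (contDiffAt_const.mul (contDiffAt_star (hps a)))
        (contDiffAt_const.mul (hps a)), wirt_wirt_const_mul _ (contDiffAt_star (hps a)),
        wirt_wirt_const_mul _ (hps a), h3]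
      simp only [hc, star_mul', hestar, hT, hp]
      ring
    rw [Finset.mul_sum, ← Finset.sum_congr rfl fun a _ => h1 a]
    simp only [dz_eq_wirt, dzbar_eq_wirt, hQ1]
    exact wirt_wirt_sum fun a _ => by simpa only [dz_eq_wirt] using hQ1t a
  have hherm : ∀ a b k, dz k (fun w => G w a b) z = star (dzbar k (fun w => G w b a) z) := by
    intro a b k
    rw [← dz_star, dz_eq_wirt]
    refine wirt_congr (hGpos.mono fun w hw => ?_)
    exact (hw.isHermitian.apply a b).symm
  have huc : (u : ℂ) = ∑ a, star (p a) * p a := by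
    rw [hu, Complex.ofReal_sum]
    exact Finset.sum_congr rfl fun a _ => by rw [Complex.normSq_eq_conj_mul_self]; rfl
  have hd2 : ∀ k, dz k (dzbar k Q2) z = e *
      (((α' (φ z) ^ 2 - α'' : ℝ) * (p k * star (p k)) - (α' (φ z) * (l k - 1) : ℝ)) * (u : ℂ) -
          α' (φ z) * (p k * ∑ a, star (p a) * γ k a + star (p k * ∑ a, star (p a) * γ k a)) +
          R k) := by
    intro k
    have h1 : ∑ a, ∑ b, star (c a) * G z a b * c b = e * e * u := by
      rw [huc, Finset.mul_sum]
      refine Finset.sum_congr rfl fun a _ => ?_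
      simp only [hG1, Matrix.one_apply, hc, star_mul', hestar]
      simp
      ring
    have h2 : ∑ a, ∑ b, star (c a) * dzbar k (fun w => G w a b) z * c b =
        e * e * ∑ a, star (p a) * γ k a := by
      simp only [hγ, Finset.mul_sum, hc, star_mul', hestar]
      exact Finset.sum_congr rfl fun a _ => Finset.sum_congr rfl fun b _ => by ring
    have h3 : ∑ a, ∑ b, star (c a) * dz k (fun w => G w a b) z * c b =
        e * e * star (∑ a, star (p a) * γ k a) := by
      simp only [hγ, Finset.mul_sum, hc, star_mul', hestar, star_sum, star_star, hherm _ _ k]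
      rw [Finset.sum_comm]
      exact Finset.sum_congr rfl fun a _ => Finset.sum_congr rfl fun b _ => by ring
    have h4 : ∑ a, ∑ b, star (c a) * dz k (dzbar k fun w => G w a b) z * c b = e * e * R k := by
      simp only [hR, Finset.mul_sum, hc, star_mul', hestar]
      exact Finset.sum_congr rfl fun a _ => Finset.sum_congr rfl fun b _ => by ring
    rw [hQ2, dz_dzbar_exp_mul_form hG hφ hα hα' hα'' c k, h1, h2, h3, h4, hHk, if_pos rfl,
      dzbar_ofReal, star_mul']
    simp only [← hφc, ← he']
    have h5 : e' * (e * e) = e := by linear_combination e * hee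
    push_cast
    linear_combination (((α' (φ z) ^ 2 - α'') * (p k * star (p k)) - (α' (φ z) * (l k - 1))) *
      (u : ℂ) - α' (φ z) * (p k * ∑ a, star (p a) * γ k a +
        star (p k) * star (∑ a, star (p a) * γ k a)) + R k) * h5
  have hdW : ∀ k a, dzbar k (W a) z = e * ((if a = k then ((l k - 1 : ℝ) : ℂ) else 0) +
      α' (φ z) * (p a * star (p k)) - γ k a) := by
    intro k a
    have h1 : dzbar k (dz a φc) z = if a = k then ((l k - 1 : ℝ) : ℂ) else 0 := by
      have h2 : dzbar k (dz a φc) z = complexHessian φc z a k := by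
        rw [complexHessian, Matrix.of_apply, dz_eq_wirt, dzbar_eq_wirt, wirt_comm hφs]
      rw [h2, hHk]
      split_ifs with h
      · rw [h]
      · rfl
    have h3 : dzbar k φc z = star (p k) := dzbar_ofReal φ
    have h4 : ∀ d, wirt Complex.I k (fun w => G w a d * c d) z = dzbar k (fun w => G w a d) z * c d :=
      fun d => by
        rw [wirt_mul (hG a d).diff (differentiableAt_const _), wirt_const, mul_zero, add_zero]
        rfl
    rw [dzbar_eq_wirt] at h1 h3 ⊢
    rw [hW, wirt_sub (hE'.mul (hps a)).diff (ContDiffAt.sum fun d _ => hGc a d).diff,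
      wirt_mul hE'.diff (hps a).diff, wirt_sum fun d _ => (hGc a d).diff, h1,
      wirt_ofReal_comp (ψ := fun r => Real.exp (α r)) hφ.diff ((hα' _).exp), h3]
    rw [Finset.sum_congr rfl fun d _ => h4 d]
    have h6 : ∑ d, dzbar k (fun w => G w a d) z * c d = e * γ k a := by
      simp only [hγ, hc, Finset.mul_sum]
      exact Finset.sum_congr rfl fun d _ => by ring
    rw [h6, Complex.ofReal_mul, ← he, show dz a φc z = p a from rfl]
    ring
  have hd3 : ∀ k, dz k (dzbar k Q3) z = e * ∑ a, (star (S k a) * S k a +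
      star ((if a = k then ((l k - 1 : ℝ) : ℂ) else 0) +
            α' (φ z) * (p a * star (p k)) - γ k a) * ((if a = k then ((l k - 1 : ℝ) : ℂ) else 0) +
            α' (φ z) * (p a * star (p k)) - γ k a)) := by
    intro k
    have hterm : ∀ a b, dz k (dzbar k fun w =>
        ((Real.exp (-α (φ w)) : ℂ) * (G w)⁻¹ a b) * (star (W a w) * W b w)) z =
        e' * (1 : Matrix (Fin n) (Fin n) ℂ) a b * (star (dz k (W a) z) * dz k (W b) z +
          star (dzbar k (W a) z) * dzbar k (W b) z) := by
      intro a b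
      rw [dz_eq_wirt, dzbar_eq_wirt, wirt_wirt_mul_of_eq_zero (hE.mul (hGinv a b))
        (contDiffAt_star (hWs a)) (hWs b) (by rw [hW0, star_zero]) (hW0 b), ← dz_eq_wirt,
        ← dzbar_eq_wirt, dz_star, dzbar_star, hG1, inv_one]
    rw [show dz k (dzbar k Q3) z = ∑ a, ∑ b, dz k (dzbar k fun w =>
        ((Real.exp (-α (φ w)) : ℂ) * (G w)⁻¹ a b) * (star (W a w) * W b w)) z by
      simp only [dz_eq_wirt, dzbar_eq_wirt, hQ3]
      rw [wirt_wirt_sum fun a _ => ContDiffAt.sum fun b _ => hQ3t a b]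
      exact Finset.sum_congr rfl fun a _ => wirt_wirt_sum fun b _ => hQ3t a b]
    rw [Finset.mul_sum]
    refine Finset.sum_congr rfl fun a _ => ?_
    rw [Finset.sum_eq_single a (fun b _ hb => by
      rw [hterm, Matrix.one_apply_ne' hb]; ring) (by simp), hterm, Matrix.one_apply_eq, hdW]
    simp only [hS, star_mul', hestar]
    have h6 : star e' = e' := by rw [he', Complex.star_def, Complex.conj_ofReal]
    rw [h6]
    set x := (if a = k then ((l k - 1 : ℝ) : ℂ) else 0) +
            α' (φ z) * (p a * star (p k)) - γ k a
    linear_combination (e * star x * x - e' * star (dz k (W a) z) * dz k (W a) z) * hee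
  -- assembly
  have hdV : ∀ k, (dz k (dzbar k fun w => (Real.exp (α (φ w)) : ℂ) *
      ((G w)⁻¹ * gradMatrix φc w).trace) z).re = Real.exp (α (φ z)) *
      (∑ a, (star (T k a) * p a + star (p a) * T k a) -
        (((α' (φ z) ^ 2 - α'' : ℝ) * (p k * star (p k)) - (α' (φ z) * (l k - 1) : ℝ)) * (u : ℂ) -
          α' (φ z) * (p k * ∑ a, star (p a) * γ k a + star (p k * ∑ a, star (p a) * γ k a)) +
          R k) +
        ∑ a, (star (S k a) * S k a + star ((if a = k then ((l k - 1 : ℝ) : ℂ) else 0) +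
            α' (φ z) * (p a * star (p k)) - γ k a) * ((if a = k then ((l k - 1 : ℝ) : ℂ) else 0) +
            α' (φ z) * (p a * star (p k)) - γ k a))).re := by
    intro k
    have h1 : dz k (dzbar k fun w => (Real.exp (α (φ w)) : ℂ) *
        ((G w)⁻¹ * gradMatrix φc w).trace) z =
        dz k (dzbar k Q1) z - dz k (dzbar k Q2) z + dz k (dzbar k Q3) z := by
      simp only [dz_eq_wirt, dzbar_eq_wirt]
      rw [wirt_congr (wirt_eventuallyEq hV), wirt_wirt_add (hQ1s.sub hQ2s) hQ3s,
        wirt_wirt_sub hQ1s hQ2s]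
    rw [h1, hd1, hd2, hd3, ← mul_sub, ← mul_add, he, Complex.re_ofReal_mul]
  simp only [hdV]
  have hfin := gradient_algebra p (fun a => dz a (fun w => (F w : ℂ)) z) T
    (fun k a => dz a (fun w => G w k k) z) R l hl u (α' (φ z)) α'' hu
    (sum_inv_mul_third_derivative hG hG1 hφ hF hl hH hdet) (fun k => γ k k)
    (fun k => by
      simp only [hγ, star_sum, star_mul']
      refine Finset.sum_congr rfl fun a _ => ?_
      -- The Kähler identity ∂_a G_{k k̄} = ∂_k G_{a k̄} identifies the derivative coming from det G
      -- with the one coming from |∂φ|²; this is the source of the cancellation of `γ`.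
      rw [← hherm, hK k k a, mul_comm]) _
    (fun k => gradient_algebra_direction p (T k) (S k) (γ k) (R k) k (l k) u (α' (φ z)) α'' hu)
  have h2 := mul_le_mul_of_nonneg_left hfin (Real.exp_pos (α (φ z))).le
  refine h2.trans (le_of_eq ?_)
  rw [Finset.mul_sum]
  exact Finset.sum_congr rfl fun k _ => by ring

end LocalInequality

/-! ### Simultaneous diagonalization and invariance of traces. -/

section Frames

variable {n : ℕ}

theorem _root_.Matrix.IsHermitian.exists_unitary_diagonal {A : Matrix (Fin n) (Fin n) ℂ}
    (hA : A.IsHermitian) : ∃ U : Matrix (Fin n) (Fin n) ℂ, U.conjTranspose * U = 1 ∧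
      U.conjTranspose * A * U = Matrix.diagonal fun a => (hA.eigenvalues a : ℂ) := by
  refine ⟨hA.eigenvectorUnitary, ?_, ?_⟩
  · exact (Matrix.mem_unitaryGroup_iff'.1 hA.eigenvectorUnitary.2)
  · have h := hA.conjStarAlgAut_star_eigenvectorUnitary
    rw [Unitary.conjStarAlgAut_apply] at h
    simpa [Matrix.star_eq_conjTranspose, Function.comp_def] using h

/-- Simultaneous diagonalization of two positive definite Hermitian forms. -/
theorem exists_frame {G H : Matrix (Fin n) (Fin n) ℂ} (hG : G.PosDef) (hH : H.PosDef) :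
    ∃ (P : Matrix (Fin n) (Fin n) ℂ) (l : Fin n → ℝ), IsUnit P.det ∧ (∀ a, 0 < l a) ∧
      P.transpose * G * P.map (starRingEnd ℂ) = 1 ∧
      P.transpose * H * P.map (starRingEnd ℂ) = Matrix.diagonal fun a => (l a : ℂ) := by
  obtain ⟨U, hU1, hU2⟩ := hG.isHermitian.exists_unitary_diagonal
  set e := hG.isHermitian.eigenvalues with he
  have hepos : ∀ a, 0 < e a := hG.eigenvalues_pos
  -- Rescaling an eigenbasis of G by inverse square roots turns G into the identity; a further
  -- unitary matrix then diagonalizes H without disturbing it.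
  set D : Matrix (Fin n) (Fin n) ℂ := Matrix.diagonal fun a => ((Real.sqrt (e a))⁻¹ : ℝ) with hD
  have hDH : D.conjTranspose = D := by
    rw [hD, Matrix.diagonal_conjTranspose]
    congr 1
    funext a
    simp
  have hS : (U * D).conjTranspose * G * (U * D) = 1 := by
    rw [Matrix.conjTranspose_mul, hDH]
    have h1 : D * U.conjTranspose * G * (U * D) = D * (U.conjTranspose * G * U) * D := by
      simp only [Matrix.mul_assoc]
    rw [h1, hU2, hD, Matrix.diagonal_mul_diagonal, Matrix.diagonal_mul_diagonal,
      ← Matrix.diagonal_one]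
    congr 1
    funext a
    have h2 : (Real.sqrt (e a))⁻¹ * e a * (Real.sqrt (e a))⁻¹ = 1 := by
      have h3 := Real.mul_self_sqrt (hepos a).le
      have h4 := (Real.sqrt_pos.2 (hepos a)).ne'
      field_simp
      nlinarith
    exact_mod_cast h2
  have hSdet : IsUnit (U * D).det := by
    have h := congrArg Matrix.det hS
    rw [Matrix.det_mul, Matrix.det_one] at h
    exact isUnit_iff_ne_zero.2 fun h0 => by simp [h0] at h
  have hSinj : Function.Injective (U * D).mulVec :=
    Matrix.mulVec_injective_iff_isUnit.2 ((Matrix.isUnit_iff_isUnit_det _).2 hSdet)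
  have hH' : ((U * D).conjTranspose * H * (U * D)).PosDef := hH.conjTranspose_mul_mul_same hSinj
  obtain ⟨U', hU'1, hU'2⟩ := hH'.isHermitian.exists_unitary_diagonal
  -- Coordinate changes act by Pᵀ · P̄ instead of P* · P, so the frame is the entrywise conjugate of
  -- `Q`.
  set Q := U * D * U' with hQ
  have hT : ∀ A : Matrix (Fin n) (Fin n) ℂ,
      (Q.map (starRingEnd ℂ)).transpose * A * (Q.map (starRingEnd ℂ)).map (starRingEnd ℂ) =
        U'.conjTranspose * ((U * D).conjTranspose * A * (U * D)) * U' := by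
    intro A
    have h1 : (Q.map (starRingEnd ℂ)).transpose = Q.conjTranspose := rfl
    have h2 : (Q.map (starRingEnd ℂ)).map (starRingEnd ℂ) = Q := by
      ext i j; simp
    rw [h1, h2, hQ, Matrix.conjTranspose_mul]
    simp only [Matrix.mul_assoc]
  have h1 : (Q.map (starRingEnd ℂ)).transpose * G * (Q.map (starRingEnd ℂ)).map (starRingEnd ℂ) =
      1 := by
    rw [hT, hS, Matrix.mul_one, hU'1]
  refine ⟨Q.map (starRingEnd ℂ), hH'.isHermitian.eigenvalues, ?_, hH'.eigenvalues_pos, h1, ?_⟩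
  · have h := congrArg Matrix.det h1
    rw [Matrix.det_mul, Matrix.det_mul, Matrix.det_transpose, Matrix.det_one] at h
    exact isUnit_iff_ne_zero.2 fun h0 => by simp [h0] at h
  · rw [hT, hU'2]

theorem trace_inv_mul_congr {J A B : Matrix (Fin n) (Fin n) ℂ} (hJ : IsUnit J.det) :
    ((J.transpose * A * J.map (starRingEnd ℂ))⁻¹ * (J.transpose * B * J.map (starRingEnd ℂ))).trace =
      (A⁻¹ * B).trace := by
  have h1 : IsUnit J.transpose.det := by rwa [Matrix.det_transpose]
  have h2 : IsUnit (J.map (starRingEnd ℂ)).det := by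
    have h := RingHom.map_det (starRingEnd ℂ) J
    rw [RingHom.mapMatrix_apply] at h
    rw [← h]
    exact hJ.map _
  rw [Matrix.mul_inv_rev, Matrix.mul_inv_rev]
  have h3 : (J.map (starRingEnd ℂ))⁻¹ * (A⁻¹ * J.transpose⁻¹) *
      (J.transpose * B * J.map (starRingEnd ℂ)) =
      (J.map (starRingEnd ℂ))⁻¹ * (A⁻¹ * B * J.map (starRingEnd ℂ)) := by
    simp only [Matrix.mul_assoc]
    rw [Matrix.nonsing_inv_mul_cancel_left _ _ h1]
  rw [h3, Matrix.trace_mul_comm, Matrix.mul_assoc, Matrix.mul_nonsing_inv _ h2, Matrix.mul_one]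

theorem gradMatrix_comp_holomorphic {f : Cn n → ℂ} {τ : Cn n → Cn n} {z : Cn n}
    (hτ : DifferentiableAt ℂ τ z) (hf : DifferentiableAt ℝ f (τ z)) :
    gradMatrix (fun w => f (τ w)) z = (jacobian τ z).transpose * gradMatrix f (τ z) *
      (jacobian τ z).map (starRingEnd ℂ) := by
  ext i j
  simp only [gradMatrix, Matrix.of_apply, dz_comp_holomorphic hτ hf, dzbar_comp_holomorphic hτ hf,
    Matrix.mul_apply, Matrix.transpose_apply, Matrix.map_apply, Finset.sum_mul, Finset.mul_sum]
  refine Finset.sum_congr rfl fun a _ => Finset.sum_congr rfl fun b _ => ?_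
  simp only [starRingEnd_apply]
  ring

end Frames

/-! ### Realizing a frame by an affine coordinate change. -/

section AffineFrame

variable {n : ℕ}

/-- The affine change of coordinates with linear part `P` that sends the origin to `z`. -/
def affineMap (z : Cn n) (P : Matrix (Fin n) (Fin n) ℂ) (w : Cn n) : Cn n := z + P.mulVec w

variable {z : Cn n} {P : Matrix (Fin n) (Fin n) ℂ}

theorem affineMap_zero : affineMap z P 0 = z := by simp [affineMap]

theorem contDiff_affineMap : ContDiff ℂ ∞ (affineMap z P) :=
  contDiff_const.add P.mulVecLin.toContinuousLinearMap.contDiff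

theorem differentiable_affineMap : Differentiable ℂ (affineMap z P) :=
  contDiff_affineMap.differentiable (by simp)

theorem jacobian_affineMap (w : Cn n) : jacobian (affineMap z P) w = P := by
  have h : HasFDerivAt (affineMap z P) P.mulVecLin.toContinuousLinearMap w :=
    (P.mulVecLin.toContinuousLinearMap.hasFDerivAt (x := w)).const_add z
  ext a i
  simp [jacobian, h.fderiv]

theorem tendsto_affineMap : Filter.Tendsto (affineMap z P) (nhds 0) (nhds z) := by
  have h := (contDiff_affineMap (z := z) (P := P)).continuous.tendsto 0
  rwa [affineMap_zero] at h

theorem contDiffAt_comp_affineMap {F : Type*} [NormedAddCommGroup F] [NormedSpace ℝ F]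
    {f : Cn n → F} (hf : ContDiffAt ℝ ∞ f z) :
    ContDiffAt ℝ ∞ (fun w => f (affineMap z P w)) 0 :=
  ContDiffAt.comp 0 (g := f) (by rwa [affineMap_zero])
    (contDiff_affineMap.contDiffAt.restrict_scalars ℝ)

theorem complexHessian_comp_affineMap {f : Cn n → ℂ} {w : Cn n}
    (hf : ContDiffAt ℝ ∞ f (affineMap z P w)) :
    complexHessian (fun w => f (affineMap z P w)) w =
      P.transpose * complexHessian f (affineMap z P w) * P.map (starRingEnd ℂ) := by
  rw [complexHessian_comp_holomorphic (Filter.Eventually.of_forall differentiable_affineMap)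
    contDiff_affineMap.contDiffAt hf, jacobian_affineMap]

theorem gradMatrix_comp_affineMap {f : Cn n → ℂ} {w : Cn n}
    (hf : DifferentiableAt ℝ f (affineMap z P w)) :
    gradMatrix (fun w => f (affineMap z P w)) w =
      P.transpose * gradMatrix f (affineMap z P w) * P.map (starRingEnd ℂ) := by
  rw [gradMatrix_comp_holomorphic (differentiable_affineMap _) hf, jacobian_affineMap]

end AffineFrame

/-! ### Trace inequalities, absorption and curvature bounds. -/

section PointwiseBound

variable {n : ℕ}

/-- The real trace of `B` with respect to `A`. -/
def contr (A B : Matrix (Fin n) (Fin n) ℂ) : ℝ := (A⁻¹ * B).trace.re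

theorem contr_congr {J A B : Matrix (Fin n) (Fin n) ℂ} (hJ : IsUnit J.det) :
    contr (J.transpose * A * J.map (starRingEnd ℂ)) (J.transpose * B * J.map (starRingEnd ℂ)) =
      contr A B := by
  rw [contr, trace_inv_mul_congr hJ, contr]

theorem contr_one (B : Matrix (Fin n) (Fin n) ℂ) : contr 1 B = ∑ k, (B k k).re := by
  simp [contr, Matrix.trace, Complex.re_sum]

theorem contr_diagonal {l : Fin n → ℝ} (hl : ∀ k, 0 < l k) (B : Matrix (Fin n) (Fin n) ℂ) :
    contr (Matrix.diagonal fun a => (l a : ℂ)) B = ∑ k, (l k)⁻¹ * (B k k).re := by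
  have h : (Matrix.diagonal fun a => (l a : ℂ))⁻¹ = Matrix.diagonal fun a => (((l a)⁻¹ : ℝ) : ℂ) := by
    refine Matrix.inv_eq_left_inv ?_
    rw [Matrix.diagonal_mul_diagonal, ← Matrix.diagonal_one]
    congr 1
    funext a
    rw [← Complex.ofReal_mul, inv_mul_cancel₀ (hl a).ne', Complex.ofReal_one]
  rw [contr, h, Matrix.trace, Complex.re_sum]
  refine Finset.sum_congr rfl fun k _ => ?_
  rw [Matrix.diag_apply, Matrix.diagonal_mul, Complex.re_ofReal_mul]

theorem gradMatrix_diag_re (φ : Cn n → ℝ) (z : Cn n) (k : Fin n) :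
    (gradMatrix (fun w => (φ w : ℂ)) z k k).re = Complex.normSq (dz k (fun w => (φ w : ℂ)) z) := by
  rw [gradMatrix, Matrix.of_apply, dzbar_ofReal, Complex.star_def, Complex.mul_conj,
    Complex.ofReal_re]

/-- If the product of the `l k` is bounded, then a large multiple of `u` is absorbed. -/
theorem exists_absorption_const (hn : 0 < n) (C₁ N : ℝ) (hC₁ : 0 ≤ C₁) :
    ∃ C : ℝ, 0 ≤ C ∧ ∀ l p : Fin n → ℝ, (∀ k, 0 < l k) → (∀ k, 0 ≤ p k) →
      ∏ k, l k ≤ Real.exp N →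
      ∑ k, p k - C ≤ (∑ k, p k) * ∑ k, (l k)⁻¹ * p k + (∑ k, p k) * ∑ k, (l k)⁻¹ -
        C₁ * ∑ k, p k := by
  -- If ∑ 1/l < C₁ + 1, every l j exceeds 1/(C₁ + 1). The bound on the product then forces l k ≤ e^N
  -- (C₁ + 1)^(n-1); the extra factor n ≥ 1 is harmless.
  set M₀ : ℝ := n * (Real.exp N * (C₁ + 1) ^ (n - 1)) with hM₀
  have hM₀pos : 0 < M₀ := by
    have : (0 : ℝ) < n := by exact_mod_cast hn
    positivity
  refine ⟨(C₁ + 1) ^ 2 * M₀ / 4, by positivity, fun l p hl hp hprod => ?_⟩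
  set u := ∑ k, p k with hu
  have hu0 : 0 ≤ u := Finset.sum_nonneg fun k _ => hp k
  have hX0 : 0 ≤ ∑ k, (l k)⁻¹ * p k :=
    Finset.sum_nonneg fun k _ => mul_nonneg (inv_nonneg.2 (hl k).le) (hp k)
  have hτ0 : 0 ≤ ∑ k, (l k)⁻¹ := Finset.sum_nonneg fun k _ => inv_nonneg.2 (hl k).le
  -- Either ∑ 1/l is large and the second term suffices, or all l k are bounded above and the first
  -- term is at least u²/M₀.
  by_cases hτ : C₁ + 1 ≤ ∑ k, (l k)⁻¹
  · have h1 : u * (C₁ + 1) ≤ u * ∑ k, (l k)⁻¹ := mul_le_mul_of_nonneg_left hτ hu0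
    have h2 : 0 ≤ u * ∑ k, (l k)⁻¹ * p k := mul_nonneg hu0 hX0
    have h3 : 0 ≤ (C₁ + 1) ^ 2 * M₀ / 4 := by positivity
    linarith
  · rw [not_le] at hτ
    have h1 : ∀ j, 1 ≤ l j * (C₁ + 1) := fun j => by
      have h2 : (l j)⁻¹ ≤ C₁ + 1 := (Finset.single_le_sum (f := fun k => (l k)⁻¹)
        (fun k _ => inv_nonneg.2 (hl k).le) (Finset.mem_univ j)).trans hτ.le
      calc 1 = l j * (l j)⁻¹ := (mul_inv_cancel₀ (hl j).ne').symm
        _ ≤ _ := mul_le_mul_of_nonneg_left h2 (hl j).le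
    have h2 : ∀ k, l k ≤ Real.exp N * (C₁ + 1) ^ (n - 1) := by
      intro k
      have h3 : 1 ≤ ∏ j ∈ Finset.univ.erase k, (l j * (C₁ + 1)) := by
        calc (1 : ℝ) = ∏ j ∈ Finset.univ.erase k, (1 : ℝ) := by simp
          _ ≤ _ := Finset.prod_le_prod (fun _ _ => zero_le_one) fun j _ => h1 j
      rw [Finset.prod_mul_distrib, Finset.prod_const, Finset.card_erase_of_mem (Finset.mem_univ k),
        Finset.card_univ, Fintype.card_fin] at h3
      calc l k = l k * 1 := (mul_one _).symm
        _ ≤ l k * ((∏ j ∈ Finset.univ.erase k, l j) * (C₁ + 1) ^ (n - 1)) :=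
          mul_le_mul_of_nonneg_left h3 (hl k).le
        _ = (∏ j, l j) * (C₁ + 1) ^ (n - 1) := by
          rw [← mul_assoc, Finset.mul_prod_erase _ _ (Finset.mem_univ k)]
        _ ≤ _ := mul_le_mul_of_nonneg_right hprod (by positivity)
    have h3 : ∑ k, p k ≤ (Real.exp N * (C₁ + 1) ^ (n - 1)) * ∑ k, (l k)⁻¹ * p k := by
      rw [Finset.mul_sum]
      refine Finset.sum_le_sum fun k _ => ?_
      calc p k = l k * ((l k)⁻¹ * p k) := by rw [mul_inv_cancel_left₀ (hl k).ne']
        _ ≤ _ := mul_le_mul_of_nonneg_right (h2 k) (mul_nonneg (inv_nonneg.2 (hl k).le) (hp k))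
    have h4 : u ≤ M₀ * ∑ k, (l k)⁻¹ * p k := by
      refine h3.trans (mul_le_mul_of_nonneg_right ?_ hX0)
      rw [hM₀]
      have : (1 : ℝ) ≤ n := by exact_mod_cast hn
      exact le_mul_of_one_le_left (by positivity) this
    have h5 : u / M₀ ≤ ∑ k, (l k)⁻¹ * p k := by
      rw [div_le_iff₀ hM₀pos, mul_comm]; exact h4
    have h6 : u * (u / M₀) ≤ u * ∑ k, (l k)⁻¹ * p k := mul_le_mul_of_nonneg_left h5 hu0
    have h7 : 0 ≤ u * ∑ k, (l k)⁻¹ := mul_nonneg hu0 hτ0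
    -- The constant is the maximum over u of (C₁ + 1) u - u²/M₀.
    have h8 : (C₁ + 1) * u - (C₁ + 1) ^ 2 * M₀ / 4 ≤ u * (u / M₀) := by
      have h9 : 0 ≤ (u - (C₁ + 1) * M₀ / 2) ^ 2 / M₀ := by positivity
      have h10 : (u - (C₁ + 1) * M₀ / 2) ^ 2 / M₀ =
          u * (u / M₀) - (C₁ + 1) * u + (C₁ + 1) ^ 2 * M₀ / 4 := by
        field_simp
        ring
      linarith
    linarith

/-- The first metric is dominated by the trace of the second. -/
theorem contr_gradMatrix_le {G H : Matrix (Fin n) (Fin n) ℂ} (hG : G.PosDef) (hH : H.PosDef)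
    {φ : Cn n → ℝ} {z : Cn n} (hφ : DifferentiableAt ℝ φ z) :
    contr G (gradMatrix (fun w => (φ w : ℂ)) z) ≤
      contr G H * contr H (gradMatrix (fun w => (φ w : ℂ)) z) := by
  obtain ⟨P, l, hP, hl, h1, h2⟩ := exists_frame hG hH
  have hφc : DifferentiableAt ℝ (fun w => (φ w : ℂ)) (affineMap z P 0) := by
    rw [affineMap_zero]; exact Complex.ofRealCLM.differentiableAt.comp z hφ
  have h3 := gradMatrix_comp_affineMap hφc
  rw [affineMap_zero] at h3
  rw [← contr_congr (A := G) hP, ← contr_congr (A := H) hP, ← contr_congr (A := G) (B := H) hP,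
    h1, h2, ← h3, contr_one, contr_one, contr_diagonal hl]
  simp only [gradMatrix_diag_re (fun w => φ (affineMap z P w)), Matrix.diagonal_apply_eq,
    Complex.ofReal_re]
  rw [Finset.sum_mul]
  refine Finset.sum_le_sum fun k _ => ?_
  -- In the diagonal frame the claim reads ∑ |p_k|² ≤ (∑ l_k)(∑ |p_j|²/l_j), which holds term by
  -- term in k.
  have h4 : (l k)⁻¹ * Complex.normSq (dz k (fun w => (φ (affineMap z P w) : ℂ)) 0) ≤
      ∑ j, (l j)⁻¹ * Complex.normSq (dz j (fun w => (φ (affineMap z P w) : ℂ)) 0) :=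
    Finset.single_le_sum
      (f := fun j => (l j)⁻¹ * Complex.normSq (dz j (fun w => (φ (affineMap z P w) : ℂ)) 0))
      (fun j _ => mul_nonneg (inv_nonneg.2 (hl j).le) (Complex.normSq_nonneg _)) (Finset.mem_univ k)
  calc _ = l k * ((l k)⁻¹ * Complex.normSq (dz k (fun w => (φ (affineMap z P w) : ℂ)) 0)) := by
        rw [mul_inv_cancel_left₀ (hl k).ne']
    _ ≤ _ := mul_le_mul_of_nonneg_left h4 (hl k).le

theorem contr_gradMatrix_nonneg {H : Matrix (Fin n) (Fin n) ℂ} (hH : H.PosDef)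
    (φ : Cn n → ℝ) (z : Cn n) : 0 ≤ contr H (gradMatrix (fun w => (φ w : ℂ)) z) := by
  rw [contr, trace_inv_mul_gradMatrix]
  exact hH.inv.posSemidef.re_dotProduct_nonneg _

theorem trace_inv_mul_gradMatrix_eq_ofReal {H : Matrix (Fin n) (Fin n) ℂ} (hH : H.PosDef)
    (φ : Cn n → ℝ) (z : Cn n) : (H⁻¹ * gradMatrix (fun w => (φ w : ℂ)) z).trace =
      (contr H (gradMatrix (fun w => (φ w : ℂ)) z) : ℂ) := by
  have h : 0 ≤ (H⁻¹ * gradMatrix (fun w => (φ w : ℂ)) z).trace := by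
    rw [trace_inv_mul_gradMatrix]
    exact hH.inv.posSemidef.dotProduct_mulVec_nonneg _
  exact Complex.eq_re_of_ofReal_le (r := 0) (by simpa using h)

theorem contr_pos {G H : Matrix (Fin n) (Fin n) ℂ} (hn : 0 < n) (hG : G.PosDef) (hH : H.PosDef) :
    0 < contr G H := by
  obtain ⟨P, l, hP, hl, h1, h2⟩ := exists_frame hG hH
  have : Nonempty (Fin n) := ⟨⟨0, hn⟩⟩
  rw [← contr_congr hP, h1, h2, contr_one]
  exact Finset.sum_pos (fun k _ => by simpa using hl k) Finset.univ_nonempty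

/-- The curvature term in a unitary frame is controlled by the second derivatives of the metric in
the original coordinates. -/
theorem curvature_term_le {G : Cn n → Matrix (Fin n) (Fin n) ℂ} {z : Cn n}
    {P : Matrix (Fin n) (Fin n) ℂ} {B B' : ℝ}
    (hG : ∀ a b, ContDiffAt ℝ ∞ (fun w => G w a b) z)
    (hP : P.transpose * G z * P.map (starRingEnd ℂ) = 1) (hPu : IsUnit P.det)
    (hB : ∀ a b c d, ‖dz c (dzbar d fun w => G w a b) z‖ ≤ B)
    (hB' : ∀ c, ‖(G z)⁻¹ c c‖ ≤ B') (p : Fin n → ℂ) (k : Fin n) :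
    (∑ a, ∑ b, star (p a) * dz k (dzbar k fun w =>
      (P.transpose * G (affineMap z P w) * P.map (starRingEnd ℂ)) a b) 0 * p b).re ≤
      (n : ℝ) ^ 4 * B * B' ^ 2 * ∑ a, Complex.normSq (p a) := by
  -- The diagonal entries of G⁻¹ are the squared norms of the rows of P, so a bound on G⁻¹ in the
  -- original chart bounds every unitary frame.
  have hinv : (G z)⁻¹ = P.map (starRingEnd ℂ) * P.transpose := by
    refine Matrix.inv_eq_left_inv ?_
    have h2 : IsUnit P.transpose.det := by rwa [Matrix.det_transpose]
    have h3 : P.transpose⁻¹ = G z * P.map (starRingEnd ℂ) := by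
      refine Matrix.inv_eq_right_inv ?_
      rw [← Matrix.mul_assoc, hP]
    have h4 : G z * P.map (starRingEnd ℂ) * P.transpose = 1 := by
      rw [← h3, Matrix.nonsing_inv_mul _ h2]
    rw [Matrix.mul_assoc] at h4
    exact mul_eq_one_comm.1 h4
  have hrow : ∀ c, ∑ a, ‖P c a‖ ^ 2 ≤ B' := by
    intro c
    have h1 : (G z)⁻¹ c c = ((∑ a, ‖P c a‖ ^ 2 : ℝ) : ℂ) := by
      rw [hinv, Matrix.mul_apply, Complex.ofReal_sum]
      refine Finset.sum_congr rfl fun a _ => ?_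
      rw [Matrix.map_apply, Matrix.transpose_apply, Complex.conj_mul']
      simp
    have h2 := hB' c
    rw [h1, Complex.norm_real, Real.norm_of_nonneg (Finset.sum_nonneg fun a _ => sq_nonneg _)] at h2
    exact h2
  set u := ∑ a, Complex.normSq (p a) with hu
  have hu0 : 0 ≤ u := Finset.sum_nonneg fun a _ => Complex.normSq_nonneg _
  have hB'0 : 0 ≤ B' := (norm_nonneg _).trans (hB' k)
  have hentry : ∀ c a, ‖P c a‖ ≤ Real.sqrt B' := fun c a => by
    refine Real.le_sqrt_of_sq_le (le_trans ?_ (hrow c))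
    exact Finset.single_le_sum (f := fun a => ‖P c a‖ ^ 2) (fun a _ => sq_nonneg _)
      (Finset.mem_univ a)
  -- Moving the frame from the metric to the vector leaves ∑ y_c ȳ_d K_{cd}, with |y_c|² ≤ B' u by
  -- Cauchy–Schwarz. The factor n⁴ counts n² pairs (c, d) and n² terms in the transformed Hessian
  -- `K`.
  set y : Fin n → ℂ := fun c => ∑ a, P c a * star (p a) with hy
  have hyb : ∀ c, ‖y c‖ ≤ Real.sqrt (B' * u) := by
    intro c
    refine Real.le_sqrt_of_sq_le ?_
    have h1 : ‖y c‖ ≤ ∑ a, ‖P c a‖ * ‖p a‖ := by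
      refine (norm_sum_le _ _).trans (le_of_eq ?_)
      exact Finset.sum_congr rfl fun a _ => by rw [norm_mul, norm_star]
    have h2 := Finset.sum_mul_sq_le_sq_mul_sq Finset.univ (fun a => ‖P c a‖) (fun a => ‖p a‖)
    have h3 : ∑ a, ‖p a‖ ^ 2 = u :=
      Finset.sum_congr rfl fun a _ => (Complex.normSq_eq_norm_sq _).symm
    rw [h3] at h2
    calc ‖y c‖ ^ 2 ≤ (∑ a, ‖P c a‖ * ‖p a‖) ^ 2 := pow_le_pow_left₀ (norm_nonneg _) h1 2
      _ ≤ (∑ a, ‖P c a‖ ^ 2) * u := h2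
      _ ≤ B' * u := mul_le_mul_of_nonneg_right (hrow c) hu0
  set K : Fin n → Fin n → ℂ := fun c d =>
    dz k (dzbar k fun w => G (affineMap z P w) c d) 0 with hK
  have hGs : ∀ c d, ContDiffAt ℝ ∞ (fun w => G (affineMap z P w) c d) 0 := fun c d =>
    contDiffAt_comp_affineMap (hG c d)
  have hKb : ∀ c d, ‖K c d‖ ≤ (n : ℝ) ^ 2 * B * B' := by
    intro c d
    have h1 : K c d = (P.transpose * complexHessian (fun w => G w c d) z *
        P.map (starRingEnd ℂ)) k k := by
      have h2 := complexHessian_comp_affineMap (z := z) (P := P) (w := 0)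
        (f := fun w => G w c d) (by rw [affineMap_zero]; exact hG c d)
      rw [affineMap_zero] at h2
      rw [← h2]
      rfl
    rw [h1, Matrix.mul_apply]
    simp only [Matrix.mul_apply, Matrix.transpose_apply, Matrix.map_apply, complexHessian,
      Matrix.of_apply]
    have h3 : ∀ f ∈ (Finset.univ : Finset (Fin n)), ‖(∑ e, P e k *
        dz e (dzbar f fun w => G w c d) z) * (starRingEnd ℂ) (P f k)‖ ≤ n * (B * B') := by
      intro f _
      rw [Finset.sum_mul]
      refine (norm_sum_le_of_le _ (f := fun e => P e k * dz e (dzbar f fun w => G w c d) z *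
        (starRingEnd ℂ) (P f k)) (n := fun _ => B * B') fun e _ => ?_).trans (by simp)
      rw [norm_mul, norm_mul, RCLike.norm_conj]
      have h4 := hentry e k
      have h5 := hentry f k
      calc ‖P e k‖ * ‖dz e (dzbar f fun w => G w c d) z‖ * ‖P f k‖
          ≤ Real.sqrt B' * B * Real.sqrt B' := by
            have := hB c d e f
            have hB0 : 0 ≤ B := (norm_nonneg _).trans this
            gcongr
        _ = B * B' := by
            rw [mul_right_comm, Real.mul_self_sqrt hB'0, mul_comm]
    refine (norm_sum_le_of_le _ h3).trans (le_of_eq ?_)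
    simp
    ring
  have hsum : ∑ a, ∑ b, star (p a) * dz k (dzbar k fun w =>
      (P.transpose * G (affineMap z P w) * P.map (starRingEnd ℂ)) a b) 0 * p b =
      ∑ c, ∑ d, y c * star (y d) * K c d := by
    have h1 : ∀ a b, dz k (dzbar k fun w =>
        (P.transpose * G (affineMap z P w) * P.map (starRingEnd ℂ)) a b) 0 =
        ∑ d, ∑ c, P c a * star (P d b) * K c d := by
      intro a b
      have h2 : (fun w => (P.transpose * G (affineMap z P w) * P.map (starRingEnd ℂ)) a b) =
          fun w => ∑ d, ∑ c, (P c a * star (P d b)) * G (affineMap z P w) c d := by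
        funext w
        simp only [Matrix.mul_apply, Matrix.transpose_apply, Matrix.map_apply, Finset.sum_mul,
          starRingEnd_apply]
        exact Finset.sum_congr rfl fun d _ => Finset.sum_congr rfl fun c _ => by ring
      simp only [hK, dz_eq_wirt, dzbar_eq_wirt]
      rw [h2, wirt_wirt_sum fun d _ => ContDiffAt.sum fun c _ => contDiffAt_const.mul (hGs c d)]
      refine Finset.sum_congr rfl fun d _ => ?_
      rw [wirt_wirt_sum fun c _ => contDiffAt_const.mul (hGs c d)]
      exact Finset.sum_congr rfl fun c _ => wirt_wirt_const_mul _ (hGs c d)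
    simp only [h1, hy, star_sum, star_mul', star_star, Finset.sum_mul, Finset.mul_sum]
    have h3 : ∀ F : Fin n → Fin n → Fin n → Fin n → ℂ,
        ∑ a, ∑ b, ∑ d, ∑ c, F a b c d = ∑ c, ∑ d, ∑ b, ∑ a, F a b c d := by
      intro F
      calc ∑ a, ∑ b, ∑ d, ∑ c, F a b c d = ∑ a, ∑ b, ∑ c, ∑ d, F a b c d :=
            Finset.sum_congr rfl fun a _ => Finset.sum_congr rfl fun b _ => Finset.sum_comm
        _ = ∑ a, ∑ c, ∑ b, ∑ d, F a b c d := Finset.sum_congr rfl fun a _ => Finset.sum_comm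
        _ = ∑ c, ∑ a, ∑ b, ∑ d, F a b c d := Finset.sum_comm
        _ = ∑ c, ∑ a, ∑ d, ∑ b, F a b c d :=
            Finset.sum_congr rfl fun c _ => Finset.sum_congr rfl fun a _ => Finset.sum_comm
        _ = ∑ c, ∑ d, ∑ a, ∑ b, F a b c d := Finset.sum_congr rfl fun c _ => Finset.sum_comm
        _ = _ := Finset.sum_congr rfl fun c _ => Finset.sum_congr rfl fun d _ => Finset.sum_comm
    rw [h3]
    exact Finset.sum_congr rfl fun c _ => Finset.sum_congr rfl fun d _ =>
      Finset.sum_congr rfl fun b _ => Finset.sum_congr rfl fun a _ => by ring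
  rw [hsum]
  refine (Complex.re_le_norm _).trans ?_
  have hBn : 0 ≤ (n : ℝ) ^ 2 * B * B' := (norm_nonneg _).trans (hKb k k)
  have h1 : ∀ c ∈ (Finset.univ : Finset (Fin n)), ‖∑ d, y c * star (y d) * K c d‖ ≤
      n * (B' * u * ((n : ℝ) ^ 2 * B * B')) := by
    intro c _
    refine (norm_sum_le_of_le _ (n := fun _ => B' * u * ((n : ℝ) ^ 2 * B * B'))
      fun d _ => ?_).trans (by simp)
    rw [norm_mul, norm_mul, norm_star]
    have h2 : ‖y c‖ * ‖y d‖ ≤ B' * u := by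
      calc ‖y c‖ * ‖y d‖ ≤ Real.sqrt (B' * u) * Real.sqrt (B' * u) := by
            gcongr
            · exact hyb c
            · exact hyb d
        _ = B' * u := Real.mul_self_sqrt (mul_nonneg hB'0 hu0)
    exact mul_le_mul h2 (hKb c d) (norm_nonneg _) (mul_nonneg hB'0 hu0)
  refine (norm_sum_le_of_le _ h1).trans (le_of_eq ?_)
  simp
  ring

end PointwiseBound

/-! ### The differential inequality in a chart. -/

section PointwiseBound

variable {n : ℕ}

/-- The exponent of the weight in the gradient estimate. -/
def weight (D t : ℝ) : ℝ := t ^ 2 / 2 - D * t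

theorem contDiff_weight (D : ℝ) : ContDiff ℝ ∞ (weight D) := by
  unfold weight
  fun_prop

theorem hasDerivAt_weight (D t : ℝ) : HasDerivAt (weight D) (t - D) t := by
  have h : HasDerivAt (weight D) ((2 : ℕ) * t ^ (2 - 1) / 2 - D * 1) t :=
    ((hasDerivAt_pow 2 t).div_const 2).sub ((hasDerivAt_id t).const_mul D)
  refine h.congr_deriv ?_
  simp

/-- The differential inequality for `v = e^{A(φ)} |∂φ|²` at a point of a chart. -/
theorem contr_complexHessian_weighted_grad_ge {G : Cn n → Matrix (Fin n) (Fin n) ℂ}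
    {φ F : Cn n → ℝ} {z : Cn n} {K B B' D C₁ C : ℝ}
    (hG : ∀ a b, ContDiffAt ℝ ∞ (fun w => G w a b) z) (hGpos : ∀ᶠ w in nhds z, (G w).PosDef)
    (hK : ∀ i j k, dz k (fun w => G w i j) z = dz i (fun w => G w k j) z)
    (hφe : ∀ᶠ w in nhds z, ContDiffAt ℝ ∞ φ w) (hF : DifferentiableAt ℝ F z)
    (hH : (G z + complexHessian (fun w => (φ w : ℂ)) z).PosDef)
    (hdet : ∀ᶠ w in nhds z, (G w + complexHessian (fun w => (φ w : ℂ)) w).det =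
      (Real.exp (F w) : ℂ) * (G w).det)
    (hB : ∀ a b c d, ‖dz c (dzbar d fun w => G w a b) z‖ ≤ B)
    (hB' : ∀ c, ‖(G z)⁻¹ c c‖ ≤ B')
    (hφK : |φ z| ≤ K) (hD : (n : ℝ) ^ 4 * B * B' ^ 2 + K + 1 ≤ D)
    (hC₁ : ((n : ℝ) + 2) * (D + K) ≤ C₁)
    (hC : ∀ l p : Fin n → ℝ, (∀ k, 0 < l k) → (∀ k, 0 ≤ p k) →
      ∏ k, l k ≤ Real.exp (F z) →
      ∑ k, p k - C ≤ (∑ k, p k) * ∑ k, (l k)⁻¹ * p k + (∑ k, p k) * ∑ k, (l k)⁻¹ -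
        C₁ * ∑ k, p k) :
    Real.exp (weight D (φ z)) * (contr (G z) (G z + complexHessian (fun w => (φ w : ℂ)) z) +
        contr (G z) (gradMatrix (fun w => (φ w : ℂ)) z) - (C + 2 * n) -
        2 * (Real.sqrt (contr (G z) (gradMatrix (fun w => (φ w : ℂ)) z)) *
          Real.sqrt (contr (G z) (gradMatrix (fun w => (F w : ℂ)) z)))) ≤
      contr (G z + complexHessian (fun w => (φ w : ℂ)) z)
        (complexHessian (fun w => ((Real.exp (weight D (φ w)) *
          contr (G w) (gradMatrix (fun w => (φ w : ℂ)) w) : ℝ) : ℂ)) z) := by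
  obtain ⟨P, l, hP, hl, h1, h2⟩ := exists_frame hGpos.self_of_nhds hH
  set τ : Cn n → Cn n := affineMap z P with hτ
  have hτ0 : τ 0 = z := affineMap_zero
  set Gt : Cn n → Matrix (Fin n) (Fin n) ℂ := fun w =>
    P.transpose * G (τ w) * P.map (starRingEnd ℂ) with hGt
  set φt : Cn n → ℝ := fun w => φ (τ w) with hφt
  set Ft : Cn n → ℝ := fun w => F (τ w) with hFt
  have hGτ : ∀ a b, ContDiffAt ℝ ∞ (fun w => G (τ w) a b) 0 := fun a b =>
    contDiffAt_comp_affineMap (hG a b)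
  have hGtdef : ∀ a b, (fun w => Gt w a b) =
      fun w => ∑ d, ∑ c, (P c a * star (P d b)) * G (τ w) c d := by
    intro a b
    funext w
    simp only [hGt, Matrix.mul_apply, Matrix.transpose_apply, Matrix.map_apply, Finset.sum_mul,
      starRingEnd_apply]
    exact Finset.sum_congr rfl fun d _ => Finset.sum_congr rfl fun c _ => by ring
  have hGts : ∀ a b, ContDiffAt ℝ ∞ (fun w => Gt w a b) 0 := fun a b => by
    rw [hGtdef]
    exact ContDiffAt.sum fun d _ => ContDiffAt.sum fun c _ => contDiffAt_const.mul (hGτ c d)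
  have hPinj : Function.Injective (P.map (starRingEnd ℂ)).mulVec := by
    refine Matrix.mulVec_injective_iff_isUnit.2 ((Matrix.isUnit_iff_isUnit_det _).2 ?_)
    have h := RingHom.map_det (starRingEnd ℂ) P
    rw [RingHom.mapMatrix_apply] at h
    rw [← h]
    exact hP.map _
  have hPt : (P.map (starRingEnd ℂ)).conjTranspose = P.transpose := by
    ext i j; simp
  have hGtpos : ∀ᶠ w in nhds 0, (Gt w).PosDef := by
    filter_upwards [tendsto_affineMap.eventually hGpos] with w hw
    have := hw.conjTranspose_mul_mul_same hPinj
    rwa [hPt] at this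
  have hGt1 : Gt 0 = 1 := by rw [hGt]; simp only [hτ0]; exact h1
  have hGtK : ∀ i j k, dz k (fun w => Gt w i j) 0 = dz i (fun w => Gt w k j) 0 := by
    have h3 : ∀ i j k, dz k (fun w => Gt w i j) 0 =
        ∑ d, ∑ c, ∑ e, (P c i * P e k) * (star (P d j) * dz e (fun w => G w c d) z) := by
      intro i j k
      rw [hGtdef, dz_eq_wirt, wirt_sum fun d _ =>
        (ContDiffAt.sum fun c _ => contDiffAt_const.mul (hGτ c d)).diff]
      refine Finset.sum_congr rfl fun d _ => ?_
      rw [wirt_sum fun c _ => (contDiffAt_const.mul (hGτ c d)).diff]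
      refine Finset.sum_congr rfl fun c _ => ?_
      rw [wirt_const_mul _ (hGτ c d).diff, ← dz_eq_wirt,
        dz_comp_holomorphic (f := fun w => G w c d) (differentiable_affineMap _)
          (by rw [affineMap_zero]; exact (hG c d).diff), jacobian_affineMap, affineMap_zero,
        Finset.mul_sum]
      exact Finset.sum_congr rfl fun e _ => by ring
    intro i j k
    rw [h3, h3]
    refine Finset.sum_congr rfl fun d _ => ?_
    rw [Finset.sum_comm]
    refine Finset.sum_congr rfl fun c _ => Finset.sum_congr rfl fun e _ => ?_
    rw [hK e d c]
    ring
  have hφ := hφe.self_of_nhds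
  have hφc : ContDiffAt ℝ ∞ (fun w => (φ w : ℂ)) z := contDiffAt_ofReal hφ
  have hφts : ContDiffAt ℝ ∞ φt 0 := contDiffAt_comp_affineMap hφ
  have hτd : DifferentiableAt ℝ τ 0 := (differentiable_affineMap 0).restrictScalars ℝ
  have hFts : DifferentiableAt ℝ Ft 0 := by
    refine DifferentiableAt.comp (0 : Cn n) (g := F) ?_ hτd
    rwa [hτ0]
  have hHess : complexHessian (fun w => (φt w : ℂ)) 0 =
      P.transpose * complexHessian (fun w => (φ w : ℂ)) z * P.map (starRingEnd ℂ) := by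
    have h3 := complexHessian_comp_affineMap (P := P) (z := z) (w := 0)
      (f := fun w => (φ w : ℂ)) (by rwa [affineMap_zero])
    rwa [affineMap_zero] at h3
  have hHt : Gt 0 + complexHessian (fun w => (φt w : ℂ)) 0 =
      Matrix.diagonal fun a => (l a : ℂ) := by
    rw [hHess, ← h2, Matrix.mul_add, Matrix.add_mul, hGt]
    simp only [hτ0]
  have hdett : ∀ᶠ w in nhds 0, (Gt w + complexHessian (fun w => (φt w : ℂ)) w).det =
      (Real.exp (Ft w) : ℂ) * (Gt w).det := by
    filter_upwards [tendsto_affineMap.eventually hdet, tendsto_affineMap.eventually hφe]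
      with w hw1 hw2
    have h3 : complexHessian (fun w => (φt w : ℂ)) w =
        P.transpose * complexHessian (fun w => (φ w : ℂ)) (τ w) * P.map (starRingEnd ℂ) :=
      complexHessian_comp_affineMap (f := fun w => (φ w : ℂ)) (contDiffAt_ofReal hw2)
    rw [h3, hGt]
    simp only
    rw [← Matrix.add_mul, ← Matrix.mul_add, Matrix.det_mul, Matrix.det_mul, hw1, Matrix.det_mul,
      Matrix.det_mul]
    ring
  set p : Fin n → ℂ := fun a => dz a (fun w => (φt w : ℂ)) 0 with hp
  set f : Fin n → ℂ := fun a => dz a (fun w => (Ft w : ℂ)) 0 with hf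
  set u : ℝ := ∑ a, Complex.normSq (p a) with hu
  have hgrad : ∀ {f : Cn n → ℝ} {w : Cn n}, DifferentiableAt ℝ f (τ w) →
      gradMatrix (fun w => (f (τ w) : ℂ)) w =
        P.transpose * gradMatrix (fun w => (f w : ℂ)) (τ w) * P.map (starRingEnd ℂ) :=
    fun {f w} hf => gradMatrix_comp_affineMap (f := fun w => (f w : ℂ))
      (Complex.ofRealCLM.differentiableAt.comp _ hf)
  have hcontr : ∀ {f : Cn n → ℝ}, DifferentiableAt ℝ f z →
      contr (G z) (gradMatrix (fun w => (f w : ℂ)) z) =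
        ∑ a, Complex.normSq (dz a (fun w => (f (τ w) : ℂ)) 0) := by
    intro f hf
    have h3 := hgrad (f := f) (w := 0) (by rwa [hτ0])
    rw [hτ0] at h3
    rw [← contr_congr hP, h1, ← h3, contr_one]
    simp only [gradMatrix_diag_re (fun w => f (τ w))]
  have hcu : contr (G z) (gradMatrix (fun w => (φ w : ℂ)) z) = u := hcontr hφ.diff
  have hcf : contr (G z) (gradMatrix (fun w => (F w : ℂ)) z) = ∑ a, Complex.normSq (f a) := hcontr hF
  have hcm : contr (G z) (G z + complexHessian (fun w => (φ w : ℂ)) z) = ∑ k, l k := by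
    rw [← contr_congr hP, h1, h2, contr_one]
    simp
  -- the function `v`
  set V : Cn n → ℂ := fun w => ((Real.exp (weight D (φ w)) *
    contr (G w) (gradMatrix (fun w => (φ w : ℂ)) w) : ℝ) : ℂ) with hV
  have hVeq : V =ᶠ[nhds z] fun w => (Real.exp (weight D (φ w)) : ℂ) *
      ((G w)⁻¹ * gradMatrix (fun w => (φ w : ℂ)) w).trace := by
    filter_upwards [hGpos] with w hw
    rw [hV]
    simp only
    rw [trace_inv_mul_gradMatrix_eq_ofReal hw, Complex.ofReal_mul]
  have hVs : ContDiffAt ℝ ∞ V z := by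
    refine ContDiffAt.congr_of_eventuallyEq ?_ hVeq
    refine (contDiffAt_ofReal ((contDiff_weight D).contDiffAt.comp z hφ).exp).mul ?_
    simp only [Matrix.trace, Matrix.diag, Matrix.mul_apply, gradMatrix, Matrix.of_apply]
    exact ContDiffAt.sum fun i _ => ContDiffAt.sum fun j _ =>
      (contDiffAt_inv_matrix hG (by
        exact ((Matrix.isUnit_iff_isUnit_det _).1 hGpos.self_of_nhds.isUnit).ne_zero) i j).mul
        ((ContDiffAt.dz hφc).mul (ContDiffAt.dzbar hφc))
  have hVt : (fun w => V (τ w)) =ᶠ[nhds 0] fun w => (Real.exp (weight D (φt w)) : ℂ) *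
      ((Gt w)⁻¹ * gradMatrix (fun w => (φt w : ℂ)) w).trace := by
    filter_upwards [tendsto_affineMap.eventually hVeq, tendsto_affineMap.eventually hφe]
      with w hw1 hw2
    rw [hw1, hgrad hw2.diff, hGt]
    simp only
    rw [trace_inv_mul_congr hP]
  have hHessV : complexHessian (fun w => V (τ w)) 0 =
      P.transpose * complexHessian V z * P.map (starRingEnd ℂ) := by
    have h3 := complexHessian_comp_affineMap (P := P) (z := z) (w := 0)
      (f := V) (by rwa [affineMap_zero])
    rwa [affineMap_zero] at h3
  have hRHS : contr (G z + complexHessian (fun w => (φ w : ℂ)) z) (complexHessian V z) =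
      ∑ k, (l k)⁻¹ * (dz k (dzbar k fun w => (Real.exp (weight D (φt w)) : ℂ) *
        ((Gt w)⁻¹ * gradMatrix (fun w => (φt w : ℂ)) w).trace) 0).re := by
    rw [← contr_congr hP, h2, ← hHessV, contr_diagonal hl]
    refine Finset.sum_congr rfl fun k _ => ?_
    rw [complexHessian, Matrix.of_apply, dz_eq_wirt, dzbar_eq_wirt,
      wirt_congr (wirt_eventuallyEq hVt)]
  -- For this weight α' = φ - D and α'' = 1.
  have hmain := laplacian_weighted_grad_ge hGts hGtpos hGt1 hGtK hφts hFts (contDiff_weight D)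
    (hasDerivAt_weight D) ((hasDerivAt_id (φt 0)).sub_const D) hl hHt hdett hu
  have hφt0 : φt 0 = φ z := by rw [hφt]; simp only [hτ0]
  rw [← hRHS, hφt0] at hmain
  refine le_trans ?_ hmain
  refine mul_le_mul_of_nonneg_left ?_ (Real.exp_pos _).le
  rw [hcu, hcf, hcm]
  have hprod : ∏ k, l k = Real.exp (F z) := by
    have h3 := hdett.self_of_nhds
    rw [hHt, hGt1, Matrix.det_one, mul_one, Matrix.det_diagonal] at h3
    have h4 : Ft 0 = F z := by rw [hFt]; simp only [hτ0]
    rw [h4] at h3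
    exact_mod_cast h3
  have habs := hC l (fun k => Complex.normSq (p k)) hl (fun k => Complex.normSq_nonneg _) hprod.le
  have hu0 : 0 ≤ u := Finset.sum_nonneg fun a _ => Complex.normSq_nonneg _
  set X : ℝ := ∑ k, (l k)⁻¹ * Complex.normSq (p k) with hX
  set T : ℝ := ∑ k, (l k)⁻¹ with hT
  have hX0 : 0 ≤ X :=
    Finset.sum_nonneg fun k _ => mul_nonneg (inv_nonneg.2 (hl k).le) (Complex.normSq_nonneg _)
  have hT0 : 0 ≤ T := Finset.sum_nonneg fun k _ => inv_nonneg.2 (hl k).le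
  have hcurv : ∑ k, (l k)⁻¹ * (∑ a, ∑ b, star (p a) *
      dz k (dzbar k fun w => Gt w a b) 0 * p b).re ≤ T * ((n : ℝ) ^ 4 * B * B' ^ 2 * u) := by
    rw [hT, Finset.sum_mul]
    exact Finset.sum_le_sum fun k _ => mul_le_mul_of_nonneg_left
      (curvature_term_le hG h1 hP hB hB' p k) (inv_nonneg.2 (hl k).le)
  have hcs : -(Real.sqrt u * Real.sqrt (∑ a, Complex.normSq (f a))) ≤
      (∑ a, star (p a) * f a).re := by
    have h3 : ‖∑ a, star (p a) * f a‖ ≤ ∑ a, ‖p a‖ * ‖f a‖ :=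
      (norm_sum_le _ _).trans (le_of_eq (Finset.sum_congr rfl fun a _ => by
        rw [norm_mul, norm_star]))
    have h4 := Real.sum_mul_le_sqrt_mul_sqrt Finset.univ (fun a => ‖p a‖) (fun a => ‖f a‖)
    simp only [← Complex.normSq_eq_norm_sq] at h4
    have h5 := (abs_le.1 ((Complex.abs_re_le_norm _).trans (h3.trans h4))).1
    exact h5
  have ht := abs_le.1 hφK
  -- The value t of α' lies between -(D + K) and -(n⁴ B B'² + 1). The upper bound lets -t u T absorb
  -- the curvature and leave u T; the lower bound gives (n + 2) t u ≥ -C₁ u, which `habs` absorbs by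
  -- means of u X + u T.
  set t := φ z - D with htdef
  have hK0 : 0 ≤ K := (abs_nonneg _).trans hφK
  have e1 : -(C₁ * u) ≤ ((n : ℝ) + 2) * t * u := by
    have h3 : ((n : ℝ) + 2) * (-(D + K)) ≤ ((n : ℝ) + 2) * t :=
      mul_le_mul_of_nonneg_left (by linarith) (by positivity)
    have h4 : -C₁ ≤ ((n : ℝ) + 2) * t := by linarith
    calc -(C₁ * u) = -C₁ * u := by ring
      _ ≤ _ := mul_le_mul_of_nonneg_right h4 hu0
  have e2 : 0 ≤ -(2 * t) * X := by
    have h3 : 0 ≤ (n : ℝ) ^ 4 * B * B' ^ 2 + 1 := by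
      rcases Nat.eq_zero_or_pos n with h0 | h0
      · subst h0; simp
      · have : 0 ≤ B := (norm_nonneg _).trans (hB ⟨0, h0⟩ ⟨0, h0⟩ ⟨0, h0⟩ ⟨0, h0⟩)
        positivity
    exact mul_nonneg (by linarith) hX0
  have e3 : ((n : ℝ) ^ 4 * B * B' ^ 2 + 1) * (u * T) ≤ -t * (u * T) :=
    mul_le_mul_of_nonneg_right (by linarith) (mul_nonneg hu0 hT0)
  nlinarith [e1, e2, e3, hcs, hcurv, habs, hT0]

end PointwiseBound

/-! ### Transition maps, tensors and functions on the manifold. -/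

section Tensors

variable {n : ℕ} {M : Type*} [TopologicalSpace M] [ChartedSpace (Cn n) M]

omit [ChartedSpace (Cn n) M] in
theorem mem_trans_source_iff {e e' : OpenPartialHomeomorph M (Cn n)} {z : Cn n} :
    z ∈ (e.symm.trans e').source ↔ z ∈ e.target ∧ e.symm z ∈ e'.source := by
  simp

omit [ChartedSpace (Cn n) M] in
theorem mem_trans_source {e e' : OpenPartialHomeomorph M (Cn n)} {x : M} (hx : x ∈ e.source)
    (hx' : x ∈ e'.source) : e x ∈ (e.symm.trans e').source :=
  mem_trans_source_iff.2 ⟨e.map_source hx, by rwa [e.left_inv hx]⟩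

theorem contDiffAt_transition [IsManifold 𝓘(ℂ, Cn n) ω M] {e e' : OpenPartialHomeomorph M (Cn n)}
    (he : e ∈ atlas (Cn n) M) (he' : e' ∈ atlas (Cn n) M) {z : Cn n}
    (hz : z ∈ (e.symm.trans e').source) : ContDiffAt ℂ ω (e' ∘ e.symm) z := by
  have h : e.symm.trans e' ∈ contDiffGroupoid ω 𝓘(ℂ, Cn n) :=
    HasGroupoid.compatible he he'
  rw [contDiffGroupoid, mem_groupoid_of_pregroupoid] at h
  have h3 : ContDiffOn ℂ ω (e' ∘ e.symm) (e.symm.trans e').source := by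
    simpa [contDiffPregroupoid] using h.1
  exact h3.contDiffAt ((e.symm.trans e').open_source.mem_nhds hz)

theorem differentiableAt_transition [IsManifold 𝓘(ℂ, Cn n) ω M]
    {e e' : OpenPartialHomeomorph M (Cn n)}
    (he : e ∈ atlas (Cn n) M) (he' : e' ∈ atlas (Cn n) M) {z : Cn n}
    (hz : z ∈ (e.symm.trans e').source) : DifferentiableAt ℂ (e' ∘ e.symm) z :=
  (contDiffAt_transition he he' hz).differentiableAt (by simp)

omit [ChartedSpace (Cn n) M] in
theorem eventually_mem_trans_source {e e' : OpenPartialHomeomorph M (Cn n)} {z : Cn n}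
    (hz : z ∈ (e.symm.trans e').source) : ∀ᶠ w in nhds z, w ∈ (e.symm.trans e').source :=
  (e.symm.trans e').open_source.mem_nhds hz

theorem jacobian_mul_jacobian [IsManifold 𝓘(ℂ, Cn n) ω M] {e e' : OpenPartialHomeomorph M (Cn n)}
    (he : e ∈ atlas (Cn n) M) (he' : e' ∈ atlas (Cn n) M) {z : Cn n}
    (hz : z ∈ (e.symm.trans e').source) :
    jacobian (e ∘ e'.symm) (e' (e.symm z)) * jacobian (e' ∘ e.symm) z = 1 := by
  obtain ⟨hz1, hz2⟩ := mem_trans_source_iff.1 hz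
  have hz' : e' (e.symm z) ∈ (e'.symm.trans e).source :=
    mem_trans_source hz2 (e.map_target hz1)
  have h1 := (differentiableAt_transition he he' hz).hasFDerivAt
  have h2 := (differentiableAt_transition he' he hz').hasFDerivAt
  have h3 : HasFDerivAt ((e ∘ e'.symm) ∘ (e' ∘ e.symm)) _ z := h2.comp z h1
  have h4 : (e ∘ e'.symm) ∘ (e' ∘ e.symm) =ᶠ[nhds z] id := by
    filter_upwards [eventually_mem_trans_source hz] with w hw
    obtain ⟨hw1, hw2⟩ := mem_trans_source_iff.1 hw
    simp [e'.left_inv hw2, e.right_inv hw1]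
  have h5 := h3.unique ((hasFDerivAt_id z).congr_of_eventuallyEq h4)
  ext a i
  have h6 := congrFun (congrArg (fun T : Cn n →L[ℂ] Cn n => T (Pi.single i 1)) h5) a
  simp only [ContinuousLinearMap.comp_apply, ContinuousLinearMap.id_apply] at h6
  rw [Matrix.mul_apply, Matrix.one_apply, ← Pi.single_apply, ← h6]
  have h7 : fderiv ℂ (e' ∘ e.symm) z (Pi.single i 1) =
      ∑ b, jacobian (e' ∘ e.symm) z b i • (Pi.single b 1 : Cn n) := by
    funext c
    simp [jacobian, Finset.sum_apply, Pi.single_apply]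
  rw [h7, map_sum, Finset.sum_apply]
  refine Finset.sum_congr rfl fun b _ => ?_
  rw [map_smul, Pi.smul_apply, smul_eq_mul, mul_comm]
  rfl

theorem isUnit_det_jacobian [IsManifold 𝓘(ℂ, Cn n) ω M] {e e' : OpenPartialHomeomorph M (Cn n)}
    (he : e ∈ atlas (Cn n) M) (he' : e' ∈ atlas (Cn n) M) {z : Cn n}
    (hz : z ∈ (e.symm.trans e').source) : IsUnit (jacobian (e' ∘ e.symm) z).det := by
  have h := congrArg Matrix.det (jacobian_mul_jacobian he he' hz)
  rw [Matrix.det_mul, Matrix.det_one] at h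
  exact IsUnit.of_mul_eq_one_right _ h

/-- A function that is smooth in the charts of the atlas. -/
def SmoothFn (f : M → ℝ) : Prop :=
  ∀ e ∈ atlas (Cn n) M, ContDiffOn ℝ ∞ (fun z => f (e.symm z)) e.target

theorem SmoothFn.contDiffAt {f : M → ℝ} (hf : SmoothFn (n := n) f)
    {e : OpenPartialHomeomorph M (Cn n)} (he : e ∈ atlas (Cn n) M) {z : Cn n} (hz : z ∈ e.target) :
    ContDiffAt ℝ ∞ (fun z => f (e.symm z)) z :=
  (hf e he).contDiffAt (e.open_target.mem_nhds hz)

theorem SmoothFn.contDiffAt_inChart {f : M → ℝ} (hf : SmoothFn (n := n) f)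
    {e : OpenPartialHomeomorph M (Cn n)} (he : e ∈ atlas (Cn n) M) {z : Cn n} (hz : z ∈ e.target) :
    ContDiffAt ℝ ∞ (inChart e f) z :=
  contDiffAt_ofReal (hf.contDiffAt he hz)

theorem SmoothFn.continuous {f : M → ℝ} (hf : SmoothFn (n := n) f) : Continuous f := by
  rw [continuous_iff_continuousAt]
  intro x
  have hx := mem_chart_source (Cn n) x
  have h := (hf.contDiffAt (chart_mem_atlas (Cn n) x) ((chartAt (Cn n) x).map_source hx)).continuousAt
  have h2 : ContinuousAt ((fun z => f ((chartAt (Cn n) x).symm z)) ∘ chartAt (Cn n) x) x :=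
    h.comp ((chartAt (Cn n) x).continuousAt hx)
  refine h2.congr ?_
  filter_upwards [(chartAt (Cn n) x).open_source.mem_nhds hx] with y hy
  simp [(chartAt (Cn n) x).left_inv hy]

theorem SmoothFn.mul {f f' : M → ℝ} (hf : SmoothFn (n := n) f) (hf' : SmoothFn (n := n) f') :
    SmoothFn (n := n) fun x => f x * f' x := fun e he => (hf e he).mul (hf' e he)

theorem SmoothFn.add_const {f : M → ℝ} (hf : SmoothFn (n := n) f) (c : ℝ) :
    SmoothFn (n := n) fun x => f x + c := fun e he => (hf e he).add contDiffOn_const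

theorem SmoothFn.comp {f : M → ℝ} (hf : SmoothFn (n := n) f) {ψ : ℝ → ℝ}
    (hψ : ∀ x, ContDiffAt ℝ ∞ ψ (f x)) : SmoothFn (n := n) fun x => ψ (f x) := fun e he z hz =>
  (ContDiffAt.comp z (hψ (e.symm z)) (hf.contDiffAt he hz)).contDiffWithinAt

/-- Families of matrices in the charts that transform as the components of a form of type
`(1, 1)`. -/
def IsTensor (T : OpenPartialHomeomorph M (Cn n) → Cn n → Matrix (Fin n) (Fin n) ℂ) : Prop :=
  ∀ e ∈ atlas (Cn n) M, ∀ e' ∈ atlas (Cn n) M, ∀ z ∈ (e.symm.trans e').source,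
    T e z = (jacobian (e' ∘ e.symm) z).transpose * T e' (e' (e.symm z)) *
      (jacobian (e' ∘ e.symm) z).map (starRingEnd ℂ)

/-- The smoothness of the components. -/
def SmoothTensor (T : OpenPartialHomeomorph M (Cn n) → Cn n → Matrix (Fin n) (Fin n) ℂ) : Prop :=
  ∀ e ∈ atlas (Cn n) M, ∀ z ∈ e.target, ∀ i j, ContDiffAt ℝ ∞ (fun w => T e w i j) z

/-- The complex Hessian of a function on a manifold. -/
def hessT (f : M → ℝ) (e : OpenPartialHomeomorph M (Cn n)) (z : Cn n) :
    Matrix (Fin n) (Fin n) ℂ := complexHessian (inChart e f) z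

/-- The tensor `∂f ⊗ ∂̄f` of a function on a manifold. -/
def gradT (f : M → ℝ) (e : OpenPartialHomeomorph M (Cn n)) (z : Cn n) :
    Matrix (Fin n) (Fin n) ℂ := gradMatrix (inChart e f) z

omit [ChartedSpace (Cn n) M] in
theorem inChart_eventuallyEq (f : M → ℝ) {e e' : OpenPartialHomeomorph M (Cn n)} {z : Cn n}
    (hz : z ∈ (e.symm.trans e').source) :
    inChart e f =ᶠ[nhds z] fun w => inChart e' f ((e' ∘ e.symm) w) := by
  filter_upwards [eventually_mem_trans_source hz] with w hw
  simp [inChart, e'.left_inv (mem_trans_source_iff.1 hw).2]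

theorem complexHessian_congr {f f' : Cn n → ℂ} {z : Cn n} (h : f =ᶠ[nhds z] f') :
    complexHessian f z = complexHessian f' z := by
  ext i j
  simp only [complexHessian, Matrix.of_apply, dz_eq_wirt, dzbar_eq_wirt]
  exact wirt_congr (wirt_eventuallyEq h)

theorem gradMatrix_congr {f f' : Cn n → ℂ} {z : Cn n} (h : f =ᶠ[nhds z] f') :
    gradMatrix f z = gradMatrix f' z := by
  ext i j
  simp only [gradMatrix, Matrix.of_apply, dz_eq_wirt, dzbar_eq_wirt, wirt_congr h]

theorem SmoothFn.isTensor_hessT [IsManifold 𝓘(ℂ, Cn n) ω M] {f : M → ℝ}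
    (hf : SmoothFn (n := n) f) : IsTensor (hessT (n := n) f) := by
  intro e he e' he' z hz
  have hz' : e' (e.symm z) ∈ e'.target := e'.map_source (mem_trans_source_iff.1 hz).2
  rw [hessT, complexHessian_congr (inChart_eventuallyEq f hz)]
  refine complexHessian_comp_holomorphic (f := inChart e' f) ?_ ?_ ?_
  · filter_upwards [eventually_mem_trans_source hz] with w hw
    exact differentiableAt_transition he he' hw
  · exact (contDiffAt_transition he he' hz).of_le (by simp)
  · exact hf.contDiffAt_inChart he' hz'

theorem SmoothFn.isTensor_gradT [IsManifold 𝓘(ℂ, Cn n) ω M] {f : M → ℝ}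
    (hf : SmoothFn (n := n) f) : IsTensor (gradT (n := n) f) := by
  intro e he e' he' z hz
  have hz' : e' (e.symm z) ∈ e'.target := e'.map_source (mem_trans_source_iff.1 hz).2
  rw [gradT, gradMatrix_congr (inChart_eventuallyEq f hz)]
  exact gradMatrix_comp_holomorphic (f := inChart e' f) (differentiableAt_transition he he' hz)
    (hf.contDiffAt_inChart he' hz').diff

theorem SmoothFn.smoothTensor_hessT {f : M → ℝ} (hf : SmoothFn (n := n) f) :
    SmoothTensor (hessT (n := n) f) := fun _ he _ hz _ _ =>
  ContDiffAt.dz (ContDiffAt.dzbar (hf.contDiffAt_inChart he hz))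

theorem SmoothFn.smoothTensor_gradT {f : M → ℝ} (hf : SmoothFn (n := n) f) :
    SmoothTensor (gradT (n := n) f) := fun _ he _ hz _ _ =>
  (ContDiffAt.dz (hf.contDiffAt_inChart he hz)).mul (ContDiffAt.dzbar (hf.contDiffAt_inChart he hz))

theorem KahlerMetric.isTensor (g : KahlerMetric n M) : IsTensor g.coeff := g.transform

theorem KahlerMetric.smoothTensor (g : KahlerMetric n M) : SmoothTensor g.coeff :=
  fun e he _ hz i j => (g.smooth e he i j).contDiffAt (e.open_target.mem_nhds hz)

theorem IsTensor.add {T T' : OpenPartialHomeomorph M (Cn n) → Cn n → Matrix (Fin n) (Fin n) ℂ}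
    (hT : IsTensor T) (hT' : IsTensor T') : IsTensor fun e z => T e z + T' e z := by
  intro e he e' he' z hz
  simp only
  rw [hT e he e' he' z hz, hT' e he e' he' z hz, Matrix.mul_add, Matrix.add_mul]

theorem SmoothTensor.add {T T' : OpenPartialHomeomorph M (Cn n) → Cn n → Matrix (Fin n) (Fin n) ℂ}
    (hT : SmoothTensor T) (hT' : SmoothTensor T') : SmoothTensor fun e z => T e z + T' e z :=
  fun e he z hz i j => (hT e he z hz i j).add (hT' e he z hz i j)

/-- The trace of `B` with respect to `A`, as a function on the manifold. -/
def contrM (A B : OpenPartialHomeomorph M (Cn n) → Cn n → Matrix (Fin n) (Fin n) ℂ) (x : M) : ℝ :=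
  contr (A (chartAt (Cn n) x) (chartAt (Cn n) x x)) (B (chartAt (Cn n) x) (chartAt (Cn n) x x))

/-- The Jacobian replaces A⁻¹ B by a conjugate matrix, so the trace is the same in every chart.
Pointwise inequalities may therefore be proved in whichever chart carries uniform bounds. -/
theorem contrM_eq [IsManifold 𝓘(ℂ, Cn n) ω M]
    {A B : OpenPartialHomeomorph M (Cn n) → Cn n → Matrix (Fin n) (Fin n) ℂ}
    (hA : IsTensor A) (hB : IsTensor B) {e : OpenPartialHomeomorph M (Cn n)}
    (he : e ∈ atlas (Cn n) M) {x : M} (hx : x ∈ e.source) :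
    contrM A B x = contr (A e (e x)) (B e (e x)) := by
  have hc := chart_mem_atlas (Cn n) x
  have hz := mem_trans_source hx (mem_chart_source (Cn n) x)
  rw [hA e he _ hc _ hz, hB e he _ hc _ hz, contr_congr (isUnit_det_jacobian he hc hz),
    e.left_inv hx]
  rfl

theorem smoothFn_contrM [IsManifold 𝓘(ℂ, Cn n) ω M]
    {A B : OpenPartialHomeomorph M (Cn n) → Cn n → Matrix (Fin n) (Fin n) ℂ}
    (hA : IsTensor A) (hB : IsTensor B) (hAs : SmoothTensor A) (hBs : SmoothTensor B)
    (hA0 : ∀ e ∈ atlas (Cn n) M, ∀ z ∈ e.target, (A e z).PosDef) :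
    SmoothFn (n := n) (contrM A B) := by
  intro e he z hz
  refine ContDiffAt.contDiffWithinAt ?_
  have h1 : (fun z => contrM A B (e.symm z)) =ᶠ[nhds z] fun z => contr (A e z) (B e z) := by
    filter_upwards [e.open_target.mem_nhds hz] with w hw
    rw [contrM_eq hA hB he (e.map_target hw), e.right_inv hw]
  refine ContDiffAt.congr_of_eventuallyEq ?_ h1
  simp only [contr, Matrix.trace, Matrix.diag, Matrix.mul_apply]
  refine Complex.reCLM.contDiff.contDiffAt.comp z (ContDiffAt.sum fun i _ => ContDiffAt.sum
    fun j _ => (contDiffAt_inv_matrix (hAs e he z hz) ?_ i j).mul (hBs e he z hz j i))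
  exact ((Matrix.isUnit_iff_isUnit_det _).1 (hA0 e he z hz).isUnit).ne_zero

theorem gradNorm_eq_sqrt (g : KahlerMetric n M) (f : M → ℝ) (x : M) :
    gradNorm g f x = Real.sqrt (contrM g.coeff (gradT f) x) := by
  rw [gradNorm, contrM, contr]
  congr 2
  simp only [Matrix.trace, Matrix.diag, Matrix.mul_apply, gradT, gradMatrix, Matrix.of_apply]
  rw [Finset.sum_comm]
  exact Finset.sum_congr rfl fun a _ => Finset.sum_congr rfl fun b _ => by ring

end Tensors

/-! ### Partitions of unity, solutions and the global differential inequality. -/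

section Solutions

variable {n : ℕ} {M : Type*} [TopologicalSpace M] [ChartedSpace (Cn n) M]

theorem isManifold_real [IsManifold 𝓘(ℂ, Cn n) ω M] : IsManifold 𝓘(ℝ, Cn n) ∞ M := by
  refine isManifold_of_contDiffOn _ _ _ fun e e' he he' => ?_
  intro z hz
  have hz' : z ∈ (e.symm.trans e').source := by simpa using hz
  have h := ((contDiffAt_transition he he' hz').of_le (show (∞ : ℕ∞ω) ≤ ω by simp)).restrict_scalars ℝ
  exact h.contDiffWithinAt

theorem smoothFn_of_contMDiff [IsManifold 𝓘(ℂ, Cn n) ω M] {f : M → ℝ}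
    (hf : ContMDiff 𝓘(ℝ, Cn n) 𝓘(ℝ, ℝ) ∞ f) : SmoothFn (n := n) f := by
  have := isManifold_real (n := n) (M := M)
  intro e he
  have h1 : ContMDiffOn 𝓘(ℝ, Cn n) 𝓘(ℝ, Cn n) ∞ e.symm e.target :=
    contMDiffOn_symm_of_mem_maximalAtlas (IsManifold.subset_maximalAtlas he)
  exact contMDiffOn_iff_contDiffOn.1 (hf.comp_contMDiffOn h1)

/-- A finite smooth partition of unity subordinate to charts of the atlas. -/
structure ChartPartition (n : ℕ) (M : Type*) [TopologicalSpace M] [ChartedSpace (Cn n) M]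
    (ι : Type*) [Fintype ι] where
  /-- The charts. -/
  e : ι → OpenPartialHomeomorph M (Cn n)
  /-- The functions. -/
  ρ : ι → M → ℝ
  mem_atlas : ∀ i, e i ∈ atlas (Cn n) M
  smooth : ∀ i, SmoothFn (n := n) (ρ i)
  nonneg : ∀ i x, 0 ≤ ρ i x
  sum_eq_one : ∀ x, ∑ i, ρ i x = 1
  tsupport_subset : ∀ i, tsupport (ρ i) ⊆ (e i).source

/-- Finitely many preferred charts cover M, and the complex atlas, read over the reals, carries
smooth partitions of unity. Uniform constants will come from the compact supports, since components
in a chart may degenerate near the edge of its target. -/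
theorem exists_chartPartition [IsManifold 𝓘(ℂ, Cn n) ω M] [T2Space M] [CompactSpace M] :
    ∃ t : Finset M, Nonempty (ChartPartition n M t) := by
  have := isManifold_real (n := n) (M := M)
  obtain ⟨t, ht⟩ := CompactSpace.elim_nhds_subcover (fun x : M => (chartAt (Cn n) x).source)
    fun x => (chartAt (Cn n) x).open_source.mem_nhds (mem_chart_source (Cn n) x)
  have hcov : (Set.univ : Set M) ⊆ ⋃ i : t, (chartAt (Cn n) (i : M)).source := by
    intro x _
    have hx : x ∈ ⋃ y ∈ t, (chartAt (Cn n) y).source := by rw [ht]; trivial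
    simp only [Set.mem_iUnion] at hx ⊢
    obtain ⟨y, hy, hxy⟩ := hx
    exact ⟨⟨y, hy⟩, hxy⟩
  obtain ⟨ρ, hρ⟩ := SmoothPartitionOfUnity.exists_isSubordinate 𝓘(ℝ, Cn n) isClosed_univ
    (fun i : t => (chartAt (Cn n) (i : M)).source) (fun i => (chartAt (Cn n) (i : M)).open_source)
    hcov
  refine ⟨t, ⟨⟨fun i => chartAt (Cn n) (i : M), fun i => ρ i, fun i => chart_mem_atlas _ _,
    fun i => smoothFn_of_contMDiff (ρ i).contMDiff, fun i x => ρ.nonneg i x, fun x => ?_,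
    fun i => hρ i⟩⟩⟩
  rw [← finsum_eq_sum_of_fintype]
  exact ρ.sum_eq_one (Set.mem_univ x)

theorem ChartPartition.exists_mem_tsupport {ι : Type*} [Fintype ι] (P : ChartPartition n M ι)
    (x : M) : ∃ i, x ∈ tsupport (P.ρ i) := by
  by_contra! h
  have h1 : ∑ i, P.ρ i x = 0 := Finset.sum_eq_zero fun i _ => by
    by_contra h2
    exact h i (subset_tsupport _ h2)
  rw [P.sum_eq_one] at h1
  exact one_ne_zero h1

/-- A function that is continuous on the targets of the charts is bounded on the images of the
supports of the partition of unity. -/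
theorem ChartPartition.exists_bound [CompactSpace M] {ι : Type*} [Fintype ι]
    (P : ChartPartition n M ι)
    {E : Type*} [SeminormedAddCommGroup E]
    (f : OpenPartialHomeomorph M (Cn n) → Cn n → E)
    (hf : ∀ e ∈ atlas (Cn n) M, ∀ z ∈ e.target, ContinuousAt (f e) z) :
    ∃ B : ℝ, 0 ≤ B ∧ ∀ i, ∀ x ∈ tsupport (P.ρ i), ‖f (P.e i) (P.e i x)‖ ≤ B := by
  have h1 : ∀ i, ∃ B : ℝ, ∀ x ∈ tsupport (P.ρ i), ‖f (P.e i) (P.e i x)‖ ≤ B := by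
    intro i
    have hc : ContinuousOn (fun x => f (P.e i) (P.e i x)) (tsupport (P.ρ i)) := fun x hx =>
      (ContinuousAt.comp (g := f (P.e i))
        (hf _ (P.mem_atlas i) _ ((P.e i).map_source (P.tsupport_subset i hx)))
        ((P.e i).continuousAt (P.tsupport_subset i hx))).continuousWithinAt
    exact (isClosed_tsupport _).isCompact.exists_bound_of_continuousOn hc
  choose B hB using h1
  refine ⟨∑ i, |B i|, Finset.sum_nonneg fun i _ => abs_nonneg _, fun i x hx => ?_⟩
  exact ((hB i x hx).trans (le_abs_self _)).trans
    (Finset.single_le_sum (f := fun i => |B i|) (fun i _ => abs_nonneg _) (Finset.mem_univ i))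

/-- The metric `g_{i j̄} + φ_{i j̄}`. -/
def perturbed (g : KahlerMetric n M) (φ : M → ℝ) (e : OpenPartialHomeomorph M (Cn n)) (z : Cn n) :
    Matrix (Fin n) (Fin n) ℂ := g.coeff e z + hessT φ e z

namespace IsSmoothSolution

variable [IsManifold 𝓘(ℂ, Cn n) ω M] {g : KahlerMetric n M} {F φ : M → ℝ}

theorem smoothFn (h : IsSmoothSolution g F φ) : SmoothFn (n := n) φ :=
  smoothFn_of_contMDiff h.smooth

theorem isTensor (h : IsSmoothSolution g F φ) : IsTensor (perturbed g φ) :=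
  g.isTensor.add h.smoothFn.isTensor_hessT

theorem smoothTensor (h : IsSmoothSolution g F φ) : SmoothTensor (perturbed g φ) :=
  g.smoothTensor.add h.smoothFn.smoothTensor_hessT

omit [IsManifold 𝓘(ℂ, Cn n) ω M] in
theorem posDef_perturbed (h : IsSmoothSolution g F φ) : ∀ e ∈ atlas (Cn n) M, ∀ z ∈ e.target,
    (perturbed g φ e z).PosDef := h.posDef

end IsSmoothSolution

theorem det_eq_ofReal_re {A : Matrix (Fin n) (Fin n) ℂ} (hA : A.PosDef) :
    0 < A.det.re ∧ A.det = (A.det.re : ℂ) := by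
  have h := hA.det_pos
  exact ⟨(Complex.lt_def.1 h).1, Complex.eq_re_of_ofReal_le (r := 0) (by simpa using h.le)⟩

namespace IsSmoothSolution

variable [IsManifold 𝓘(ℂ, Cn n) ω M] {g : KahlerMetric n M} {F φ : M → ℝ}

omit [IsManifold 𝓘(ℂ, Cn n) ω M] in
theorem det_perturbed (h : IsSmoothSolution g F φ) {e : OpenPartialHomeomorph M (Cn n)}
    (he : e ∈ atlas (Cn n) M) {z : Cn n} (hz : z ∈ e.target) :
    (perturbed g φ e z).det = (Real.exp (F (e.symm z)) : ℂ) * (g.coeff e z).det := by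
  obtain ⟨h1, h2⟩ := det_eq_ofReal_re (h.posDef_perturbed e he z hz)
  obtain ⟨h3, h4⟩ := det_eq_ofReal_re (g.posDef e he z hz)
  have h5 : Real.exp (F (e.symm z)) = (perturbed g φ e z).det.re / (g.coeff e z).det.re := by
    rw [← h.equation e he z hz]
    exact Real.exp_log (div_pos h1 h3)
  rw [h5, h2, h4, ← Complex.ofReal_mul]
  simp only [Complex.ofReal_re]
  rw [div_mul_cancel₀ _ h3.ne']

/-- The equation itself exhibits F as the logarithm of a smooth positive function. -/
theorem smoothFn_right (h : IsSmoothSolution g F φ) : SmoothFn (n := n) F := by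
  intro e he z hz
  refine ContDiffAt.contDiffWithinAt ?_
  have h1 : (fun w => F (e.symm w)) =ᶠ[nhds z] fun w =>
      Real.log ((perturbed g φ e w).det.re / (g.coeff e w).det.re) := by
    filter_upwards [e.open_target.mem_nhds hz] with w hw
    exact (h.equation e he w hw).symm
  refine ContDiffAt.congr_of_eventuallyEq ?_ h1
  obtain ⟨h2, _⟩ := det_eq_ofReal_re (h.posDef_perturbed e he z hz)
  obtain ⟨h3, _⟩ := det_eq_ofReal_re (g.posDef e he z hz)
  have hre : ∀ {T : OpenPartialHomeomorph M (Cn n) → Cn n → Matrix (Fin n) (Fin n) ℂ},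
      SmoothTensor T → ContDiffAt ℝ ∞ (fun w => (T e w).det.re) z := fun hT =>
    Complex.reCLM.contDiff.contDiffAt.comp z (contDiffAt_det (hT e he z hz))
  exact ((hre h.smoothTensor).div (hre g.smoothTensor) h3.ne').log (div_pos h2 h3).ne'

end IsSmoothSolution

/-- The function `e^{A(φ)} |∂φ|²` to which the maximum principle type argument is applied. -/
def weightedGrad (g : KahlerMetric n M) (D : ℝ) (φ : M → ℝ) (x : M) : ℝ :=
  Real.exp (weight D (φ x)) * contrM g.coeff (gradT φ) x

theorem smoothFn_weightedGrad [IsManifold 𝓘(ℂ, Cn n) ω M] (g : KahlerMetric n M) (D : ℝ)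
    {φ : M → ℝ} (hφ : SmoothFn (n := n) φ) : SmoothFn (n := n) (weightedGrad g D φ) :=
  (hφ.comp (ψ := fun t => Real.exp (weight D t)) fun _ => (contDiff_weight D).exp.contDiffAt).mul
    (smoothFn_contrM g.isTensor hφ.isTensor_gradT g.smoothTensor hφ.smoothTensor_gradT g.posDef)

/-- The differential inequality for `e^{A(φ)} |∂φ|²`, with constants that depend only on bounds for
`φ` and `F`. -/
theorem exists_laplacian_weightedGrad_ge [IsManifold 𝓘(ℂ, Cn n) ω M] [T2Space M] [CompactSpace M]
    (hn : 0 < n) (g : KahlerMetric n M) (K N : ℝ) :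
    ∃ D C : ℝ, 0 ≤ C ∧ ∀ F φ : M → ℝ, IsSmoothSolution g F φ → (∀ x, |φ x| ≤ K) →
      (∀ x, F x ≤ N) → ∀ x,
      Real.exp (weight D (φ x)) * (contrM g.coeff (perturbed g φ) x +
        contrM g.coeff (gradT φ) x - C -
        2 * (Real.sqrt (contrM g.coeff (gradT φ) x) * Real.sqrt (contrM g.coeff (gradT F) x))) ≤
      contrM (perturbed g φ) (hessT (weightedGrad g D φ)) x := by
  obtain ⟨t, ⟨P⟩⟩ := exists_chartPartition (n := n) (M := M)
  -- Second derivatives and inverse of g are bounded uniformly on the compact supports, and every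
  -- point lies in one of them; this makes D and C independent of the point and of the solution.
  obtain ⟨B, hB0, hB⟩ := P.exists_bound (fun e z => fun (a b c d : Fin n) =>
    dz c (dzbar d fun w => g.coeff e w a b) z) (fun e he z hz => by
      refine continuousAt_pi.2 fun a => continuousAt_pi.2 fun b => continuousAt_pi.2 fun c =>
        continuousAt_pi.2 fun d => ?_
      exact (ContDiffAt.dz (ContDiffAt.dzbar (g.smoothTensor e he z hz a b))).continuousAt)
  obtain ⟨B', hB'0, hB'⟩ := P.exists_bound (fun e z => fun c : Fin n => (g.coeff e z)⁻¹ c c)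
    (fun e he z hz => continuousAt_pi.2 fun c => (contDiffAt_inv_matrix (g.smoothTensor e he z hz)
      ((Matrix.isUnit_iff_isUnit_det _).1 (g.posDef e he z hz).isUnit).ne_zero c c).continuousAt)
  -- `|K|` is used because K has no assumed sign; D is the least value that the chart inequality
  -- allows.
  set D : ℝ := (n : ℝ) ^ 4 * B * B' ^ 2 + |K| + 1 with hD
  set C₁ : ℝ := ((n : ℝ) + 2) * (D + |K|) with hC₁
  obtain ⟨C, hC0, hC⟩ := exists_absorption_const hn C₁ N (by positivity)
  refine ⟨D, C + 2 * n, by positivity, fun F φ h hφK hFN x => ?_⟩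
  obtain ⟨i, hi⟩ := P.exists_mem_tsupport x
  have hx := P.tsupport_subset i hi
  have he := P.mem_atlas i
  set e := P.e i with hedef
  have hz : e x ∈ e.target := e.map_source hx
  have hF := h.smoothFn_right
  have hφ := h.smoothFn
  have hv := smoothFn_weightedGrad g D hφ
  have htgt := e.open_target.mem_nhds hz
  have hbound : ∀ {E : Type} [SeminormedAddCommGroup E] (f : Fin n → E) (a : Fin n) (b : ℝ),
      ‖f‖ ≤ b → ‖f a‖ ≤ b := fun f a b hf => (norm_le_pi_norm f a).trans hf
  have hmain := contr_complexHessian_weighted_grad_ge (G := g.coeff e)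
    (φ := fun w => φ (e.symm w)) (F := fun w => F (e.symm w)) (z := e x) (K := |K|) (B := B)
    (B' := B') (D := D) (C₁ := C₁) (C := C) (g.smoothTensor e he _ hz)
    (Filter.mem_of_superset htgt fun w hw => g.posDef e he w hw)
    (fun i j k => g.closed e he _ hz i j k)
    (Filter.mem_of_superset htgt fun w hw => hφ.contDiffAt he hw) (hF.contDiffAt he hz).diff
    (h.posDef_perturbed e he _ hz) (Filter.mem_of_superset htgt fun w hw => h.det_perturbed he hw)
    (fun a b c d => hbound _ d _ (hbound _ c _ (hbound _ b _ (hbound _ a _ (hB i x hi)))))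
    (fun c => hbound (fun c => (g.coeff e (e x))⁻¹ c c) c _ (hB' i x hi))
    ((hφK _).trans (le_abs_self K)) le_rfl le_rfl
    (fun l p hl hp hprod => hC l p hl hp (hprod.trans (Real.exp_le_exp.2 (hFN _))))
  have hVeq : inChart e (weightedGrad g D φ) =ᶠ[nhds (e x)] fun w =>
      ((Real.exp (weight D (φ (e.symm w))) *
        contr (g.coeff e w) (gradMatrix (fun w => (φ (e.symm w) : ℂ)) w) : ℝ) : ℂ) := by
    filter_upwards [htgt] with w hw
    rw [inChart, weightedGrad, contrM_eq g.isTensor hφ.isTensor_gradT he (e.map_target hw),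
      e.right_inv hw]
    rfl
  rw [contrM_eq g.isTensor h.isTensor he hx, contrM_eq g.isTensor hφ.isTensor_gradT he hx,
    contrM_eq g.isTensor hF.isTensor_gradT he hx, contrM_eq h.isTensor hv.isTensor_hessT he hx,
    hessT, complexHessian_congr hVeq]
  simp only [e.left_inv hx] at hmain
  exact hmain

end Solutions

/-! ### The volume measure and its gluing. -/

section Volume

variable {n : ℕ} {M : Type*} [TopologicalSpace M] [ChartedSpace (Cn n) M]
  [MeasurableSpace M] [BorelSpace M]

/-- The density of the volume in a chart. -/
def density (g : KahlerMetric n M) (e : OpenPartialHomeomorph M (Cn n)) (z : Cn n) : ℝ :=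
  2 ^ n * (g.coeff e z).det.re

omit [MeasurableSpace M] [BorelSpace M] in
theorem density_pos (g : KahlerMetric n M) {e : OpenPartialHomeomorph M (Cn n)}
    (he : e ∈ atlas (Cn n) M) {z : Cn n} (hz : z ∈ e.target) : 0 < density g e z :=
  mul_pos (by positivity) (det_eq_ofReal_re (g.posDef e he z hz)).1

omit [MeasurableSpace M] [BorelSpace M] in
theorem continuousAt_density (g : KahlerMetric n M) {e : OpenPartialHomeomorph M (Cn n)}
    (he : e ∈ atlas (Cn n) M) {z : Cn n} (hz : z ∈ e.target) : ContinuousAt (density g e) z :=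
  continuousAt_const.mul (Complex.continuous_re.continuousAt.comp
    (contDiffAt_det (g.smoothTensor e he z hz)).continuousAt)

omit [MeasurableSpace M] [BorelSpace M] in
theorem aemeasurable_density (g : KahlerMetric n M) {e : OpenPartialHomeomorph M (Cn n)}
    (he : e ∈ atlas (Cn n) M) : AEMeasurable (fun z => ENNReal.ofReal (density g e z))
      ((volume : Measure (Cn n)).restrict e.target) := by
  have h : ContinuousOn (density g e) e.target := fun z hz =>
    (continuousAt_density g he hz).continuousWithinAt
  exact (h.aemeasurable e.open_target.measurableSet).ennreal_ofReal

omit [ChartedSpace (Cn n) M] in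
theorem aemeasurable_symm (e : OpenPartialHomeomorph M (Cn n)) :
    AEMeasurable e.symm ((volume : Measure (Cn n)).restrict e.target) :=
  e.continuousOn_symm.aemeasurable e.open_target.measurableSet

theorem lintegral_chartVol (g : KahlerMetric n M) {e : OpenPartialHomeomorph M (Cn n)}
    (he : e ∈ atlas (Cn n) M) {f : M → ENNReal} (hf : Measurable f) :
    ∫⁻ x, f x ∂(chartVol g e) =
      ∫⁻ z in e.target, ENNReal.ofReal (density g e z) * f (e.symm z) := by
  have h1 := aemeasurable_symm e
  have h2 : AEMeasurable e.symm (((volume : Measure (Cn n)).restrict e.target).withDensity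
      fun z => ENNReal.ofReal (2 ^ n * (g.coeff e z).det.re)) :=
    h1.mono_ac (withDensity_absolutelyContinuous _ _)
  exact (lintegral_map' hf.aemeasurable h2).trans
    (lintegral_withDensity_eq_lintegral_mul₀ (aemeasurable_density g he) (hf.comp_aemeasurable h1))

omit [ChartedSpace (Cn n) M] in
theorem measurableSet_target_inter_preimage (e : OpenPartialHomeomorph M (Cn n)) {s : Set M}
    (hs : MeasurableSet s) : MeasurableSet (e.target ∩ e.symm ⁻¹' s) := by
  have h := (continuousOn_iff_continuous_domRestrict.1 e.continuousOn_symm).measurable hs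
  have h2 := e.open_target.measurableSet.subtype_image h
  convert h2 using 1
  ext z
  simp [and_comm]

-- The real Jacobian determinant of a holomorphic map is |det J|², which is also the factor by which
-- det g changes.
omit [MeasurableSpace M] [BorelSpace M] in
theorem density_eq [IsManifold 𝓘(ℂ, Cn n) ω M] (g : KahlerMetric n M)
    {e e' : OpenPartialHomeomorph M (Cn n)} (he : e ∈ atlas (Cn n) M) (he' : e' ∈ atlas (Cn n) M)
    {z : Cn n} (hz : z ∈ (e.symm.trans e').source) :
    density g e z = |((fderiv ℂ (e' ∘ e.symm) z).restrictScalars ℝ).det| *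
      density g e' (e' (e.symm z)) := by
  have hdet : ((fderiv ℂ (e' ∘ e.symm) z).restrictScalars ℝ).det =
      Complex.normSq (jacobian (e' ∘ e.symm) z).det := by
    have h1 : (jacobian (e' ∘ e.symm) z).det =
        LinearMap.det (fderiv ℂ (e' ∘ e.symm) z : Cn n →ₗ[ℂ] Cn n) := by
      rw [← LinearMap.det_toMatrix']
      congr 1
    rw [h1, ← Algebra.norm_complex_apply, ← LinearMap.det_restrictScalars]
    rfl
  have hmap : ((jacobian (e' ∘ e.symm) z).map (starRingEnd ℂ)).det =
      (starRingEnd ℂ) (jacobian (e' ∘ e.symm) z).det := by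
    have h := RingHom.map_det (starRingEnd ℂ) (jacobian (e' ∘ e.symm) z)
    rw [RingHom.mapMatrix_apply] at h
    exact h.symm
  rw [hdet, abs_of_nonneg (Complex.normSq_nonneg _), density, density, g.transform e he e' he' z hz,
    Matrix.det_mul, Matrix.det_mul, Matrix.det_transpose, hmap, mul_right_comm, Complex.mul_conj,
    Complex.re_ofReal_mul]
  ring

/-- The change of variables formula between two charts. -/
theorem chartVol_restrict_eq [IsManifold 𝓘(ℂ, Cn n) ω M] (g : KahlerMetric n M)
    {e e' : OpenPartialHomeomorph M (Cn n)} (he : e ∈ atlas (Cn n) M) (he' : e' ∈ atlas (Cn n) M) :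
    (chartVol g e).restrict e'.source = (chartVol g e').restrict e.source := by
  refine Measure.ext fun s hs => ?_
  have key : ∀ {a b : OpenPartialHomeomorph M (Cn n)}, a ∈ atlas (Cn n) M →
      (chartVol g a).restrict b.source s =
        ∫⁻ z in a.target ∩ a.symm ⁻¹' (s ∩ b.source), ENNReal.ofReal (density g a z) := by
    intro a b ha
    have hsb := hs.inter b.open_source.measurableSet
    rw [Measure.restrict_apply hs, ← lintegral_indicator_one hsb,
      lintegral_chartVol g ha (measurable_one.indicator hsb),
      ← lintegral_indicator a.open_target.measurableSet,
      ← lintegral_indicator (measurableSet_target_inter_preimage a hsb)]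
    refine lintegral_congr fun z => ?_
    by_cases hz : z ∈ a.target
    · by_cases h : a.symm z ∈ s ∩ b.source
      · rw [Set.indicator_of_mem hz, Set.indicator_of_mem h, Set.indicator_of_mem (s := a.target ∩ _)
          ⟨hz, h⟩]
        simp
      · rw [Set.indicator_of_mem hz, Set.indicator_of_notMem h,
          Set.indicator_of_notMem (s := a.target ∩ _) fun h' => h h'.2, mul_zero]
    · rw [Set.indicator_of_notMem hz, Set.indicator_of_notMem fun h' => hz h'.1]
  rw [key he, key he']
  have himage : (e' ∘ e.symm) '' (e.target ∩ e.symm ⁻¹' (s ∩ e'.source)) =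
      e'.target ∩ e'.symm ⁻¹' (s ∩ e.source) := by
    ext w
    constructor
    · rintro ⟨z, ⟨hz1, hz2, hz3⟩, rfl⟩
      refine ⟨e'.map_source hz3, ?_⟩
      simp only [Function.comp_apply, Set.mem_preimage, e'.left_inv hz3]
      exact ⟨hz2, e.map_target hz1⟩
    · rintro ⟨hw1, hw2, hw3⟩
      refine ⟨e (e'.symm w), ⟨e.map_source hw3, ?_⟩, ?_⟩
      · simp only [Set.mem_preimage, e.left_inv hw3]
        exact ⟨hw2, e'.map_target hw1⟩
      · simp [e.left_inv hw3, e'.right_inv hw1]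
  have hmem : ∀ z ∈ e.target ∩ e.symm ⁻¹' (s ∩ e'.source), z ∈ (e.symm.trans e').source :=
    fun z hz => mem_trans_source_iff.2 ⟨hz.1, hz.2.2⟩
  have hmeas : MeasurableSet (e.target ∩ e.symm ⁻¹' (s ∩ e'.source)) :=
    measurableSet_target_inter_preimage e (hs.inter e'.open_source.measurableSet)
  rw [← himage, lintegral_image_eq_lintegral_abs_det_fderiv_mul volume hmeas
    (f' := fun z => (fderiv ℂ (e' ∘ e.symm) z).restrictScalars ℝ)
    (fun z hz => ((differentiableAt_transition he he'
      (hmem z hz)).hasFDerivAt.restrictScalars ℝ).hasFDerivWithinAt)]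
  · refine setLIntegral_congr_fun hmeas fun z hz => ?_
    rw [density_eq g he he' (hmem z hz), ENNReal.ofReal_mul (abs_nonneg _)]
    rfl
  · intro z hz w hw hzw
    have h1 : e.symm z = e.symm w := by
      have := congrArg e'.symm hzw
      simpa [e'.left_inv hz.2.2, e'.left_inv hw.2.2] using this
    have h2 := congrArg e h1
    rwa [e.right_inv hz.1, e.right_inv hw.1] at h2

theorem chartVol_compl_source (g : KahlerMetric n M) {e : OpenPartialHomeomorph M (Cn n)}
    (he : e ∈ atlas (Cn n) M) : chartVol g e e.sourceᶜ = 0 := by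
  have h := lintegral_chartVol g he (f := e.sourceᶜ.indicator 1)
    (measurable_one.indicator e.open_source.measurableSet.compl)
  rw [lintegral_indicator_one e.open_source.measurableSet.compl] at h
  rw [h, setLIntegral_congr_fun e.open_target.measurableSet (g := fun _ => 0), lintegral_zero]
  intro z hz
  have := e.map_target hz
  simp [this]

variable {ι : Type*} [Fintype ι]

/-- The volume measure, glued by means of a partition of unity. -/
def gluedVol (g : KahlerMetric n M) (P : ChartPartition n M ι) : Measure M :=
  ∑ i, (chartVol g (P.e i)).withDensity fun x => ENNReal.ofReal (P.ρ i x)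

/-- Each chart measure lies below the supremum and the weights sum to one. This one-sided comparison
suffices, as the Sobolev norm enters only through upper bounds. -/
theorem gluedVol_le_vol (g : KahlerMetric n M) (P : ChartPartition n M ι) :
    gluedVol g P ≤ vol g := by
  refine Measure.le_iff.2 fun s hs => ?_
  rw [gluedVol, Measure.finsetSum_apply]
  have hm : ∀ i, Measurable fun x => ENNReal.ofReal (P.ρ i x) := fun i =>
    (P.smooth i).continuous.measurable.ennreal_ofReal
  calc ∑ i, (chartVol g (P.e i)).withDensity (fun x => ENNReal.ofReal (P.ρ i x)) s
      ≤ ∑ i, ∫⁻ x in s, ENNReal.ofReal (P.ρ i x) ∂(vol g) := by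
        refine Finset.sum_le_sum fun i _ => ?_
        rw [withDensity_apply _ hs]
        refine lintegral_mono' (Measure.restrict_mono le_rfl ?_) le_rfl
        exact le_iSup₂_of_le (f := fun e (_ : e ∈ atlas (Cn n) M) => chartVol g e) (P.e i)
          (P.mem_atlas i) le_rfl
    _ = ∫⁻ x in s, ∑ i, ENNReal.ofReal (P.ρ i x) ∂(vol g) := by
        rw [lintegral_finsetSum _ fun i _ => hm i]
    _ = ∫⁻ x in s, 1 ∂(vol g) := by
        refine lintegral_congr fun x => ?_
        rw [← ENNReal.ofReal_sum_of_nonneg fun i _ => P.nonneg i x, P.sum_eq_one, ENNReal.ofReal_one]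
    _ = vol g s := by simp

/-- Where ρ i lives, the measure of its chart agrees with that of `e` on the overlap, and the
weights sum to one. Integrals of functions supported in one chart thus become coordinate integrals.
-/
theorem gluedVol_restrict [IsManifold 𝓘(ℂ, Cn n) ω M] (g : KahlerMetric n M)
    (P : ChartPartition n M ι) {e : OpenPartialHomeomorph M (Cn n)} (he : e ∈ atlas (Cn n) M) :
    (gluedVol g P).restrict e.source = chartVol g e := by
  have hm : ∀ i, Measurable fun x => ENNReal.ofReal (P.ρ i x) := fun i =>
    (P.smooth i).continuous.measurable.ennreal_ofReal
  have h0 : (chartVol g e).restrict e.source = chartVol g e :=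
    Measure.restrict_eq_self_of_ae_mem (by
      rw [ae_iff]; exact chartVol_compl_source g he)
  refine Measure.ext fun s hs => ?_
  rw [Measure.restrict_apply hs, gluedVol, Measure.finsetSum_apply]
  have h1 : ∀ i, (chartVol g (P.e i)).withDensity (fun x => ENNReal.ofReal (P.ρ i x))
      (s ∩ e.source) = ∫⁻ x in s, ENNReal.ofReal (P.ρ i x) ∂(chartVol g e) := by
    intro i
    rw [withDensity_apply _ (hs.inter e.open_source.measurableSet), ← Measure.restrict_restrict hs,
      ← chartVol_restrict_eq g he (P.mem_atlas i), Measure.restrict_restrict hs,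
      ← lintegral_indicator (hs.inter (P.e i).open_source.measurableSet), ← lintegral_indicator hs]
    refine lintegral_congr fun x => ?_
    by_cases hx : x ∈ (P.e i).source
    · by_cases hxs : x ∈ s <;> simp [hx, hxs]
    · have h2 : P.ρ i x = 0 := image_eq_zero_of_notMem_tsupport fun h => hx (P.tsupport_subset i h)
      by_cases hxs : x ∈ s <;> simp [hx, hxs, h2]
  simp only [h1]
  rw [← lintegral_finsetSum _ fun i _ => hm i]
  have h3 : ∀ x, ∑ i, ENNReal.ofReal (P.ρ i x) = 1 := fun x => by
    rw [← ENNReal.ofReal_sum_of_nonneg fun i _ => P.nonneg i x, P.sum_eq_one, ENNReal.ofReal_one]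
  simp [h3]

end Volume

/-! ### The divergence theorem in a chart. -/

section Divergence

variable {n : ℕ}

/-- Extension by zero of a function with compact support in an open set. -/
theorem contDiff_indicator {F : Type*} [NormedAddCommGroup F] [NormedSpace ℝ F] {U K : Set (Cn n)}
    (hU : IsOpen U) (hK : IsCompact K) (hKU : K ⊆ U) {f : Cn n → F} (hf : ContDiffOn ℝ ∞ f U)
    (h0 : ∀ z ∈ U, z ∉ K → f z = 0) :
    ContDiff ℝ ∞ (U.indicator f) ∧ HasCompactSupport (U.indicator f) := by
  have hzero : ∀ z, z ∉ K → U.indicator f z = 0 := fun z hz => by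
    by_cases h : z ∈ U
    · rw [Set.indicator_of_mem h, h0 z h hz]
    · rw [Set.indicator_of_notMem h]
  refine ⟨contDiff_iff_contDiffAt.2 fun z => ?_, HasCompactSupport.intro hK hzero⟩
  by_cases hz : z ∈ U
  · refine (hf.contDiffAt (hU.mem_nhds hz)).congr_of_eventuallyEq ?_
    filter_upwards [hU.mem_nhds hz] with w hw
    rw [Set.indicator_of_mem hw]
  · have h1 : U.indicator f =ᶠ[nhds z] fun _ => 0 := by
      filter_upwards [hK.isClosed.isOpen_compl.mem_nhds fun h => hz (hKU h)] with w hw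
      exact hzero w hw
    exact contDiffAt_const.congr_of_eventuallyEq h1

/-- Integration by parts against the constant function 1. -/
theorem integral_fderiv_eq_zero {f : Cn n → ℂ} (hf : ContDiff ℝ ∞ f) (hs : HasCompactSupport f)
    (v : Cn n) : Integrable (fun z => fderiv ℝ f z v) ∧ ∫ z, fderiv ℝ f z v = 0 := by
  have h1 : Continuous fun z => fderiv ℝ f z v :=
    (hf.continuous_fderiv (by simp)).clm_apply continuous_const
  have h2 : Integrable (fun z => fderiv ℝ f z v) :=
    h1.integrable_of_hasCompactSupport (hs.fderiv_apply (𝕜 := ℝ) v)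
  refine ⟨h2, ?_⟩
  have h := integral_mul_fderiv_eq_neg_fderiv_mul_of_integrable (𝕜 := ℂ) (μ := volume)
    (f := fun _ : Cn n => (1 : ℂ)) (g := f) (v := v) (by simp) (by simpa using h2)
    (by simpa using hf.continuous.integrable_of_hasCompactSupport hs)
    (fun _ _ => differentiableAt_const _) (fun z _ => hf.differentiable (by simp) z)
  simpa using h

theorem integral_dz_eq_zero {f : Cn n → ℂ} (hf : ContDiff ℝ ∞ f) (hs : HasCompactSupport f)
    (i : Fin n) : Integrable (dz i f) ∧ ∫ z, dz i f z = 0 := by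
  obtain ⟨h1, h2⟩ := integral_fderiv_eq_zero hf hs (Pi.single i 1)
  obtain ⟨h3, h4⟩ := integral_fderiv_eq_zero hf hs (Pi.single i Complex.I)
  refine ⟨(h1.sub (h3.const_mul Complex.I)).div_const 2, ?_⟩
  have h5 : ∫ z, dz i f z = (∫ z, fderiv ℝ f z (Pi.single i 1) -
      Complex.I * fderiv ℝ f z (Pi.single i Complex.I)) / 2 := integral_div _ _
  rw [h5, integral_sub h1 (h3.const_mul _), integral_const_mul, h2, h4]
  simp

/-- The Laplacian of a Kähler metric is a divergence. -/
theorem integral_adjugate_mul_hessian {U K : Set (Cn n)} (hU : IsOpen U) (hK : IsCompact K)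
    (hKU : K ⊆ U) {A : Cn n → Matrix (Fin n) (Fin n) ℂ} {f : Cn n → ℂ}
    (hA : ∀ z ∈ U, ∀ i j, ContDiffAt ℝ ∞ (fun w => A w i j) z)
    (hA0 : ∀ z ∈ U, (A z).det ≠ 0)
    (hAK : ∀ z ∈ U, ∀ i j k, dz k (fun w => A w i j) z = dz i (fun w => A w k j) z)
    (hf : ∀ z ∈ U, ContDiffAt ℝ ∞ f z) (h0 : ∀ z ∈ U, z ∉ K → f z = 0) :
    Integrable (U.indicator fun z => ((A z).adjugate * complexHessian f z).trace) ∧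
      ∫ z, U.indicator (fun z => ((A z).adjugate * complexHessian f z).trace) z = 0 := by
  -- The vector field whose divergence is tr(adj(A) ∂∂̄f): when ∂_i falls on the cofactor, the sum
  -- over i vanishes by closedness of the Kähler form.
  set Y : Fin n → Cn n → ℂ := fun i =>
    U.indicator fun z => ∑ j, (A z).adjugate j i * dzbar j f z with hY
  have hdf0 : ∀ z ∈ U, z ∉ K → ∀ j, dzbar j f z = 0 := by
    intro z hz hzK j
    have h1 : f =ᶠ[nhds z] fun _ => 0 := by
      filter_upwards [hU.mem_nhds hz, hK.isClosed.isOpen_compl.mem_nhds hzK] with w hw hwK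
      exact h0 w hw hwK
    rw [dzbar_eq_wirt, wirt_congr h1, wirt_const]
  have hterm : ∀ z ∈ U, ∀ i j, ContDiffAt ℝ ∞ (fun z => (A z).adjugate j i * dzbar j f z) z :=
    fun z hz i j => (contDiffAt_adjugate (hA z hz) j i).mul (ContDiffAt.dzbar (hf z hz))
  have hYs : ∀ i, ContDiff ℝ ∞ (Y i) ∧ HasCompactSupport (Y i) := fun i => by
    refine contDiff_indicator hU hK hKU (fun z hz => ?_) fun z hz hzK => ?_
    · exact (ContDiffAt.sum fun j _ => hterm z hz i j).contDiffWithinAt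
    · simp [hdf0 z hz hzK]
  have hdY : (U.indicator fun z => ((A z).adjugate * complexHessian f z).trace) =
      fun z => ∑ i, dz i (Y i) z := by
    funext z
    by_cases hz : z ∈ U
    · have h1 : ∀ i, Y i =ᶠ[nhds z] fun z => ∑ j, (A z).adjugate j i * dzbar j f z := fun i => by
        filter_upwards [hU.mem_nhds hz] with w hw
        exact Set.indicator_of_mem hw _
      have h2 : ∀ i, dz i (Y i) z = ∑ j, dz i (fun w => (A w).adjugate j i) z * dzbar j f z +
          ∑ j, (A z).adjugate j i * dz i (dzbar j f) z := by
        intro i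
        rw [dz_eq_wirt, wirt_congr (h1 i), wirt_sum fun j _ => (hterm z hz i j).diff,
          ← Finset.sum_add_distrib]
        exact Finset.sum_congr rfl fun j _ => wirt_mul (contDiffAt_adjugate (hA z hz) j i).diff
          (ContDiffAt.dzbar (hf z hz)).diff
      rw [Set.indicator_of_mem hz]
      simp only [h2, Finset.sum_add_distrib]
      rw [Finset.sum_comm]
      simp only [← Finset.sum_mul, sum_dz_adjugate_eq_zero (hA z hz) (hA0 z hz) (hAK z hz),
        zero_mul, Finset.sum_const_zero, zero_add]
      rw [Finset.sum_comm]
      simp [Matrix.trace, Matrix.mul_apply, complexHessian]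
    · rw [Set.indicator_of_notMem hz]
      refine (Finset.sum_eq_zero fun i _ => ?_).symm
      have h1 : Y i =ᶠ[nhds z] fun _ => 0 := by
        filter_upwards [hK.isClosed.isOpen_compl.mem_nhds fun h => hz (hKU h)] with w hw
        by_cases hwU : w ∈ U
        · simp only [hY, Set.indicator_of_mem hwU]
          simp [hdf0 w hwU hw]
        · exact Set.indicator_of_notMem hwU _
      rw [dz_eq_wirt, wirt_congr h1, wirt_const]
  rw [hdY]
  refine ⟨integrable_finsetSum _ fun i _ => (integral_dz_eq_zero (hYs i).1 (hYs i).2 i).1, ?_⟩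
  rw [integral_finsetSum _ fun i _ => (integral_dz_eq_zero (hYs i).1 (hYs i).2 i).1]
  exact Finset.sum_eq_zero fun i _ => (integral_dz_eq_zero (hYs i).1 (hYs i).2 i).2

end Divergence

/-! ### Integration against the glued volume. -/

section GluedVolume

variable {n : ℕ} {M : Type*} [TopologicalSpace M] [ChartedSpace (Cn n) M]
  [MeasurableSpace M] [BorelSpace M] {ι : Type*} [Fintype ι]
  [IsManifold 𝓘(ℂ, Cn n) ω M]

theorem lintegral_gluedVol (g : KahlerMetric n M) (P : ChartPartition n M ι)
    {e : OpenPartialHomeomorph M (Cn n)} (he : e ∈ atlas (Cn n) M) {f : M → ENNReal}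
    (hf : Measurable f) (h0 : ∀ x, x ∉ e.source → f x = 0) :
    ∫⁻ x, f x ∂(gluedVol g P) =
      ∫⁻ z in e.target, ENNReal.ofReal (density g e z) * f (e.symm z) := by
  rw [← lintegral_chartVol g he hf, ← gluedVol_restrict g P he,
    ← lintegral_indicator e.open_source.measurableSet]
  refine lintegral_congr fun x => ?_
  by_cases hx : x ∈ e.source
  · rw [Set.indicator_of_mem hx]
  · rw [Set.indicator_of_notMem hx, h0 x hx]

theorem integral_gluedVol (g : KahlerMetric n M) (P : ChartPartition n M ι)
    {e : OpenPartialHomeomorph M (Cn n)} (he : e ∈ atlas (Cn n) M) {f : M → ℝ}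
    (hf : Continuous f) (h0 : ∀ x, x ∉ e.source → f x = 0) :
    ∫ x, f x ∂(gluedVol g P) = ∫ z in e.target, density g e z * f (e.symm z) := by
  rw [← setIntegral_eq_integral_of_forall_compl_eq_zero h0, gluedVol_restrict g P he, chartVol]
  have h1 := aemeasurable_symm e
  have h2 : AEMeasurable e.symm (((volume : Measure (Cn n)).restrict e.target).withDensity
      fun z => ENNReal.ofReal (2 ^ n * (g.coeff e z).det.re)) :=
    h1.mono_ac (withDensity_absolutelyContinuous _ _)
  rw [integral_map h2 hf.measurable.aestronglyMeasurable]
  have h3 := integral_withDensity_eq_integral_toReal_smul₀ (aemeasurable_density g he)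
    (by simp) (fun z => f (e.symm z))
  refine h3.trans ?_
  refine setIntegral_congr_fun e.open_target.measurableSet fun z hz => ?_
  simp only [smul_eq_mul]
  rw [ENNReal.toReal_ofReal (density_pos g he hz).le]

/-- The density is positive in every chart. Moser iteration yields an essential bound, and
positivity on open sets makes it a bound at every point. -/
instance (g : KahlerMetric n M) (P : ChartPartition n M ι) : (gluedVol g P).IsOpenPosMeasure := by
  refine ⟨fun U hU ⟨x, hx⟩ h0 => ?_⟩
  have he := chart_mem_atlas (Cn n) x
  set e := chartAt (Cn n) x
  have hO : MeasurableSet (U ∩ e.source) := (hU.inter e.open_source).measurableSet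
  have h1 : gluedVol g P (U ∩ e.source) = 0 := measure_mono_null Set.inter_subset_left h0
  rw [← lintegral_indicator_one hO, lintegral_gluedVol g P he (measurable_one.indicator hO)
    fun y hy => Set.indicator_of_notMem (fun h => hy h.2) _] at h1
  have hV : IsOpen (e.target ∩ e.symm ⁻¹' U) := e.isOpen_inter_preimage_symm hU
  have h2 : ∫⁻ z in e.target ∩ e.symm ⁻¹' U, ENNReal.ofReal (density g e z) = 0 := by
    refine le_antisymm (le_trans ?_ h1.le) zero_le
    rw [← lintegral_indicator hV.measurableSet, ← lintegral_indicator e.open_target.measurableSet]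
    refine lintegral_mono fun z => ?_
    by_cases hz : z ∈ e.target ∩ e.symm ⁻¹' U
    · rw [Set.indicator_of_mem hz, Set.indicator_of_mem hz.1,
        Set.indicator_of_mem (show e.symm z ∈ U ∩ e.source from ⟨hz.2, e.map_target hz.1⟩)]
      simp
    · rw [Set.indicator_of_notMem hz]
      exact zero_le
  have h3 : (volume : Measure (Cn n)) (e.target ∩ e.symm ⁻¹' U) = 0 := by
    have h4 := (lintegral_eq_zero_iff' ((aemeasurable_density g he).mono_measure
      (Measure.restrict_mono Set.inter_subset_left le_rfl))).1 h2
    rw [Filter.EventuallyEq, ae_restrict_iff' hV.measurableSet] at h4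
    refine measure_mono_null (fun z hz => ?_) h4
    simp only [Set.mem_compl_iff, Set.mem_ofPred_eq, not_forall]
    refine ⟨hz, ?_⟩
    simpa using density_pos g he hz.1
  refine (hV.measure_pos volume ⟨e x, e.map_source (mem_chart_source _ x), ?_⟩).ne' h3
  simpa [e, (chartAt (Cn n) x).left_inv (mem_chart_source (Cn n) x)] using hx

end GluedVolume

/-! ### Localization, finiteness, and the mean of the Laplacian. -/

section GluedVolume

variable {n : ℕ} {M : Type*} [TopologicalSpace M] [ChartedSpace (Cn n) M]
  {ι : Type*} [Fintype ι]

/-- Compactness of the supports pinches the density from both sides, so that integrals pass between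
dvol_g and Lebesgue measure in either direction. -/
theorem ChartPartition.exists_density_bound [CompactSpace M] (g : KahlerMetric n M)
    (P : ChartPartition n M ι) : ∃ Λ : ℝ, 0 ≤ Λ ∧ ∀ i, ∀ x ∈ tsupport (P.ρ i),
      density g (P.e i) (P.e i x) ≤ Λ ∧ 1 ≤ Λ * density g (P.e i) (P.e i x) := by
  obtain ⟨B, hB0, hB⟩ := P.exists_bound (density g) fun e he z hz => continuousAt_density g he hz
  obtain ⟨B', hB'0, hB'⟩ := P.exists_bound (fun e z => (density g e z)⁻¹) fun e he z hz =>
    (continuousAt_density g he hz).inv₀ (density_pos g he hz).ne'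
  refine ⟨max B B', le_max_of_le_left hB0, fun i x hx => ?_⟩
  have hpos := density_pos g (P.mem_atlas i) ((P.e i).map_source (P.tsupport_subset i hx))
  have h1 := (le_abs_self _).trans (hB i x hx)
  have h2 := (le_abs_self _).trans (hB' i x hx)
  refine ⟨h1.trans (le_max_left _ _), ?_⟩
  calc 1 = (density g (P.e i) (P.e i x))⁻¹ * density g (P.e i) (P.e i x) :=
        (inv_mul_cancel₀ hpos.ne').symm
    _ ≤ _ := mul_le_mul_of_nonneg_right (h2.trans (le_max_right _ _)) hpos.le

theorem ChartPartition.le_one (P : ChartPartition n M ι) (i : ι) (x : M) : P.ρ i x ≤ 1 := by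
  rw [← P.sum_eq_one x]
  exact Finset.single_le_sum (f := fun i => P.ρ i x) (fun i _ => P.nonneg i x) (Finset.mem_univ i)

theorem ChartPartition.isCompact_image [CompactSpace M] (P : ChartPartition n M ι) (i : ι) :
    IsCompact (P.e i '' tsupport (P.ρ i)) :=
  (isClosed_tsupport _).isCompact.image_of_continuousOn
    ((P.e i).continuousOn.mono (P.tsupport_subset i))

theorem ChartPartition.image_subset_target (P : ChartPartition n M ι) (i : ι) :
    P.e i '' tsupport (P.ρ i) ⊆ (P.e i).target := by
  rintro _ ⟨x, hx, rfl⟩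
  exact (P.e i).map_source (P.tsupport_subset i hx)

theorem ChartPartition.symm_mem_tsupport {P : ChartPartition n M ι} {i : ι} {z : Cn n}
    (hz : z ∈ (P.e i).target) : (P.e i).symm z ∈ tsupport (P.ρ i) ↔ z ∈ P.e i '' tsupport (P.ρ i) :=
  ⟨fun h => ⟨_, h, (P.e i).right_inv hz⟩, by
    rintro ⟨x, hx, rfl⟩
    rwa [(P.e i).left_inv (P.tsupport_subset i hx)]⟩

omit [Fintype ι] in
theorem contr_sum (A : Matrix (Fin n) (Fin n) ℂ) {S : Finset ι}
    (B : ι → Matrix (Fin n) (Fin n) ℂ) : contr A (∑ i ∈ S, B i) = ∑ i ∈ S, contr A (B i) := by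
  simp only [contr, Finset.mul_sum, Matrix.trace_sum, Complex.re_sum]

omit [Fintype ι] in
theorem complexHessian_sum {S : Finset ι} {f : ι → Cn n → ℂ} {z : Cn n}
    (hf : ∀ a ∈ S, ContDiffAt ℝ ∞ (f a) z) :
    complexHessian (fun w => ∑ a ∈ S, f a w) z = ∑ a ∈ S, complexHessian (f a) z := by
  ext i j
  rw [Matrix.sum_apply]
  simp only [complexHessian, Matrix.of_apply, dz_eq_wirt, dzbar_eq_wirt]
  exact wirt_wirt_sum hf

/-- Linearity of the Hessian and ∑ ρ i = 1 reduce integrals of the Laplacian to functions supported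
in one chart. -/
theorem contrM_hessT_eq_sum (P : ChartPartition n M ι)
    (A : OpenPartialHomeomorph M (Cn n) → Cn n → Matrix (Fin n) (Fin n) ℂ) {f : M → ℝ}
    (hf : SmoothFn (n := n) f) (x : M) :
    contrM A (hessT f) x = ∑ i, contrM A (hessT fun y => P.ρ i y * f y) x := by
  have hc := chart_mem_atlas (Cn n) x
  have hz := (chartAt (Cn n) x).map_source (mem_chart_source (Cn n) x)
  simp only [contrM]
  rw [← contr_sum]
  congr 1
  simp only [hessT]
  rw [← complexHessian_sum fun i _ => ((P.smooth i).mul hf).contDiffAt_inChart hc hz]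
  congr 1
  funext w
  simp only [inChart, ← Complex.ofReal_sum, ← Finset.sum_mul, P.sum_eq_one, one_mul]

theorem contrM_hessT_eq_zero
    (A : OpenPartialHomeomorph M (Cn n) → Cn n → Matrix (Fin n) (Fin n) ℂ) {f : M → ℝ} {x : M}
    (hx : x ∉ tsupport f) : contrM A (hessT f) x = 0 := by
  have hz := (chartAt (Cn n) x).map_source (mem_chart_source (Cn n) x)
  have h1 : inChart (chartAt (Cn n) x) f =ᶠ[nhds (chartAt (Cn n) x x)] fun _ => 0 := by
    have h2 : ∀ᶠ y in nhds x, f y = 0 := by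
      filter_upwards [(isClosed_tsupport f).isOpen_compl.mem_nhds hx] with y hy
      exact image_eq_zero_of_notMem_tsupport hy
    have h3 := ((chartAt (Cn n) x).symm.continuousAt hz).tendsto
    rw [OpenPartialHomeomorph.left_inv _ (mem_chart_source (Cn n) x)] at h3
    filter_upwards [h3.eventually h2] with w hw
    simp [inChart, hw]
  rw [contrM, hessT, complexHessian_congr h1]
  have h4 : complexHessian (fun _ : Cn n => (0 : ℂ)) (chartAt (Cn n) x x) = 0 := by
    ext i j
    have h5 : dzbar j (fun _ : Cn n => (0 : ℂ)) = fun _ => 0 := by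
      funext w; rw [dzbar_eq_wirt, wirt_const]
    rw [complexHessian, Matrix.of_apply, h5, dz_eq_wirt, wirt_const]
    rfl
  rw [h4, contr, Matrix.mul_zero, Matrix.trace_zero, Complex.zero_re]

variable [MeasurableSpace M] [BorelSpace M] [IsManifold 𝓘(ℂ, Cn n) ω M]

/-- In its own chart, each weighted piece has bounded density on a compact image. -/
instance [CompactSpace M] (g : KahlerMetric n M) (P : ChartPartition n M ι) :
    IsFiniteMeasure (gluedVol g P) := by
  obtain ⟨Λ, hΛ0, hΛ⟩ := P.exists_density_bound g
  have hm : ∀ i, Measurable fun x => ENNReal.ofReal (P.ρ i x) := fun i =>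
    (P.smooth i).continuous.measurable.ennreal_ofReal
  have h1 : gluedVol g P Set.univ = ∑ i, ∫⁻ x, ENNReal.ofReal (P.ρ i x) ∂(gluedVol g P) := by
    rw [← lintegral_finsetSum _ fun i _ => hm i]
    have h3 : ∀ x, ∑ i, ENNReal.ofReal (P.ρ i x) = 1 := fun x => by
      rw [← ENNReal.ofReal_sum_of_nonneg fun i _ => P.nonneg i x, P.sum_eq_one, ENNReal.ofReal_one]
    simp [h3]
  refine ⟨?_⟩
  rw [h1]
  refine ENNReal.sum_lt_top.2 fun i _ => ?_
  rw [lintegral_gluedVol g P (P.mem_atlas i) (hm i) fun x hx => by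
    rw [image_eq_zero_of_notMem_tsupport fun h => hx (P.tsupport_subset i h), ENNReal.ofReal_zero]]
  calc ∫⁻ z in (P.e i).target, ENNReal.ofReal (density g (P.e i) z) *
        ENNReal.ofReal (P.ρ i ((P.e i).symm z))
      ≤ ∫⁻ z in (P.e i).target, (P.e i '' tsupport (P.ρ i)).indicator
          (fun _ => ENNReal.ofReal Λ) z := by
        refine setLIntegral_mono' (P.e i).open_target.measurableSet fun z hz => ?_
        by_cases hzK : z ∈ P.e i '' tsupport (P.ρ i)
        · rw [Set.indicator_of_mem hzK]
          have h4 := (hΛ i _ (ChartPartition.symm_mem_tsupport hz |>.2 hzK)).1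
          rw [(P.e i).right_inv hz] at h4
          calc _ ≤ ENNReal.ofReal Λ * 1 := by
                gcongr
                exact ENNReal.ofReal_le_one.2 (P.le_one i _)
            _ = _ := mul_one _
        · rw [image_eq_zero_of_notMem_tsupport fun h =>
            hzK (ChartPartition.symm_mem_tsupport hz |>.1 h)]
          simp
    _ ≤ ∫⁻ z, (P.e i '' tsupport (P.ρ i)).indicator (fun _ => ENNReal.ofReal Λ) z :=
        lintegral_mono' Measure.restrict_le_self le_rfl
    _ = ENNReal.ofReal Λ * volume (P.e i '' tsupport (P.ρ i)) :=
        lintegral_indicator_const (P.isCompact_image i).measurableSet _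
    _ < ⊤ := ENNReal.mul_lt_top ENNReal.ofReal_lt_top (P.isCompact_image i).measure_lt_top

theorem integrable_gluedVol [CompactSpace M] (g : KahlerMetric n M) (P : ChartPartition n M ι)
    {f : M → ℝ} (hf : Continuous f) : Integrable f (gluedVol g P) :=
  hf.integrable_of_hasCompactSupport (HasCompactSupport.of_compactSpace f)

omit [MeasurableSpace M] [BorelSpace M] in
theorem IsSmoothSolution.smoothFn_laplacian {g : KahlerMetric n M} {F φ : M → ℝ}
    (h : IsSmoothSolution g F φ) {f : M → ℝ} (hf : SmoothFn (n := n) f) :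
    SmoothFn (n := n) (contrM (perturbed g φ) (hessT f)) :=
  smoothFn_contrM h.isTensor hf.isTensor_hessT h.smoothTensor hf.smoothTensor_hessT
    h.posDef_perturbed

-- The added third derivatives of φ are symmetric in the two holomorphic indices, so g_φ is again
-- Kähler.
omit [MeasurableSpace M] [BorelSpace M] in
theorem IsSmoothSolution.perturbed_closed {g : KahlerMetric n M} {F φ : M → ℝ}
    (h : IsSmoothSolution g F φ) {e : OpenPartialHomeomorph M (Cn n)} (he : e ∈ atlas (Cn n) M)
    {z : Cn n} (hz : z ∈ e.target) (i j k : Fin n) :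
    dz k (fun w => perturbed g φ e w i j) z = dz i (fun w => perturbed g φ e w k j) z := by
  have h1 : ∀ a b c, dz c (fun w => perturbed g φ e w a b) z =
      dz c (fun w => g.coeff e w a b) z + dz c (dz a (dzbar b (inChart e φ))) z := by
    intro a b c
    simp only [dz_eq_wirt]
    rw [show (fun w => perturbed g φ e w a b) = fun w => g.coeff e w a b +
      wirt (-Complex.I) a (dzbar b (inChart e φ)) w from by
        funext w; rw [← dz_eq_wirt]; rfl]
    exact wirt_add (g.smoothTensor e he z hz a b).diff
      (ContDiffAt.wirt (ContDiffAt.dzbar (h.smoothFn.contDiffAt_inChart he hz))).diff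
  rw [h1, h1, g.closed e he z hz i j k]
  congr 1
  simp only [dz_eq_wirt]
  exact wirt_comm (ContDiffAt.dzbar (h.smoothFn.contDiffAt_inChart he hz))

/-- The Laplacian of the metric `g_{i j̄} + φ_{i j̄}` has mean zero. -/
theorem IsSmoothSolution.integral_laplacian_eq_zero [CompactSpace M] {g : KahlerMetric n M}
    {F φ : M → ℝ} (h : IsSmoothSolution g F φ) (P : ChartPartition n M ι) {f : M → ℝ}
    (hf : SmoothFn (n := n) f) :
    ∫ x, contrM (perturbed g φ) (hessT f) x * Real.exp (F x) ∂(gluedVol g P) = 0 := by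
  have hFc : Continuous fun x => Real.exp (F x) :=
    Real.continuous_exp.comp h.smoothFn_right.continuous
  have hk : ∀ i, SmoothFn (n := n) fun y => P.ρ i y * f y := fun i => (P.smooth i).mul hf
  have hcont : ∀ i, Continuous fun x =>
      contrM (perturbed g φ) (hessT fun y => P.ρ i y * f y) x * Real.exp (F x) := fun i =>
    (h.smoothFn_laplacian (hk i)).continuous.mul hFc
  simp only [contrM_hessT_eq_sum P _ hf, Finset.sum_mul]
  rw [integral_finsetSum _ fun i _ => integrable_gluedVol g P (hcont i)]
  refine Finset.sum_eq_zero fun i _ => ?_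
  have he := P.mem_atlas i
  have hsupp : tsupport (fun y => P.ρ i y * f y) ⊆ tsupport (P.ρ i) := tsupport_mul_subset_left
  have hnot : ∀ x, x ∉ tsupport (P.ρ i) →
      contrM (perturbed g φ) (hessT fun y => P.ρ i y * f y) x = 0 := fun x hx =>
    contrM_hessT_eq_zero _ fun h => hx (hsupp h)
  rw [integral_gluedVol g P he (hcont i) fun x hx => by
    rw [hnot x fun h => hx (P.tsupport_subset i h), zero_mul]]
  set e := P.e i with hedef
  set k : Cn n → ℂ := inChart e fun y => P.ρ i y * f y with hkdef
  -- The equation turns e^F det g into det g_φ, and det g_φ times the inverse of g_φ is its cofactor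
  -- matrix: the integrand becomes the divergence form.
  have hpt : ∀ z ∈ e.target, density g e z *
      (contrM (perturbed g φ) (hessT fun y => P.ρ i y * f y) (e.symm z) *
        Real.exp (F (e.symm z))) =
      2 ^ n * (((perturbed g φ e z).adjugate * complexHessian k z).trace).re := by
    intro z hz
    obtain ⟨h1, h2⟩ := det_eq_ofReal_re (h.posDef_perturbed e he z hz)
    obtain ⟨_, h4⟩ := det_eq_ofReal_re (g.posDef e he z hz)
    have h5 : (perturbed g φ e z).det.re = Real.exp (F (e.symm z)) * (g.coeff e z).det.re := by
      rw [h.det_perturbed he hz, Complex.re_ofReal_mul]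
    have h6 : (perturbed g φ e z).adjugate = (perturbed g φ e z).det • (perturbed g φ e z)⁻¹ := by
      have hu : IsUnit (perturbed g φ e z).det :=
        (Matrix.isUnit_iff_isUnit_det _).1 (h.posDef_perturbed e he z hz).isUnit
      rw [Matrix.inv_def, smul_smul, Ring.mul_inverse_cancel _ hu, one_smul]
    rw [contrM_eq h.isTensor (hk i).isTensor_hessT he (e.map_target hz), e.right_inv hz, h6,
      Matrix.smul_mul, Matrix.trace_smul, smul_eq_mul, h2, Complex.re_ofReal_mul, h5, density,
      contr, hessT]
    ring
  rw [setIntegral_congr_fun e.open_target.measurableSet hpt, integral_const_mul,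
    ← integral_indicator e.open_target.measurableSet]
  obtain ⟨h1, h2⟩ := integral_adjugate_mul_hessian (f := k) e.open_target (P.isCompact_image i)
    (P.image_subset_target i) (A := perturbed g φ e) (fun z hz => h.smoothTensor e he z hz)
    (fun z hz => ((Matrix.isUnit_iff_isUnit_det _).1
      (h.posDef_perturbed e he z hz).isUnit).ne_zero)
    (fun z hz i j k => h.perturbed_closed he hz i j k)
    (fun z hz => (hk i).contDiffAt_inChart he hz)
    (fun z hz hzK => by
      have h3 : P.ρ i (e.symm z) = 0 := image_eq_zero_of_notMem_tsupport fun h =>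
        hzK (ChartPartition.symm_mem_tsupport hz |>.1 h)
      simp [hkdef, inChart, h3])
  have h3 : ∀ z, e.target.indicator
      (fun z => (((perturbed g φ e z).adjugate * complexHessian k z).trace).re) z =
      (e.target.indicator
        (fun z => ((perturbed g φ e z).adjugate * complexHessian k z).trace) z).re := by
    intro z
    by_cases hz : z ∈ e.target
    · rw [Set.indicator_of_mem hz, Set.indicator_of_mem hz]
    · rw [Set.indicator_of_notMem hz, Set.indicator_of_notMem hz, Complex.zero_re]
  simp only [h3]
  have h4 := integral_re h1
  simp only [RCLike.re_to_complex] at h4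
  rw [h4, h2]
  simp

end GluedVolume

/-! ### The Sobolev inequality for W^{1,1} on the manifold. -/

section Sobolev

variable {n : ℕ} {M : Type*} [TopologicalSpace M] [ChartedSpace (Cn n) M]
  {ι : Type*} [Fintype ι]

theorem norm_fderiv_ofReal_le (φ : Cn n → ℝ) (z : Cn n) :
    ‖fderiv ℝ (fun w => (φ w : ℂ)) z‖ ≤ 2 * ∑ a, ‖dz a (fun w => (φ w : ℂ)) z‖ := by
  refine ContinuousLinearMap.opNorm_le_bound _ (by positivity) fun v => ?_
  rw [fderiv_eq_sum_wirt, Finset.mul_sum, Finset.sum_mul]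
  refine (norm_sum_le _ _).trans (Finset.sum_le_sum fun a _ => ?_)
  rw [dzbar_ofReal]
  refine (norm_add_le _ _).trans ?_
  rw [norm_mul, norm_mul, norm_star, norm_star]
  have h : ‖v a‖ ≤ ‖v‖ := norm_le_pi_norm v a
  nlinarith [norm_nonneg (dz a (fun w => (φ w : ℂ)) z)]

/-- The trace inequality between two metrics, with the Euclidean one in first place: |∂φ|²_eucl ≤
tr_eucl(G) |∂φ|²_G. -/
theorem norm_dz_ofReal_le {G : Matrix (Fin n) (Fin n) ℂ} (hG : G.PosDef) {φ : Cn n → ℝ} {z : Cn n}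
    (hφ : DifferentiableAt ℝ φ z) (a : Fin n) : ‖dz a (fun w => (φ w : ℂ)) z‖ ≤
      √(contr 1 G) * √(contr G (gradMatrix (fun w => (φ w : ℂ)) z)) := by
  have h1 := contr_gradMatrix_le Matrix.PosDef.one hG hφ
  have h2 : Complex.normSq (dz a (fun w => (φ w : ℂ)) z) ≤
      contr 1 (gradMatrix (fun w => (φ w : ℂ)) z) := by
    rw [contr_one]
    simp only [gradMatrix_diag_re]
    exact Finset.single_le_sum (f := fun k => Complex.normSq (dz k (fun w => (φ w : ℂ)) z))
      (fun k _ => Complex.normSq_nonneg _) (Finset.mem_univ a)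
  rw [← Real.sqrt_mul' _ (contr_gradMatrix_nonneg hG φ z)]
  refine Real.le_sqrt_of_sq_le ?_
  rw [← Complex.normSq_eq_norm_sq]
  exact h2.trans h1

variable [IsManifold 𝓘(ℂ, Cn n) ω M]

theorem SmoothFn.smoothFn_contrM_gradT {A : OpenPartialHomeomorph M (Cn n) → Cn n →
    Matrix (Fin n) (Fin n) ℂ} (hA : IsTensor A) (hAs : SmoothTensor A)
    (hA0 : ∀ e ∈ atlas (Cn n) M, ∀ z ∈ e.target, (A e z).PosDef) {f : M → ℝ}
    (hf : SmoothFn (n := n) f) : SmoothFn (n := n) (contrM A (gradT f)) :=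
  smoothFn_contrM hA hf.isTensor_gradT hAs hf.smoothTensor_gradT hA0

theorem SmoothFn.continuous_gradNorm (g : KahlerMetric n M) {f : M → ℝ}
    (hf : SmoothFn (n := n) f) : Continuous (gradNorm g f) := by
  rw [funext (gradNorm_eq_sqrt g f)]
  exact (hf.smoothFn_contrM_gradT g.isTensor g.smoothTensor g.posDef).continuous.sqrt

theorem ChartPartition.exists_fderiv_bound [CompactSpace M] (g : KahlerMetric n M)
    (P : ChartPartition n M ι) : ∃ B : ℝ, 0 ≤ B ∧ ∀ f : M → ℝ, SmoothFn (n := n) f →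
      ∀ i, ∀ x ∈ tsupport (P.ρ i),
        ‖fderiv ℝ (inChart (P.e i) fun y => P.ρ i y * f y) (P.e i x)‖ ≤
          B * (gradNorm g f x + |f x|) := by
  -- The bound is taken over families indexed by charts, not by `i`, so the derivatives of all ρ j
  -- are bounded at once; only j = i is used.
  obtain ⟨B₁, hB₁0, hB₁⟩ := P.exists_bound
    (fun e z => fun (j : ι) (a : Fin n) => dz a (inChart e (P.ρ j)) z) fun e he z hz =>
      continuousAt_pi.2 fun j => continuousAt_pi.2 fun a =>
        (ContDiffAt.dz ((P.smooth j).contDiffAt_inChart he hz)).continuousAt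
  obtain ⟨B₂, hB₂0, hB₂⟩ := P.exists_bound (fun e z => contr 1 (g.coeff e z)) fun e he z hz => by
    simp only [contr_one]
    exact tendsto_finsetSum _ fun k _ => Complex.continuous_re.continuousAt.comp
      (g.smoothTensor e he z hz k k).continuousAt
  refine ⟨2 * (n * (B₁ + √B₂)), by positivity, fun f hf i x hx => ?_⟩
  have he := P.mem_atlas i
  have hxs := P.tsupport_subset i hx
  have hz := (P.e i).map_source hxs
  have hdf := (hf.contDiffAt he hz).diff
  have hdρ := ((P.smooth i).contDiffAt_inChart he hz).diff
  refine (norm_fderiv_ofReal_le (fun w => P.ρ i ((P.e i).symm w) * f ((P.e i).symm w)) _).trans ?_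
  rw [mul_assoc]
  refine mul_le_mul_of_nonneg_left ?_ zero_le_two
  have hgrad : √(contr (g.coeff (P.e i) (P.e i x)) (gradMatrix (inChart (P.e i) f) (P.e i x))) =
      gradNorm g f x := by
    rw [gradNorm_eq_sqrt, contrM_eq g.isTensor hf.isTensor_gradT he hxs]
    rfl
  have hg0 : 0 ≤ gradNorm g f x := Real.sqrt_nonneg _
  have hone : ∀ a, ‖dz a (fun w =>
      ((P.ρ i ((P.e i).symm w) * f ((P.e i).symm w) : ℝ) : ℂ)) (P.e i x)‖ ≤
      (B₁ + √B₂) * (gradNorm g f x + |f x|) := by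
    intro a
    have h1 := norm_dz_ofReal_le (g.posDef _ he _ hz) hdf a
    have h2 : ‖dz a (inChart (P.e i) (P.ρ i)) (P.e i x)‖ ≤ B₁ :=
      (norm_le_pi_norm (fun a => dz a (inChart (P.e i) (P.ρ i)) (P.e i x)) a).trans
        ((norm_le_pi_norm (fun j a => dz a (inChart (P.e i) (P.ρ j)) (P.e i x)) i).trans
          (hB₁ i x hx))
    have h3 : √(contr 1 (g.coeff (P.e i) (P.e i x))) ≤ √B₂ :=
      Real.sqrt_le_sqrt ((le_abs_self _).trans (hB₂ i x hx))
    have h4 : ‖dz a (inChart (P.e i) f) (P.e i x)‖ ≤ √B₂ * gradNorm g f x := by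
      rw [← hgrad]
      exact h1.trans (mul_le_mul_of_nonneg_right h3 (Real.sqrt_nonneg _))
    have h5 : dz a (fun w => ((P.ρ i ((P.e i).symm w) * f ((P.e i).symm w) : ℝ) : ℂ)) (P.e i x) =
        dz a (inChart (P.e i) (P.ρ i)) (P.e i x) * f x +
          P.ρ i x * dz a (inChart (P.e i) f) (P.e i x) := by
      simp only [Complex.ofReal_mul, dz_eq_wirt]
      have := wirt_mul (s := -Complex.I) (i := a) hdρ (hf.contDiffAt_inChart he hz).diff
      simp only [inChart, (P.e i).left_inv hxs] at this
      exact this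
    rw [h5]
    refine (norm_add_le _ _).trans ?_
    rw [norm_mul, norm_mul, Complex.norm_real, Complex.norm_real, Real.norm_eq_abs,
      Real.norm_eq_abs, abs_of_nonneg (P.nonneg i x)]
    have h6 : P.ρ i x * ‖dz a (inChart (P.e i) f) (P.e i x)‖ ≤ √B₂ * gradNorm g f x :=
      (mul_le_of_le_one_left (norm_nonneg _) (P.le_one i x)).trans h4
    have h7 : ‖dz a (inChart (P.e i) (P.ρ i)) (P.e i x)‖ * |f x| ≤ B₁ * |f x| :=
      mul_le_mul_of_nonneg_right h2 (abs_nonneg _)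
    nlinarith [mul_nonneg hB₁0 hg0, mul_nonneg (Real.sqrt_nonneg B₂) (abs_nonneg (f x))]
  calc _ ≤ ∑ _a : Fin n, (B₁ + √B₂) * (gradNorm g f x + |f x|) :=
        Finset.sum_le_sum fun a _ => hone a
    _ = _ := by simp; ring

variable [MeasurableSpace M] [BorelSpace M]

/-- The Gagliardo–Nirenberg–Sobolev inequality for ρ i f, extended by zero from its chart to ℂⁿ. The
upper density bound converts the left side to Lebesgue measure, the lower one converts the gradient
integral back to dvol_g. -/
theorem exists_local_sobolev [CompactSpace M] {χ : ℝ}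
    (hχ : Real.HolderConjugate (Module.finrank ℝ (Cn n)) χ) (g : KahlerMetric n M)
    (P : ChartPartition n M ι) : ∃ C : ENNReal, C ≠ ⊤ ∧ ∀ f : M → ℝ, SmoothFn (n := n) f → ∀ i,
      ∫⁻ x, ‖P.ρ i x * f x‖ₑ ^ χ ∂(gluedVol g P) ≤
        C * (∫⁻ x, ENNReal.ofReal (gradNorm g f x + |f x|) ∂(gluedVol g P)) ^ χ := by
  obtain ⟨Λ, hΛ0, hΛ⟩ := P.exists_density_bound g
  obtain ⟨B, hB0, hB⟩ := P.exists_fderiv_bound g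
  have hχ0 : 0 < χ := hχ.symm.pos
  refine ⟨ENNReal.ofReal Λ * (lintegralPowLePowLIntegralFDerivConst (volume : Measure (Cn n)) χ *
    (ENNReal.ofReal (B * Λ)) ^ χ), ?_, fun f hf i => ?_⟩
  · exact ENNReal.mul_ne_top ENNReal.ofReal_ne_top (ENNReal.mul_ne_top ENNReal.coe_ne_top
      (ENNReal.rpow_ne_top_of_nonneg hχ0.le ENNReal.ofReal_ne_top))
  have he := P.mem_atlas i
  set e := P.e i with hedef
  set k : Cn n → ℂ := inChart e fun y => P.ρ i y * f y with hk
  set K := e '' tsupport (P.ρ i) with hKdef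
  have hk0 : ∀ z ∈ e.target, z ∉ K → k z = 0 := fun z hz hzK => by
    have h3 : P.ρ i (e.symm z) = 0 := image_eq_zero_of_notMem_tsupport fun h =>
      hzK (ChartPartition.symm_mem_tsupport hz |>.1 h)
    simp [hk, inChart, h3]
  have hsm : SmoothFn (n := n) fun y => P.ρ i y * f y := (P.smooth i).mul hf
  obtain ⟨hu, hus⟩ := contDiff_indicator e.open_target (P.isCompact_image i)
    (P.image_subset_target i)
    (fun z hz => (hsm.contDiffAt_inChart he hz).contDiffWithinAt) hk0
  have hS := lintegral_pow_le_pow_lintegral_fderiv (volume : Measure (Cn n))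
    (hu.of_le (by simp)) hus hχ
  have hcont : Continuous fun x => gradNorm g f x + |f x| :=
    (hf.continuous_gradNorm g).add hf.continuous.abs
  have hKm : MeasurableSet K := (P.isCompact_image i).measurableSet
  have h1 : ∫⁻ x, ‖P.ρ i x * f x‖ₑ ^ χ ∂(gluedVol g P) ≤
      ENNReal.ofReal Λ * ∫⁻ z, ‖e.target.indicator k z‖ₑ ^ χ := by
    rw [lintegral_gluedVol g P he (hsm.continuous.measurable.enorm.pow_const χ) fun x hx => by
      rw [image_eq_zero_of_notMem_tsupport fun h => hx (P.tsupport_subset i h), zero_mul,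
        enorm_zero, ENNReal.zero_rpow_of_pos hχ0],
      ← lintegral_const_mul' _ _ ENNReal.ofReal_ne_top]
    refine (setLIntegral_mono' e.open_target.measurableSet fun z hz => ?_).trans
      (lintegral_mono' Measure.restrict_le_self le_rfl)
    rw [Set.indicator_of_mem hz]
    by_cases hzK : z ∈ K
    · have h4 := (hΛ i _ (ChartPartition.symm_mem_tsupport hz |>.2 hzK)).1
      rw [← hedef, e.right_inv hz] at h4
      have h5 : ‖k z‖ₑ = ‖P.ρ i (e.symm z) * f (e.symm z)‖ₑ := by
        rw [hk, inChart, ← ofReal_norm, Complex.norm_real, ofReal_norm]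
      rw [h5]
      gcongr
    · have h3 : P.ρ i (e.symm z) = 0 := image_eq_zero_of_notMem_tsupport fun h =>
        hzK (ChartPartition.symm_mem_tsupport hz |>.1 h)
      rw [h3, zero_mul, enorm_zero, ENNReal.zero_rpow_of_pos hχ0, mul_zero]
      exact zero_le
  have h2 : ∫⁻ z, ‖fderiv ℝ (e.target.indicator k) z‖ₑ ≤ ENNReal.ofReal (B * Λ) *
      ∫⁻ x, ENNReal.ofReal (gradNorm g f x + |f x|) ∂(gluedVol g P) := by
    have hm : Measurable ((tsupport (P.ρ i)).indicator fun x =>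
        ENNReal.ofReal (gradNorm g f x + |f x|)) :=
      hcont.measurable.ennreal_ofReal.indicator (isClosed_tsupport _).measurableSet
    calc ∫⁻ z, ‖fderiv ℝ (e.target.indicator k) z‖ₑ
        ≤ ∫⁻ z, e.target.indicator (fun z => ENNReal.ofReal (B * Λ) *
            (ENNReal.ofReal (density g e z) * (tsupport (P.ρ i)).indicator (fun x =>
              ENNReal.ofReal (gradNorm g f x + |f x|)) (e.symm z))) z := by
          refine lintegral_mono fun z => ?_
          by_cases hzK : z ∈ K
          · have hz := P.image_subset_target i hzK
            have hxs := ChartPartition.symm_mem_tsupport hz |>.2 hzK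
            have h4 := (hΛ i _ hxs).2
            have h5 := hB f hf i _ hxs
            rw [← hedef, e.right_inv hz] at h4 h5
            have h6 : fderiv ℝ (e.target.indicator k) z = fderiv ℝ k z :=
              Filter.EventuallyEq.fderiv_eq (by
                filter_upwards [e.open_target.mem_nhds hz] with w hw
                rw [Set.indicator_of_mem hw])
            have hg0 : 0 ≤ gradNorm g f (e.symm z) + |f (e.symm z)| :=
              add_nonneg (Real.sqrt_nonneg _) (abs_nonneg _)
            have hd0 := (density_pos g he hz).le
            rw [Set.indicator_of_mem hz, Set.indicator_of_mem hxs, h6,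
              ← ENNReal.ofReal_mul hd0, ← ENNReal.ofReal_mul (by positivity),
              ← ofReal_norm]
            refine ENNReal.ofReal_le_ofReal (h5.trans ?_)
            have h7 : 0 ≤ B * (gradNorm g f (e.symm z) + |f (e.symm z)|) := by positivity
            nlinarith
          · have h6 : fderiv ℝ (e.target.indicator k) z = 0 := by
              have h7 : e.target.indicator k =ᶠ[nhds z] fun _ => 0 := by
                filter_upwards [(P.isCompact_image i).isClosed.isOpen_compl.mem_nhds hzK] with w hw
                by_cases hwt : w ∈ e.target
                · rw [Set.indicator_of_mem hwt, hk0 w hwt hw]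
                · rw [Set.indicator_of_notMem hwt]
              rw [h7.fderiv_eq]
              simp
            have h8 : ‖fderiv ℝ (e.target.indicator k) z‖ₑ = 0 := by
              rw [← ofReal_norm, h6, norm_zero, ENNReal.ofReal_zero]
            rw [h8]
            exact zero_le
      _ = ENNReal.ofReal (B * Λ) * ∫⁻ x, (tsupport (P.ρ i)).indicator (fun x =>
              ENNReal.ofReal (gradNorm g f x + |f x|)) x ∂(gluedVol g P) := by
          rw [lintegral_indicator e.open_target.measurableSet,
            lintegral_const_mul' _ _ ENNReal.ofReal_ne_top,
            lintegral_gluedVol g P he hm fun x hx =>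
              Set.indicator_of_notMem (fun h => hx (P.tsupport_subset i h)) _]
      _ ≤ _ := by
          gcongr
          exact Set.indicator_le_self _ _ _
  calc _ ≤ ENNReal.ofReal Λ * ∫⁻ z, ‖e.target.indicator k z‖ₑ ^ χ := h1
    _ ≤ ENNReal.ofReal Λ * (lintegralPowLePowLIntegralFDerivConst (volume : Measure (Cn n)) χ *
        (ENNReal.ofReal (B * Λ) *
          ∫⁻ x, ENNReal.ofReal (gradNorm g f x + |f x|) ∂(gluedVol g P)) ^ χ) := by
        gcongr
        refine hS.trans ?_
        gcongr
    _ = _ := by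
        rw [ENNReal.mul_rpow_of_nonneg _ _ hχ0.le]
        ring

/-- The Sobolev inequality for the embedding of `W^{1,1}`. -/
theorem exists_sobolev [CompactSpace M] {χ : ℝ}
    (hχ : Real.HolderConjugate (Module.finrank ℝ (Cn n)) χ) (g : KahlerMetric n M)
    (P : ChartPartition n M ι) : ∃ C : ℝ, 0 ≤ C ∧ ∀ f : M → ℝ, SmoothFn (n := n) f →
      (∫ x, |f x| ^ χ ∂(gluedVol g P)) ^ (1 / χ) ≤
        C * ∫ x, (gradNorm g f x + |f x|) ∂(gluedVol g P) := by
  obtain ⟨C, hC, hS⟩ := exists_local_sobolev hχ g P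
  have hχ0 : 0 < χ := hχ.symm.pos
  have hχ1 : 1 ≤ χ := hχ.symm.lt.le
  refine ⟨(∑ _i : ι, C ^ (1 / χ)).toReal, ENNReal.toReal_nonneg, fun f hf => ?_⟩
  have hcont : Continuous fun x => gradNorm g f x + |f x| :=
    (hf.continuous_gradNorm g).add hf.continuous.abs
  have hg0 : ∀ x, 0 ≤ gradNorm g f x + |f x| := fun x =>
    add_nonneg (Real.sqrt_nonneg _) (abs_nonneg _)
  have hpow : Continuous fun x => |f x| ^ χ :=
    hf.continuous.abs.rpow_const fun _ => Or.inr hχ0.le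
  have hpow0 : ∀ x, 0 ≤ |f x| ^ χ := fun x => Real.rpow_nonneg (abs_nonneg _) _
  have h1 : ENNReal.ofReal (∫ x, (gradNorm g f x + |f x|) ∂(gluedVol g P)) =
      ∫⁻ x, ENNReal.ofReal (gradNorm g f x + |f x|) ∂(gluedVol g P) :=
    ofReal_integral_eq_lintegral_ofReal (integrable_gluedVol g P hcont) (ae_of_all _ hg0)
  have h2 : ENNReal.ofReal ((∫ x, |f x| ^ χ ∂(gluedVol g P)) ^ (1 / χ)) =
      eLpNorm' f χ (gluedVol g P) := by
    rw [← ENNReal.ofReal_rpow_of_nonneg (integral_nonneg hpow0) (by positivity),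
      ofReal_integral_eq_lintegral_ofReal (integrable_gluedVol g P hpow) (ae_of_all _ hpow0),
      eLpNorm']
    congr 1
    refine lintegral_congr fun x => ?_
    rw [← ENNReal.ofReal_rpow_of_nonneg (abs_nonneg _) hχ0.le, ← Real.norm_eq_abs, ofReal_norm]
  have h3 : f = ∑ i, fun x => P.ρ i x * f x := by
    funext x
    rw [Finset.sum_apply, ← Finset.sum_mul, P.sum_eq_one, one_mul]
  have h4 : ∀ i, eLpNorm' (fun x => P.ρ i x * f x) χ (gluedVol g P) ≤
      C ^ (1 / χ) * ENNReal.ofReal (∫ x, (gradNorm g f x + |f x|) ∂(gluedVol g P)) := by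
    intro i
    rw [eLpNorm', h1]
    refine (ENNReal.rpow_le_rpow (hS f hf i) (by positivity)).trans ?_
    rw [ENNReal.mul_rpow_of_nonneg _ _ (by positivity), ← ENNReal.rpow_mul,
      mul_one_div_cancel hχ0.ne', ENNReal.rpow_one]
  -- Minkowski's inequality over the partition; it needs χ ≥ 1.
  have h5 : eLpNorm' f χ (gluedVol g P) ≤ (∑ _i : ι, C ^ (1 / χ)) *
      ENNReal.ofReal (∫ x, (gradNorm g f x + |f x|) ∂(gluedVol g P)) := by
    rw [Finset.sum_mul]
    conv_lhs => rw [h3]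
    exact (eLpNorm'_sum_le (fun i _ => ((P.smooth i).mul hf).continuous.aestronglyMeasurable)
      hχ1).trans (Finset.sum_le_sum fun i _ => h4 i)
  have h6 : (∑ _i : ι, C ^ (1 / χ)) ≠ ⊤ := ENNReal.sum_ne_top.2 fun _ _ =>
    ENNReal.rpow_ne_top_of_nonneg (by positivity) hC
  rw [← ENNReal.ofReal_le_ofReal_iff (mul_nonneg ENNReal.toReal_nonneg (integral_nonneg hg0)), h2,
    ENNReal.ofReal_mul ENNReal.toReal_nonneg, ENNReal.ofReal_toReal h6]
  exact h5

end Sobolev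

/-! ### Chain rules and positivity for traces. -/

section Composition

variable {n : ℕ} {M : Type*} [TopologicalSpace M] [ChartedSpace (Cn n) M]
  {A B : OpenPartialHomeomorph M (Cn n) → Cn n → Matrix (Fin n) (Fin n) ℂ} {f : M → ℝ}
  {ψ ψ' : ℝ → ℝ} {d d' : ℝ} {x : M}

theorem contrM_gradT_comp (hf : SmoothFn (n := n) f) (hψ : HasDerivAt ψ d (f x)) :
    contrM A (gradT fun y => ψ (f y)) x = d ^ 2 * contrM A (gradT f) x := by
  have hz := (chartAt (Cn n) x).map_source (mem_chart_source (Cn n) x)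
  have hd := (hf.contDiffAt (chart_mem_atlas (Cn n) x) hz).diff
  have hψ' : HasDerivAt ψ d (f ((chartAt (Cn n) x).symm (chartAt (Cn n) x x))) := by
    rwa [OpenPartialHomeomorph.left_inv _ (mem_chart_source (Cn n) x)]
  have h : gradT (fun y => ψ (f y)) (chartAt (Cn n) x) (chartAt (Cn n) x x) =
      ((d ^ 2 : ℝ) : ℂ) • gradT f (chartAt (Cn n) x) (chartAt (Cn n) x x) := by
    ext i j
    simp only [gradT, gradMatrix, Matrix.of_apply, Matrix.smul_apply, smul_eq_mul, dz_eq_wirt,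
      dzbar_eq_wirt]
    unfold inChart
    rw [wirt_ofReal_comp hd hψ', wirt_ofReal_comp hd hψ']
    push_cast
    ring
  rw [contrM, contrM, h, contr, contr, Matrix.mul_smul, Matrix.trace_smul, smul_eq_mul,
    Complex.re_ofReal_mul]

theorem gradNorm_comp (g : KahlerMetric n M) (hf : SmoothFn (n := n) f)
    (hψ : HasDerivAt ψ d (f x)) :
    gradNorm g (fun y => ψ (f y)) x = |d| * gradNorm g f x := by
  rw [gradNorm_eq_sqrt, gradNorm_eq_sqrt, contrM_gradT_comp hf hψ, Real.sqrt_mul (sq_nonneg d),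
    Real.sqrt_sq_eq_abs]

theorem contrM_hessT_comp (hf : SmoothFn (n := n) f)
    (hψ : ∀ᶠ r in nhds (f x), HasDerivAt ψ (ψ' r) r) (hψ' : HasDerivAt ψ' d' (f x)) :
    contrM A (hessT fun y => ψ (f y)) x =
      d' * contrM A (gradT f) x + ψ' (f x) * contrM A (hessT f) x := by
  have hx := (chartAt (Cn n) x).left_inv (mem_chart_source (Cn n) x)
  have hz := (chartAt (Cn n) x).map_source (mem_chart_source (Cn n) x)
  have hd := hf.contDiffAt (chart_mem_atlas (Cn n) x) hz
  have h : hessT (fun y => ψ (f y)) (chartAt (Cn n) x) (chartAt (Cn n) x x) =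
      (d' : ℂ) • gradT f (chartAt (Cn n) x) (chartAt (Cn n) x x) +
        (ψ' (f x) : ℂ) • hessT f (chartAt (Cn n) x) (chartAt (Cn n) x x) := by
    ext i j
    rw [Matrix.add_apply, Matrix.smul_apply, Matrix.smul_apply]
    simp only [gradT, gradMatrix, hessT, complexHessian, Matrix.of_apply, smul_eq_mul, dz_eq_wirt,
      dzbar_eq_wirt]
    unfold inChart
    have h1 := wirt_wirt_ofReal_comp (s := -Complex.I) (t := Complex.I) (i := i) (j := j) hd
      (by rwa [hx]) (by rwa [hx])
    rw [hx] at h1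
    rw [mul_assoc] at h1
    exact h1
  rw [contrM, contrM, contrM, h, contr, contr, contr, Matrix.mul_add, Matrix.mul_smul,
    Matrix.mul_smul, Matrix.trace_add, Matrix.trace_smul, Matrix.trace_smul, smul_eq_mul,
    smul_eq_mul, Complex.add_re, Complex.re_ofReal_mul, Complex.re_ofReal_mul]

theorem contrM_hessT_add_const (hf : SmoothFn (n := n) f) (c : ℝ) :
    contrM A (hessT fun y => f y + c) x = contrM A (hessT f) x := by
  have h := contrM_hessT_comp (A := A) (x := x) (ψ := fun r => r + c) (ψ' := fun _ => 1) (d' := 0) hf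
    (Filter.Eventually.of_forall fun r => (hasDerivAt_id r).add_const c) (hasDerivAt_const _ _)
  rw [h]
  ring

theorem contrM_gradT_nonneg (hA : ∀ e ∈ atlas (Cn n) M, ∀ z ∈ e.target, (A e z).PosDef) (f : M → ℝ)
    (x : M) : 0 ≤ contrM A (gradT f) x :=
  contr_gradMatrix_nonneg (hA _ (chart_mem_atlas (Cn n) x) _
    ((chartAt (Cn n) x).map_source (mem_chart_source (Cn n) x))) _ _

theorem contrM_gradT_le (hA : ∀ e ∈ atlas (Cn n) M, ∀ z ∈ e.target, (A e z).PosDef)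
    (hB : ∀ e ∈ atlas (Cn n) M, ∀ z ∈ e.target, (B e z).PosDef) (hf : SmoothFn (n := n) f) (x : M) :
    contrM A (gradT f) x ≤ contrM A B x * contrM B (gradT f) x := by
  have hz := (chartAt (Cn n) x).map_source (mem_chart_source (Cn n) x)
  have hc := chart_mem_atlas (Cn n) x
  exact contr_gradMatrix_le (hA _ hc _ hz) (hB _ hc _ hz) (hf.contDiffAt hc hz).diff

end Composition

/-! ### Abstract Moser iteration. -/

section Moser

/-- Moser iteration: reverse Hölder inequalities with linearly growing constants imply a bound for
the supremum. -/
theorem exists_moser_bound {A χ r : ℝ} (hA : 0 < A) (hr : 0 < r) (hrχ : r < χ) (I : ℝ) :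
    ∃ B : ℝ, ∀ {α : Type*} [TopologicalSpace α] [CompactSpace α] [MeasurableSpace α] [BorelSpace α]
      (μ : Measure α) [IsFiniteMeasure μ] [μ.IsOpenPosMeasure] (w : α → ℝ), Continuous w →
      (∀ x, 0 ≤ w x) → ∫ x, w x ∂μ ≤ I →
      (∀ q, 1 / r ≤ q →
        (∫ x, w x ^ (q * χ) ∂μ) ^ (1 / χ) ≤ A * q * (∫ x, w x ^ (q * r) ∂μ) ^ (1 / r)) →
      ∀ x, w x ≤ B := by
  have hχ : 0 < χ := hr.trans hrχ
  -- One step raises the exponent from q r to q χ, that is, by the factor θ > 1.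
  set θ := χ / r with hθ
  have hθ1 : 1 < θ := (one_lt_div hr).2 hrχ
  have hθ0 : 0 < θ := zero_lt_one.trans hθ1
  -- An upper bound for (1/q) log(A q) at q = θ^k / r, with an absolute value so that all terms are
  -- nonnegative. Linear growth in k against θ^{-k} makes the product of the step constants
  -- converge.
  set a : ℕ → ℝ := fun k => r * ((|Real.log (A / r)| + k * Real.log θ) * θ⁻¹ ^ k) with ha
  have hlogθ : 0 ≤ Real.log θ := (Real.log_pos hθ1).le
  have ha0 : ∀ k, 0 ≤ a k := fun k => by positivity
  have hsum : Summable a := by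
    have h1 : ‖θ⁻¹‖ < 1 := by
      rw [Real.norm_of_nonneg (by positivity)]
      exact inv_lt_one_of_one_lt₀ hθ1
    have h2 := (summable_geometric_of_norm_lt_one h1).mul_left |Real.log (A / r)|
    have h3 := (summable_pow_mul_geometric_of_norm_lt_one 1 h1).mul_left (Real.log θ)
    refine ((h2.add h3).congr fun k => ?_).mul_left r
    simp only [pow_one]
    ring
  refine ⟨I * Real.exp (∑' k, a k), fun {α} _ _ _ _ μ _ _ w hw hw0 hI hq x₀ => ?_⟩
  set s : ℕ → ℝ := fun k => θ ^ k with hs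
  have hs0 : ∀ k, 0 < s k := fun k => pow_pos hθ0 k
  -- The norm in L^{θ^k}; k = 0 is the L¹ norm, which is bounded by `I`.
  set N : ℕ → ℝ := fun k => (∫ x, w x ^ s k ∂μ) ^ (1 / s k) with hN
  have hint0 : ∀ t : ℝ, 0 ≤ ∫ x, w x ^ t ∂μ := fun t =>
    integral_nonneg fun x => Real.rpow_nonneg (hw0 x) t
  have hN0 : ∀ k, 0 ≤ N k := fun k => Real.rpow_nonneg (hint0 _) _
  have hstep : ∀ k, N (k + 1) ≤ Real.exp (a k) * N k := by
    intro k
    set q := s k / r with hqdef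
    have hq0 : 0 < q := div_pos (hs0 k) hr
    have h1 : 1 / r ≤ q := by
      rw [hqdef]
      gcongr
      exact one_le_pow₀ hθ1.le
    have h2 : q * r = s k := div_mul_cancel₀ _ hr.ne'
    have h3 : q * χ = s (k + 1) := by
      rw [hqdef, hs]
      simp only [pow_succ, hθ]
      field_simp
    have h4 := hq q h1
    rw [h2, h3] at h4
    have h5 := Real.rpow_le_rpow (Real.rpow_nonneg (hint0 _) _) h4 (z := 1 / q) (by positivity)
    rw [← Real.rpow_mul (hint0 _), Real.mul_rpow (by positivity) (Real.rpow_nonneg (hint0 _) _),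
      ← Real.rpow_mul (hint0 _)] at h5
    have h6 : 1 / χ * (1 / q) = 1 / s (k + 1) := by rw [← h3]; field_simp
    have h7 : 1 / r * (1 / q) = 1 / s k := by rw [← h2]; field_simp
    rw [h6, h7] at h5
    refine h5.trans (mul_le_mul_of_nonneg_right ?_ (hN0 k))
    rw [Real.rpow_def_of_pos (by positivity)]
    refine Real.exp_le_exp.2 ?_
    have h8 : Real.log (A * q) = Real.log (A / r) + k * Real.log θ := by
      rw [← Real.log_pow, ← Real.log_mul (by positivity) (by positivity)]
      congr 1
      rw [hqdef, hs]
      ring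
    rw [h8]
    have h9 : 1 / q = r * θ⁻¹ ^ k := by
      rw [hqdef, hs, inv_pow]
      field_simp
    rw [h9, ha]
    have h10 : Real.log (A / r) + k * Real.log θ ≤ |Real.log (A / r)| + k * Real.log θ := by
      gcongr
      exact le_abs_self _
    calc _ ≤ (|Real.log (A / r)| + k * Real.log θ) * (r * θ⁻¹ ^ k) := by gcongr
      _ = _ := by ring
  have hI0 : 0 ≤ I := (integral_nonneg hw0).trans hI
  have hNk : ∀ k, N k ≤ I * Real.exp (∑ j ∈ Finset.range k, a j) := by
    intro k
    induction k with
    | zero => simpa [hN, hs] using hI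
    | succ k ih =>
      rw [Finset.sum_range_succ, Real.exp_add]
      calc N (k + 1) ≤ Real.exp (a k) * N k := hstep k
        _ ≤ Real.exp (a k) * (I * Real.exp (∑ j ∈ Finset.range k, a j)) := by gcongr
        _ = _ := by ring
  have hNB : ∀ k, N k ≤ I * Real.exp (∑' k, a k) := fun k =>
    (hNk k).trans (by gcongr; exact hsum.sum_le_tsum _ fun j _ => ha0 j)
  -- All L^{θ^k} norms are at most the claimed bound. If w exceeded some c above it on a nonempty
  -- open set, of measure m > 0, they would be at least c m^{1/θ^k}, which tends to c.
  by_contra! hlt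
  obtain ⟨c, hc1, hc2⟩ := exists_between hlt
  have hc0 : 0 < c := lt_of_le_of_lt (by positivity) hc1
  have hU : IsOpen {x | c < w x} := isOpen_lt continuous_const hw
  have hm : 0 < μ.real {x | c < w x} :=
    ENNReal.toReal_pos (hU.measure_pos μ ⟨x₀, hc2⟩).ne' (measure_ne_top _ _)
  have hlow : ∀ k, c * μ.real {x | c < w x} ^ (1 / s k) ≤ N k := by
    intro k
    have hci : Integrable (fun x => w x ^ s k) μ :=
      (hw.rpow_const fun _ => Or.inr (hs0 k).le).integrable_of_hasCompactSupport
        (HasCompactSupport.of_compactSpace _)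
    have h1 : c ^ s k * μ.real {x | c < w x} ≤ ∫ x, w x ^ s k ∂μ := by
      calc c ^ s k * μ.real {x | c < w x} = ∫ x in {x | c < w x}, c ^ s k ∂μ := by
            rw [setIntegral_const, smul_eq_mul, mul_comm]
        _ ≤ ∫ x in {x | c < w x}, w x ^ s k ∂μ :=
            setIntegral_mono_on (integrable_const _).integrableOn hci.integrableOn hU.measurableSet
              fun x hx => Real.rpow_le_rpow hc0.le (le_of_lt hx) (hs0 k).le
        _ ≤ _ := setIntegral_le_integral hci (ae_of_all _ fun x => Real.rpow_nonneg (hw0 x) _)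
    calc c * μ.real {x | c < w x} ^ (1 / s k) = (c ^ s k * μ.real {x | c < w x}) ^ (1 / s k) := by
          rw [Real.mul_rpow (by positivity) hm.le, ← Real.rpow_mul hc0.le,
            mul_one_div_cancel (hs0 k).ne', Real.rpow_one]
      _ ≤ N k := Real.rpow_le_rpow (by positivity) h1 (by have := hs0 k; positivity)
  have hlim : Filter.Tendsto (fun k => c * μ.real {x | c < w x} ^ (1 / s k)) Filter.atTop
      (nhds (c * μ.real {x | c < w x} ^ (0 : ℝ))) := by
    refine Filter.Tendsto.const_mul c (Filter.Tendsto.rpow tendsto_const_nhds ?_ (Or.inl hm.ne'))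
    simp only [one_div]
    exact (tendsto_pow_atTop_atTop_of_one_lt hθ1).inv_tendsto_atTop
  rw [Real.rpow_zero, mul_one] at hlim
  exact absurd (le_of_tendsto' hlim fun k => (hlow k).trans (hNB k)) (not_le.2 hc1)

end Moser

/-! ### Supremum bounds from gradient control, and the bound for F. -/

section SupBound

variable {n : ℕ} {M : Type*} [TopologicalSpace M] [ChartedSpace (Cn n) M]
  {ι : Type*} [Fintype ι] [MeasurableSpace M] [BorelSpace M] [IsManifold 𝓘(ℂ, Cn n) ω M]

theorem finrank_Cn (n : ℕ) : Module.finrank ℝ (Cn n) = 2 * n := by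
  rw [Module.finrank_pi_fintype]
  simp [Complex.finrank_real_complex, mul_comm]

omit [MeasurableSpace M] [BorelSpace M] [IsManifold 𝓘(ℂ, Cn n) ω M] in
theorem gradNorm_nonneg (g : KahlerMetric n M) (f : M → ℝ) (x : M) : 0 ≤ gradNorm g f x :=
  Real.sqrt_nonneg _

/-- The supremum bound for functions whose powers have gradients controlled by an `L^{p₀}` function
with `p₀ > 2 n`. -/
theorem exists_sup_bound [CompactSpace M] (hn : 0 < n) (g : KahlerMetric n M)
    (P : ChartPartition n M ι) {p₀ r : ℝ} (hp₀ : 2 * (n : ℝ) < p₀) (hr : p₀.HolderConjugate r)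
    {b : ℝ} (hb : 0 ≤ b) (R I : ℝ) :
    ∃ B : ℝ, ∀ w G : M → ℝ, SmoothFn (n := n) w → (∀ x, 1 ≤ w x) → Continuous G →
      (∀ x, 1 ≤ G x) → ∫ x, G x ^ p₀ ∂(gluedVol g P) ≤ R →
      (∀ q, 1 / r ≤ q → ∫ x, gradNorm g (fun y => w y ^ q) x ∂(gluedVol g P) ≤
        b * q * ∫ x, G x * w x ^ q ∂(gluedVol g P)) →
      ∫ x, w x ∂(gluedVol g P) ≤ I → ∀ x, w x ≤ B := by
  have hn1 : (1 : ℝ) ≤ n := by exact_mod_cast hn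
  -- The Sobolev exponent of W^{1,1} in real dimension 2n, conjugate to 2n.
  set χ : ℝ := 2 * n / (2 * n - 1) with hχdef
  have hχ : Real.HolderConjugate (Module.finrank ℝ (Cn n)) χ := by
    rw [finrank_Cn]
    push_cast
    rw [Real.holderConjugate_iff_eq_conjExponent (by linarith)]
  have hr0 : 0 < r := hr.symm.pos
  have hp0 : 0 < p₀ := hr.pos
  -- The only place where p₀ > 2n is essential: the Sobolev gain must beat the Hölder loss.
  have hrχ : r < χ := by
    have h1 := hr.inv_add_inv_eq_one
    have h2 := hχ.inv_add_inv_eq_one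
    rw [finrank_Cn] at h2
    push_cast at h2
    have h3 : p₀⁻¹ < (2 * (n : ℝ))⁻¹ := inv_strictAnti₀ (by linarith) hp₀
    have h4 : χ⁻¹ < r⁻¹ := by linarith
    exact (inv_lt_inv₀ hχ.symm.pos hr0).1 h4
  obtain ⟨C, hC0, hC⟩ := exists_sobolev hχ g P
  -- The summand 1 only ensures positivity.
  set A : ℝ := C * (b + r) * |R| ^ (1 / p₀) + 1 with hA
  obtain ⟨B, hB⟩ := exists_moser_bound (A := A) (by positivity) hr0 hrχ I
  refine ⟨B, fun w G hw hw1 hG hG1 hGR hgrad hI => hB (gluedVol g P) w hw.continuous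
    (fun x => zero_le_one.trans (hw1 x)) hI fun q hq => ?_⟩
  have hq0 : 0 < q := (one_div_pos.2 hr0).trans_le hq
  have hw0 : ∀ x, 0 < w x := fun x => zero_lt_one.trans_le (hw1 x)
  have hG0 : ∀ x, 0 ≤ G x := fun x => zero_le_one.trans (hG1 x)
  have hws : ∀ t : ℝ, SmoothFn (n := n) fun y => w y ^ t := fun t =>
    hw.comp fun x => Real.contDiffAt_rpow_const_of_ne (hw0 x).ne'
  have hwt0 : ∀ (t : ℝ) x, 0 ≤ w x ^ t := fun t x => Real.rpow_nonneg (hw0 x).le t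
  have hint : ∀ {f : M → ℝ}, Continuous f → Integrable f (gluedVol g P) := fun hf =>
    integrable_gluedVol g P hf
  have hSob := hC _ (hws q)
  have h1 : ∀ x, |w x ^ q| ^ χ = w x ^ (q * χ) := fun x => by
    rw [abs_of_nonneg (hwt0 q x), ← Real.rpow_mul (hw0 x).le]
  simp only [h1] at hSob
  have hGw : Continuous fun x => G x * w x ^ q := hG.mul (hws q).continuous
  -- The zeroth-order Sobolev term takes the shape of the gradient term because G ≥ 1 and r q ≥ 1.
  have h2 : ∫ x, |w x ^ q| ∂(gluedVol g P) ≤ r * q * ∫ x, G x * w x ^ q ∂(gluedVol g P) := by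
    have h3 : ∫ x, |w x ^ q| ∂(gluedVol g P) ≤ ∫ x, G x * w x ^ q ∂(gluedVol g P) := by
      refine integral_mono (hint (hws q).continuous.abs) (hint hGw) fun x => ?_
      simp only [abs_of_nonneg (hwt0 q x)]
      exact le_mul_of_one_le_left (hwt0 q x) (hG1 x)
    have h4 : 1 ≤ r * q := by
      rw [div_le_iff₀ hr0] at hq
      linarith
    exact h3.trans (le_mul_of_one_le_left
      (integral_nonneg fun x => mul_nonneg (hG0 x) (hwt0 q x)) h4)
  have hHol : ∫ x, G x * w x ^ q ∂(gluedVol g P) ≤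
      |R| ^ (1 / p₀) * (∫ x, w x ^ (q * r) ∂(gluedVol g P)) ^ (1 / r) := by
    have hmem : ∀ {f : M → ℝ} {t : ENNReal}, Continuous f → MemLp f t (gluedVol g P) :=
      fun hf => hf.memLp_of_hasCompactSupport (HasCompactSupport.of_compactSpace _)
    have h5 := integral_mul_le_Lp_mul_Lq_of_nonneg (μ := gluedVol g P) hr
      (ae_of_all _ hG0) (ae_of_all _ (hwt0 q)) (hmem hG) (hmem (hws q).continuous)
    have h6 : ∀ x, (w x ^ q) ^ r = w x ^ (q * r) := fun x => (Real.rpow_mul (hw0 x).le q r).symm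
    simp only [h6] at h5
    refine h5.trans (mul_le_mul_of_nonneg_right (Real.rpow_le_rpow
      (integral_nonneg fun x => Real.rpow_nonneg (hG0 x) _) (hGR.trans (le_abs_self R))
      (by positivity)) (Real.rpow_nonneg (integral_nonneg fun x => hwt0 _ x) _))
  have hJ0 : 0 ≤ (∫ x, w x ^ (q * r) ∂(gluedVol g P)) ^ (1 / r) :=
    Real.rpow_nonneg (integral_nonneg fun x => hwt0 _ x) _
  rw [integral_add (hint ((hws q).continuous_gradNorm g)) (hint (hws q).continuous.abs)] at hSob
  calc (∫ x, w x ^ (q * χ) ∂(gluedVol g P)) ^ (1 / χ)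
      ≤ C * ((b + r) * q * (|R| ^ (1 / p₀) *
          (∫ x, w x ^ (q * r) ∂(gluedVol g P)) ^ (1 / r))) := by
        refine hSob.trans (mul_le_mul_of_nonneg_left ?_ hC0)
        calc _ ≤ b * q * ∫ x, G x * w x ^ q ∂(gluedVol g P) +
              r * q * ∫ x, G x * w x ^ q ∂(gluedVol g P) := add_le_add (hgrad q hq) h2
          _ = (b + r) * q * ∫ x, G x * w x ^ q ∂(gluedVol g P) := by ring
          _ ≤ _ := mul_le_mul_of_nonneg_left hHol (by positivity)
    _ = C * (b + r) * |R| ^ (1 / p₀) * q *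
          (∫ x, w x ^ (q * r) ∂(gluedVol g P)) ^ (1 / r) := by ring
    _ ≤ A * q * (∫ x, w x ^ (q * r) ∂(gluedVol g P)) ^ (1 / r) := by
        refine mul_le_mul_of_nonneg_right (mul_le_mul_of_nonneg_right ?_ hq0.le) hJ0
        rw [hA]
        linarith

/-- Bounds for the powers of `F` and its gradient in terms of the Sobolev norm. -/
theorem integral_rpow_le_of_sobolevNorm_le [CompactSpace M] {g : KahlerMetric n M}
    (P : ChartPartition n M ι) {p₀ L : ℝ} (hp₀ : 0 < p₀) (hL : 0 ≤ L) {F : M → ℝ}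
    (hF : SmoothFn (n := n) F) (h : sobolevNorm g p₀ F ≤ ENNReal.ofReal L) :
    ∫ x, |F x| ^ p₀ ∂(gluedVol g P) ≤ L ^ p₀ ∧
      ∫ x, gradNorm g F x ^ p₀ ∂(gluedVol g P) ≤ L ^ p₀ := by
  have key : ∀ {f : M → ℝ}, Continuous f →
      eLpNorm f (ENNReal.ofReal p₀) (vol g) ≤ ENNReal.ofReal L →
      ∫ x, |f x| ^ p₀ ∂(gluedVol g P) ≤ L ^ p₀ := by
    intro f hf hfL
    have h1 := (eLpNorm_mono_measure f (gluedVol_le_vol g P)).trans hfL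
    rw [eLpNorm_eq_lintegral_rpow_enorm_toReal (by simpa using hp₀) ENNReal.ofReal_ne_top,
      ENNReal.toReal_ofReal hp₀.le] at h1
    have h2 := ENNReal.rpow_le_rpow h1 hp₀.le
    rw [← ENNReal.rpow_mul, one_div_mul_cancel hp₀.ne', ENNReal.rpow_one,
      ENNReal.ofReal_rpow_of_nonneg hL hp₀.le] at h2
    have h3 : Integrable (fun x => |f x| ^ p₀) (gluedVol g P) :=
      integrable_gluedVol g P (hf.abs.rpow_const fun _ => Or.inr hp₀.le)
    have h4 : ∀ x, 0 ≤ |f x| ^ p₀ := fun x => Real.rpow_nonneg (abs_nonneg _) _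
    rw [← ENNReal.ofReal_le_ofReal_iff (by positivity),
      ofReal_integral_eq_lintegral_ofReal h3 (ae_of_all _ h4)]
    refine le_trans (le_of_eq (lintegral_congr fun x => ?_)) h2
    rw [← ENNReal.ofReal_rpow_of_nonneg (abs_nonneg _) hp₀.le, ← Real.norm_eq_abs, ofReal_norm]
  refine ⟨key hF.continuous (le_self_add.trans h), ?_⟩
  have h5 := key (hF.continuous_gradNorm g) (le_add_self.trans h)
  simpa only [abs_of_nonneg (gradNorm_nonneg g F _)] using h5

/-- The constant function plus the gradient is bounded in `L^{p₀}`. -/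
theorem integral_one_add_gradNorm_rpow_le [CompactSpace M] {g : KahlerMetric n M}
    (P : ChartPartition n M ι) {p₀ L : ℝ} (hp₀ : 1 ≤ p₀) (hL : 0 ≤ L) {F : M → ℝ}
    (hF : SmoothFn (n := n) F) (h : sobolevNorm g p₀ F ≤ ENNReal.ofReal L) :
    ∫ x, (1 + gradNorm g F x) ^ p₀ ∂(gluedVol g P) ≤
      2 ^ (p₀ - 1) * ((gluedVol g P).real Set.univ + L ^ p₀) := by
  have hp : 0 < p₀ := zero_lt_one.trans_le hp₀
  have hc := hF.continuous_gradNorm g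
  have hc' : Continuous fun x => gradNorm g F x ^ p₀ := hc.rpow_const fun _ => Or.inr hp.le
  have h1 : ∀ x, (1 + gradNorm g F x) ^ p₀ ≤ 2 ^ (p₀ - 1) * (1 + gradNorm g F x ^ p₀) := fun x => by
    have h2 := NNReal.coe_le_coe.2 (NNReal.rpow_add_le_mul_rpow_add_rpow 1
      ⟨gradNorm g F x, gradNorm_nonneg g F x⟩ hp₀)
    push_cast at h2
    rwa [Real.one_rpow] at h2
  calc ∫ x, (1 + gradNorm g F x) ^ p₀ ∂(gluedVol g P)
      ≤ ∫ x, 2 ^ (p₀ - 1) * (1 + gradNorm g F x ^ p₀) ∂(gluedVol g P) :=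
        integral_mono (integrable_gluedVol g P
          ((continuous_const.add hc).rpow_const fun _ => Or.inr hp.le))
          (integrable_gluedVol g P (continuous_const.mul (continuous_const.add hc'))) h1
    _ = 2 ^ (p₀ - 1) * ((gluedVol g P).real Set.univ + ∫ x, gradNorm g F x ^ p₀ ∂(gluedVol g P)) := by
        rw [integral_const_mul, integral_add (integrable_const _) (integrable_gluedVol g P hc'),
          integral_const, smul_eq_mul, mul_one]
    _ ≤ _ := by
        gcongr
        exact (integral_rpow_le_of_sobolevNorm_le P hp hL hF h).2

/-- A bound for the supremum in terms of the Sobolev norm for `p₀ > 2 n`. -/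
theorem exists_abs_le_of_sobolevNorm_le [CompactSpace M] (hn : 0 < n) (g : KahlerMetric n M)
    (P : ChartPartition n M ι) {p₀ L : ℝ} (hp₀ : 2 * (n : ℝ) < p₀) (hL : 0 ≤ L) :
    ∃ N : ℝ, ∀ F : M → ℝ, SmoothFn (n := n) F → sobolevNorm g p₀ F ≤ ENNReal.ofReal L →
      ∀ x, |F x| ≤ N := by
  have hn1 : (1 : ℝ) ≤ n := by exact_mod_cast hn
  have hp1 : 1 < p₀ := by linarith
  have hr : p₀.HolderConjugate p₀.conjExponent := Real.HolderConjugate.conjExponent hp1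
  obtain ⟨B, hB⟩ := exists_sup_bound hn g P hp₀ hr zero_le_one
    (2 ^ (p₀ - 1) * ((gluedVol g P).real Set.univ + L ^ p₀))
    (2 * (gluedVol g P).real Set.univ + L ^ p₀)
  refine ⟨B, fun F hF hFL => ?_⟩
  -- A smooth substitute for |F| that is at least 1 and whose gradient is at most that of F; hence
  -- |∇ w^q| ≤ q |∇F| w^q.
  set w : M → ℝ := fun x => √(1 + F x ^ 2) with hw
  have hpos : ∀ t : ℝ, 0 < 1 + t ^ 2 := fun t => by positivity
  have hws : SmoothFn (n := n) w :=
    hF.comp (ψ := fun t => √(1 + t ^ 2)) fun x => ContDiffAt.sqrt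
      (contDiffAt_const.add (contDiffAt_id.pow 2)) (hpos _).ne'
  have hw1 : ∀ x, 1 ≤ w x := fun x => Real.one_le_sqrt.2 (by nlinarith [sq_nonneg (F x)])
  have hFw : ∀ x, |F x| ≤ w x := fun x => Real.abs_le_sqrt (by linarith)
  have hw0 : ∀ x, 0 < w x := fun x => zero_lt_one.trans_le (hw1 x)
  have hc := hF.continuous_gradNorm g
  have hwd : ∀ x, gradNorm g w x ≤ gradNorm g F x := by
    intro x
    have hd : HasDerivAt (fun t : ℝ => √(1 + t ^ 2)) (2 * F x / (2 * w x)) (F x) := by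
      have h1 : HasDerivAt (fun t : ℝ => 1 + t ^ 2) (2 * F x) (F x) := by
        simpa using (hasDerivAt_pow 2 (F x)).const_add 1
      exact h1.sqrt (hpos _).ne'
    rw [hw, gradNorm_comp g hF hd]
    refine mul_le_of_le_one_left (gradNorm_nonneg g F x) ?_
    rw [mul_div_mul_left _ _ two_ne_zero, abs_div, abs_of_pos (hw0 x)]
    exact (div_le_one (hw0 x)).2 (hFw x)
  refine fun x => (hFw x).trans (hB w (fun x => 1 + gradNorm g F x) hws hw1 (continuous_const.add hc)
    (fun x => le_add_of_nonneg_right (gradNorm_nonneg g F x))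
    (integral_one_add_gradNorm_rpow_le P hp1.le hL hF hFL) (fun q hq => ?_) ?_ x)
  · have hq0 : 0 < q := (one_div_pos.2 hr.symm.pos).trans_le hq
    have hwq : SmoothFn (n := n) fun y => w y ^ q :=
      hws.comp fun x => Real.contDiffAt_rpow_const_of_ne (hw0 x).ne'
    rw [one_mul, ← integral_const_mul]
    refine integral_mono (integrable_gluedVol g P (hwq.continuous_gradNorm g))
      (integrable_gluedVol g P (continuous_const.mul ((continuous_const.add hc).mul
        hwq.continuous))) fun x => ?_
    simp only
    rw [gradNorm_comp g hws (Real.hasDerivAt_rpow_const (Or.inl (hw0 x).ne')),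
      abs_of_nonneg (by have := (hw0 x).le; positivity), mul_assoc]
    refine mul_le_mul_of_nonneg_left ?_ hq0.le
    have h1 : w x ^ (q - 1) ≤ w x ^ q := Real.rpow_le_rpow_of_exponent_le (hw1 x) (by linarith)
    rw [mul_comm]
    exact mul_le_mul ((hwd x).trans (by linarith)) h1 (Real.rpow_nonneg (hw0 x).le _)
      (by linarith [gradNorm_nonneg g F x])
  · have h1 : ∀ x, w x ≤ 2 + |F x| ^ p₀ := by
      intro x
      have h2 : w x ≤ 1 + |F x| := by
        rw [hw]
        refine Real.sqrt_le_iff.2 ⟨by positivity, ?_⟩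
        nlinarith [sq_abs (F x), abs_nonneg (F x)]
      have h3 : |F x| ≤ 1 + |F x| ^ p₀ := by
        rcases le_total |F x| 1 with h | h
        · have := Real.rpow_nonneg (abs_nonneg (F x)) p₀
          linarith
        · have := Real.self_le_rpow_of_one_le h hp1.le
          linarith
      linarith
    have hcp : Continuous fun x => |F x| ^ p₀ :=
      hF.continuous.abs.rpow_const fun _ => Or.inr (by linarith)
    calc ∫ x, w x ∂(gluedVol g P) ≤ ∫ x, (2 + |F x| ^ p₀) ∂(gluedVol g P) :=
          integral_mono (integrable_gluedVol g P hws.continuous)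
            (integrable_gluedVol g P (continuous_const.add hcp)) h1
      _ = 2 * (gluedVol g P).real Set.univ + ∫ x, |F x| ^ p₀ ∂(gluedVol g P) := by
          rw [integral_add (integrable_const _) (integrable_gluedVol g P hcp), integral_const,
            smul_eq_mul, mul_comm]
      _ ≤ _ := by
          gcongr
          exact (integral_rpow_le_of_sobolevNorm_le P (by linarith) hL hF hFL).1

end SupBound

/-! ### Global inequalities for the weighted gradient and its powers. -/

section GradientEstimate

variable {n : ℕ} {M : Type*} [TopologicalSpace M] [ChartedSpace (Cn n) M]
  [IsManifold 𝓘(ℂ, Cn n) ω M]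

omit [IsManifold 𝓘(ℂ, Cn n) ω M] in
theorem IsSmoothSolution.contrM_perturbed_nonneg {g : KahlerMetric n M} {F φ : M → ℝ}
    (h : IsSmoothSolution g F φ) (hn : 0 < n) (x : M) :
    0 ≤ contrM g.coeff (perturbed g φ) x := by
  have hc := chart_mem_atlas (Cn n) x
  have hz := (chartAt (Cn n) x).map_source (mem_chart_source (Cn n) x)
  exact (contr_pos hn (g.posDef _ hc _ hz) (h.posDef_perturbed _ hc _ hz)).le

/-- The differential inequality for the weighted gradient, with explicit two sided bounds for the
weight. -/
theorem exists_weightedGrad_bounds [T2Space M] [CompactSpace M] (hn : 0 < n)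
    (g : KahlerMetric n M) (K N : ℝ) :
    ∃ D c c₁ : ℝ, 0 < c ∧ 0 < c₁ ∧ ∀ F φ : M → ℝ, IsSmoothSolution g F φ → (∀ x, |φ x| ≤ K) →
      (∀ x, F x ≤ N) → ∀ x,
      c * contrM g.coeff (gradT φ) x ≤ weightedGrad g D φ x ∧
      weightedGrad g D φ x ≤ c₁ * contrM g.coeff (gradT φ) x ∧
      c * (contrM g.coeff (perturbed g φ) x + contrM g.coeff (gradT φ) x) -
        c₁ * (1 + √(contrM g.coeff (gradT φ) x) * gradNorm g F x) ≤
      contrM (perturbed g φ) (hessT (weightedGrad g D φ)) x := by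
  obtain ⟨D, C, hC0, hC⟩ := exists_laplacian_weightedGrad_ge (M := M) hn g K N
  -- A bound for the absolute value of the exponent when |φ| ≤ K; the weight lies between e^{-a} and
  -- e^a.
  set a : ℝ := K ^ 2 / 2 + |D| * |K| with ha
  refine ⟨D, Real.exp (-a), Real.exp a * (C + 2), Real.exp_pos _, by positivity,
    fun F φ h hφ hF x => ?_⟩
  have hu0 : 0 ≤ contrM g.coeff (gradT φ) x := contrM_gradT_nonneg g.posDef φ x
  have hm0 : 0 ≤ contrM g.coeff (perturbed g φ) x :=
    h.contrM_perturbed_nonneg hn x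
  have hw : |weight D (φ x)| ≤ a := by
    have h1 : |φ x| ≤ |K| := (hφ x).trans (le_abs_self K)
    have h2 : φ x ^ 2 ≤ K ^ 2 := sq_le_sq.2 h1
    rw [weight, ha]
    refine (abs_sub _ _).trans ?_
    rw [abs_mul, abs_of_nonneg (by positivity : (0 : ℝ) ≤ φ x ^ 2 / 2)]
    gcongr
  have h3 : Real.exp (-a) ≤ Real.exp (weight D (φ x)) := Real.exp_le_exp.2 (abs_le.1 hw).1
  have h4 : Real.exp (weight D (φ x)) ≤ Real.exp a := Real.exp_le_exp.2 (abs_le.1 hw).2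
  refine ⟨mul_le_mul_of_nonneg_right h3 hu0, mul_le_mul_of_nonneg_right (h4.trans
    (le_mul_of_one_le_right (Real.exp_pos a).le (by linarith))) hu0, ?_⟩
  refine le_trans ?_ (hC F φ h hφ hF x)
  rw [← gradNorm_eq_sqrt g F x]
  set u := contrM g.coeff (gradT φ) x
  set m := contrM g.coeff (perturbed g φ) x
  set T := √u * gradNorm g F x with hT
  have hT0 : 0 ≤ T := mul_nonneg (Real.sqrt_nonneg _) (gradNorm_nonneg g F x)
  have h5 : Real.exp (-a) * (m + u) ≤ Real.exp (weight D (φ x)) * (m + u) := by gcongr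
  have h6 : Real.exp (weight D (φ x)) * (C + 2 * T) ≤ Real.exp a * (C + 2 * T) := by gcongr
  have h7 : Real.exp a * (C + 2 * T) ≤ Real.exp a * ((C + 2) * (1 + T)) := by
    gcongr
    nlinarith
  linarith

variable {ι : Type*} [Fintype ι] [MeasurableSpace M] [BorelSpace M] [CompactSpace M]
  {g : KahlerMetric n M} {F φ w : M → ℝ}

/-- The energy identity for the powers of a positive function. -/
theorem IsSmoothSolution.integral_energy_eq_zero (h : IsSmoothSolution g F φ)
    (P : ChartPartition n M ι) (hw : SmoothFn (n := n) w) (hw0 : ∀ x, 0 < w x) {p : ℝ}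
    (hp : 0 < p) :
    ∫ x, (p * (w x ^ (p - 1) * contrM (perturbed g φ) (gradT w) x) +
      w x ^ p * contrM (perturbed g φ) (hessT w) x) * Real.exp (F x) ∂(gluedVol g P) = 0 := by
  -- Testing with w^p amounts to the vanishing mean of Δ_φ w^{p+1}, whose two terms share the
  -- nonzero factor p + 1.
  have hws : SmoothFn (n := n) fun y => w y ^ (p + 1) :=
    hw.comp fun x => Real.contDiffAt_rpow_const_of_ne (hw0 x).ne'
  have h1 := h.integral_laplacian_eq_zero P hws
  have h2 : ∀ x, contrM (perturbed g φ) (hessT fun y => w y ^ (p + 1)) x =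
      (p + 1) * (p * (w x ^ (p - 1) * contrM (perturbed g φ) (gradT w) x) +
        w x ^ p * contrM (perturbed g φ) (hessT w) x) := by
    intro x
    rw [contrM_hessT_comp (ψ := fun r => r ^ (p + 1)) (ψ' := fun r => (p + 1) * r ^ p)
      (d' := (p + 1) * (p * w x ^ (p - 1))) hw ?_ ?_]
    · ring
    · filter_upwards [lt_mem_nhds (hw0 x)] with r hr
      have := Real.hasDerivAt_rpow_const (p := p + 1) (Or.inl hr.ne')
      rwa [add_sub_cancel_right] at this
    · exact (Real.hasDerivAt_rpow_const (Or.inl (hw0 x).ne')).const_mul _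
  simp only [h2, mul_assoc (p + 1)] at h1
  rw [integral_const_mul] at h1
  exact (mul_eq_zero.1 h1).resolve_left (by linarith)

omit [IsManifold 𝓘(ℂ, Cn n) ω M] [MeasurableSpace M] [BorelSpace M] [CompactSpace M] in
/-- The gradients of the powers of a function are controlled by its energy density. -/
theorem IsSmoothSolution.gradNorm_rpow_le (h : IsSmoothSolution g F φ) (hw : SmoothFn (n := n) w)
    (hw0 : ∀ x, 0 < w x) {p : ℝ} (hp : 0 < p) (hn : 0 < n) (x : M) :
    gradNorm g (fun y => w y ^ (p + 1 / 2)) x ≤ (p + 1 / 2) / 2 *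
      (w x ^ (p - 1) * contrM (perturbed g φ) (gradT w) x +
        w x ^ p * contrM g.coeff (perturbed g φ) x) := by
  have hQ0 : 0 ≤ contrM (perturbed g φ) (gradT w) x := contrM_gradT_nonneg h.posDef_perturbed w x
  have hm0 : 0 ≤ contrM g.coeff (perturbed g φ) x :=
    h.contrM_perturbed_nonneg hn x
  have hle := contrM_gradT_le g.posDef h.posDef_perturbed hw x
  set Q := contrM (perturbed g φ) (gradT w) x
  set m := contrM g.coeff (perturbed g φ) x
  have hpow : ∀ t : ℝ, 0 < w x ^ t := fun t => Real.rpow_pos_of_pos (hw0 x) t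
  rw [gradNorm_comp g hw (Real.hasDerivAt_rpow_const (Or.inl (hw0 x).ne')), gradNorm_eq_sqrt,
    abs_of_pos (by have := hpow (p + 1 / 2 - 1); positivity), mul_assoc, div_mul_eq_mul_div,
    mul_div_assoc]
  refine mul_le_mul_of_nonneg_left ?_ (by positivity)
  -- The exponent p + 1/2 is chosen so that 2 (p - 1/2) = (p - 1) + p. With |∂w|²_g ≤ tr_g g_φ ·
  -- |∂w|²_{g_φ}, the squared gradient splits into the two energy terms and the arithmetic-geometric
  -- inequality applies.
  have h1 : w x ^ (p + 1 / 2 - 1) * w x ^ (p + 1 / 2 - 1) = w x ^ (p - 1) * w x ^ p := by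
    rw [← Real.rpow_add (hw0 x), ← Real.rpow_add (hw0 x)]
    congr 1
    ring
  have h2 : w x ^ (p + 1 / 2 - 1) * √(contrM g.coeff (gradT w) x) ≤
      √((w x ^ (p - 1) * Q) * (w x ^ p * m)) := by
    refine Real.le_sqrt_of_sq_le ?_
    rw [mul_pow, Real.sq_sqrt (contrM_gradT_nonneg g.posDef w x), sq, h1]
    calc _ ≤ w x ^ (p - 1) * w x ^ p * (m * Q) :=
          mul_le_mul_of_nonneg_left hle (mul_pos (hpow _) (hpow _)).le
      _ = _ := by ring
  refine h2.trans ?_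
  have hX := mul_nonneg (hpow (p - 1)).le hQ0
  have hY := mul_nonneg (hpow p).le hm0
  rw [Real.sqrt_le_left (by positivity)]
  nlinarith [sq_nonneg (w x ^ (p - 1) * Q - w x ^ p * m)]

end GradientEstimate

/-! ### The L¹ bound, the reverse Hölder input, and the gradient estimate. -/

section MainEstimate

variable {n : ℕ} {M : Type*} [TopologicalSpace M] [ChartedSpace (Cn n) M]
  [IsManifold 𝓘(ℂ, Cn n) ω M] {ι : Type*} [Fintype ι] [MeasurableSpace M] [BorelSpace M]
  [CompactSpace M] {g : KahlerMetric n M} {F φ v : M → ℝ} {c c₁ N : ℝ}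

/-- The bound for the mean of a function that satisfies the differential inequality of the weighted
gradient. -/
theorem IsSmoothSolution.integral_add_one_le (h : IsSmoothSolution g F φ) (hn : 0 < n)
    (P : ChartPartition n M ι) (hv : SmoothFn (n := n) v) {p₀ R : ℝ} (hp₀ : 2 ≤ p₀) (hc : 0 < c)
    (hc₁ : 0 < c₁) (hFN : ∀ x, |F x| ≤ N)
    (hR : ∫ x, (1 + gradNorm g F x) ^ p₀ ∂(gluedVol g P) ≤ R)
    (hup : ∀ x, v x ≤ c₁ * contrM g.coeff (gradT φ) x)
    (hlap : ∀ x, c * (contrM g.coeff (perturbed g φ) x + contrM g.coeff (gradT φ) x) -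
        c₁ * (1 + √(contrM g.coeff (gradT φ) x) * gradNorm g F x) ≤
      contrM (perturbed g φ) (hessT v) x) :
    ∫ x, (v x + 1) ∂(gluedVol g P) ≤
      c₁ * (2 / c * Real.exp N) * ((c₁ + c₁ ^ 2 / (2 * c)) * Real.exp N * R) +
        (gluedVol g P).real Set.univ := by
  have hF := h.smoothFn_right
  have hFc : Continuous fun x => Real.exp (F x) := Real.continuous_exp.comp hF.continuous
  have hlapc : Continuous fun x => contrM (perturbed g φ) (hessT v) x * Real.exp (F x) :=
    (h.smoothFn_laplacian hv).continuous.mul hFc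
  have hGc : Continuous fun x => (1 + gradNorm g F x) ^ p₀ :=
    (continuous_const.add (hF.continuous_gradNorm g)).rpow_const fun _ => Or.inr (by linarith)
  have hint : ∀ {f : M → ℝ}, Continuous f → Integrable f (gluedVol g P) := fun hf =>
    integrable_gluedVol g P hf
  set κ : ℝ := c₁ + c₁ ^ 2 / (2 * c) with hκ
  have hκ0 : 0 < κ := by positivity
  have hpt : ∀ x, v x + 1 ≤ c₁ * (2 / c * Real.exp N) *
      (contrM (perturbed g φ) (hessT v) x * Real.exp (F x) +
        κ * Real.exp N * (1 + gradNorm g F x) ^ p₀) + 1 := by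
    intro x
    have hu0 : 0 ≤ contrM g.coeff (gradT φ) x := contrM_gradT_nonneg g.posDef φ x
    have hm0 := h.contrM_perturbed_nonneg hn x
    have hl := hlap x
    have hu := hup x
    set u := contrM g.coeff (gradT φ) x
    set m := contrM g.coeff (perturbed g φ) x
    set T := gradNorm g F x with hT
    set Δ := contrM (perturbed g φ) (hessT v) x
    have hT0 : 0 ≤ T := gradNorm_nonneg g F x
    have hG2 : (1 + T) ^ 2 ≤ (1 + T) ^ p₀ := by
      rw [← Real.rpow_natCast]
      exact Real.rpow_le_rpow_of_exponent_le (by linarith) (by exact_mod_cast hp₀)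
    -- Half of c u absorbs the gradient term. What remains is quadratic in |∇F|, hence integrable
    -- because p₀ ≥ 2.
    have h1 : c₁ * (√u * T) ≤ c / 2 * u + c₁ ^ 2 / (2 * c) * T ^ 2 := by
      have h2 : 0 ≤ (c * √u - c₁ * T) ^ 2 / (2 * c) := by positivity
      have h3 : (c * √u - c₁ * T) ^ 2 / (2 * c) =
          c / 2 * √u ^ 2 + c₁ ^ 2 / (2 * c) * T ^ 2 - c₁ * (√u * T) := by
        field_simp
        ring
      rw [h3, Real.sq_sqrt hu0] at h2
      linarith
    have h4 : c / 2 * u ≤ Δ + κ * (1 + T) ^ p₀ := by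
      have h5 : 1 ≤ (1 + T) ^ 2 := by nlinarith
      have h6 : T ^ 2 ≤ (1 + T) ^ 2 := by nlinarith
      have h7 : c₁ * 1 ≤ c₁ * (1 + T) ^ p₀ := by
        gcongr
        linarith
      have h8 : c₁ ^ 2 / (2 * c) * T ^ 2 ≤ c₁ ^ 2 / (2 * c) * (1 + T) ^ p₀ := by
        gcongr
        linarith
      have h9 := mul_nonneg hc.le hm0
      rw [hκ]
      linarith
    have hE1 : Real.exp (F x) ≤ Real.exp N := Real.exp_le_exp.2 (abs_le.1 (hFN x)).2
    -- The factor e^F must be inserted for Δ_φ v to integrate to zero. It multiplies a nonnegative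
    -- quantity before the differential inequality is used, so the sign of Δ_φ v plays no role.
    have hE2 : 1 ≤ Real.exp N * Real.exp (F x) := by
      rw [← Real.exp_add]
      exact Real.one_le_exp (by linarith [(abs_le.1 (hFN x)).1])
    have hG0 : 0 ≤ (1 + T) ^ p₀ := Real.rpow_nonneg (by linarith) _
    have h10 : u ≤ 2 / c * Real.exp N * (Δ * Real.exp (F x) + κ * Real.exp N * (1 + T) ^ p₀) := by
      calc u = 2 / c * (c / 2 * u) := by field_simp
        _ ≤ 2 / c * (Real.exp N * Real.exp (F x) * (c / 2 * u)) := by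
            exact mul_le_mul_of_nonneg_left (le_mul_of_one_le_left (by positivity) hE2)
              (by positivity)
        _ ≤ 2 / c * (Real.exp N * Real.exp (F x) * (Δ + κ * (1 + T) ^ p₀)) := by gcongr
        _ = 2 / c * Real.exp N * (Δ * Real.exp (F x) + κ * Real.exp (F x) * (1 + T) ^ p₀) := by ring
        _ ≤ _ := by gcongr
    have h11 := hu.trans (mul_le_mul_of_nonneg_left h10 hc₁.le)
    linarith
  calc ∫ x, (v x + 1) ∂(gluedVol g P)
      ≤ ∫ x, (c₁ * (2 / c * Real.exp N) * (contrM (perturbed g φ) (hessT v) x * Real.exp (F x) +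
        κ * Real.exp N * (1 + gradNorm g F x) ^ p₀) + 1) ∂(gluedVol g P) :=
        integral_mono (hint (hv.continuous.add continuous_const))
          (hint ((continuous_const.mul (hlapc.add (continuous_const.mul hGc))).add
            continuous_const)) hpt
    _ = c₁ * (2 / c * Real.exp N) * (κ * Real.exp N *
          ∫ x, (1 + gradNorm g F x) ^ p₀ ∂(gluedVol g P)) + (gluedVol g P).real Set.univ := by
        have h1 : Integrable (fun x => κ * Real.exp N * (1 + gradNorm g F x) ^ p₀) (gluedVol g P) :=
          hint (continuous_const.mul hGc)
        have h2 : Integrable (fun x => c₁ * (2 / c * Real.exp N) *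
            (contrM (perturbed g φ) (hessT v) x * Real.exp (F x) +
              κ * Real.exp N * (1 + gradNorm g F x) ^ p₀)) (gluedVol g P) :=
          ((hint hlapc).add h1).const_mul _
        rw [integral_add h2 (integrable_const _), integral_const_mul, integral_add (hint hlapc) h1,
          h.integral_laplacian_eq_zero P hv, zero_add,
          integral_const_mul, integral_const, smul_eq_mul, mul_one]
    _ ≤ _ := by gcongr

/-- The gradients of the powers of a function that satisfies the differential inequality of the
weighted gradient. -/
theorem IsSmoothSolution.integral_gradNorm_rpow_le (h : IsSmoothSolution g F φ) (hn : 0 < n)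
    (P : ChartPartition n M ι) (hv : SmoothFn (n := n) v) (hc : 0 < c) (hc₁ : 0 < c₁)
    (hFN : ∀ x, |F x| ≤ N) (hlow : ∀ x, c * contrM g.coeff (gradT φ) x ≤ v x)
    (hlap : ∀ x, c * (contrM g.coeff (perturbed g φ) x + contrM g.coeff (gradT φ) x) -
        c₁ * (1 + √(contrM g.coeff (gradT φ) x) * gradNorm g F x) ≤
      contrM (perturbed g φ) (hessT v) x) {σ p : ℝ} (hσ : 0 < σ) (hσc : σ ≤ c) (hσp : σ ≤ p) :
    ∫ x, gradNorm g (fun y => (v y + 1) ^ (p + 1 / 2)) x ∂(gluedVol g P) ≤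
      Real.exp N / (2 * σ) * (c₁ * (1 + 1 / √c) * Real.exp N) * (p + 1 / 2) *
        ∫ x, (1 + gradNorm g F x) * (v x + 1) ^ (p + 1 / 2) ∂(gluedVol g P) := by
  have hp : 0 < p := hσ.trans_le hσp
  have hF := h.smoothFn_right
  have hFc : Continuous fun x => Real.exp (F x) := Real.continuous_exp.comp hF.continuous
  have hint : ∀ {f : M → ℝ}, Continuous f → Integrable f (gluedVol g P) := fun hf =>
    integrable_gluedVol g P hf
  have hw : SmoothFn (n := n) fun x => v x + 1 := hv.add_const 1
  have hu0 : ∀ x, 0 ≤ contrM g.coeff (gradT φ) x := contrM_gradT_nonneg g.posDef φ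
  have hw1 : ∀ x, 1 ≤ v x + 1 := fun x => by linarith [hlow x, mul_nonneg hc.le (hu0 x)]
  have hw0 : ∀ x, 0 < v x + 1 := fun x => zero_lt_one.trans_le (hw1 x)
  have hws : ∀ t : ℝ, SmoothFn (n := n) fun y => (v y + 1) ^ t := fun t =>
    hw.comp fun x => Real.contDiffAt_rpow_const_of_ne (hw0 x).ne'
  have hEn := h.integral_energy_eq_zero P hw hw0 hp
  set E : M → ℝ := fun x => (p * ((v x + 1) ^ (p - 1) *
    contrM (perturbed g φ) (gradT fun y => v y + 1) x) +
    (v x + 1) ^ p * contrM (perturbed g φ) (hessT fun y => v y + 1) x) * Real.exp (F x) with hE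
  have hEc : Continuous E := ((continuous_const.mul ((hws _).continuous.mul
    (hw.smoothFn_contrM_gradT h.isTensor h.smoothTensor h.posDef_perturbed).continuous)).add
    ((hws _).continuous.mul (h.smoothFn_laplacian hw).continuous)).mul hFc
  have hGc : Continuous fun x => (1 + gradNorm g F x) * (v x + 1) ^ (p + 1 / 2) :=
    (continuous_const.add (hF.continuous_gradNorm g)).mul (hws _).continuous
  have hpt : ∀ x, gradNorm g (fun y => (v y + 1) ^ (p + 1 / 2)) x ≤
      Real.exp N / (2 * σ) * (p + 1 / 2) * (E x + c₁ * (1 + 1 / √c) * Real.exp N *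
        ((1 + gradNorm g F x) * (v x + 1) ^ (p + 1 / 2))) := by
    intro x
    have h1 := h.gradNorm_rpow_le hw hw0 hp hn x
    have hQ0 : 0 ≤ contrM (perturbed g φ) (gradT fun y => v y + 1) x :=
      contrM_gradT_nonneg h.posDef_perturbed _ x
    have hm0 := h.contrM_perturbed_nonneg hn x
    have hl := hlap x
    have hlo := hlow x
    have hux := hu0 x
    simp only [hE, contrM_hessT_add_const hv]
    set Q := contrM (perturbed g φ) (gradT fun y => v y + 1) x
    set u := contrM g.coeff (gradT φ) x
    set m := contrM g.coeff (perturbed g φ) x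
    set T := gradNorm g F x with hT
    set Δ := contrM (perturbed g φ) (hessT v) x
    have hT0 : 0 ≤ T := gradNorm_nonneg g F x
    have hpow : ∀ t : ℝ, 0 < (v x + 1) ^ t := fun t => Real.rpow_pos_of_pos (hw0 x) t
    have hX := mul_nonneg (hpow (p - 1)).le hQ0
    have hY := mul_nonneg (hpow p).le hm0
    -- This raises the error w^p √u |∇F| to w^{p+1/2} |∇F|, the same power of w whose gradient is
    -- being estimated.
    have hsu : √u ≤ 1 / √c * √(v x + 1) := by
      rw [one_div, ← Real.sqrt_inv, ← Real.sqrt_mul (inv_nonneg.2 hc.le)]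
      refine Real.sqrt_le_sqrt ?_
      rw [le_inv_mul_iff₀ hc]
      linarith
    have hq : (v x + 1) ^ (p + 1 / 2) = (v x + 1) ^ p * √(v x + 1) := by
      rw [Real.rpow_add (hw0 x), Real.sqrt_eq_rpow]
    have hs1 : 1 ≤ √(v x + 1) := Real.one_le_sqrt.2 (hw1 x)
    have h2 : 1 + √u * T ≤ (1 + 1 / √c) * ((1 + T) * √(v x + 1)) := by
      have h3 : √u * T ≤ 1 / √c * √(v x + 1) * T := mul_le_mul_of_nonneg_right hsu hT0
      have h4 : 0 ≤ 1 / √c := by positivity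
      have h5 : 0 ≤ 1 / √c * √(v x + 1) := by positivity
      have h6 : 0 ≤ T * √(v x + 1) := by positivity
      nlinarith
    have h7 : p * ((v x + 1) ^ (p - 1) * Q) + c * ((v x + 1) ^ p * m) ≤
        p * ((v x + 1) ^ (p - 1) * Q) + (v x + 1) ^ p * Δ +
          c₁ * (1 + 1 / √c) * ((1 + T) * (v x + 1) ^ (p + 1 / 2)) := by
      have h8 : c * m ≤ Δ + c₁ * ((1 + 1 / √c) * ((1 + T) * √(v x + 1))) := by
        have h9 := mul_le_mul_of_nonneg_left h2 hc₁.le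
        have h10 := mul_nonneg hc.le hux
        linarith
      have h11 := mul_le_mul_of_nonneg_left h8 (hpow p).le
      rw [hq]
      linarith
    -- A common lower bound σ for the two coefficients p and c keeps the constant uniform over all p
    -- of the iteration.
    have h12 : σ * ((v x + 1) ^ (p - 1) * Q + (v x + 1) ^ p * m) ≤
        p * ((v x + 1) ^ (p - 1) * Q) + c * ((v x + 1) ^ p * m) := by
      rw [mul_add]
      gcongr
    have hE1 : Real.exp (F x) ≤ Real.exp N := Real.exp_le_exp.2 (abs_le.1 (hFN x)).2
    have hE2 : 1 ≤ Real.exp N * Real.exp (F x) := by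
      rw [← Real.exp_add]
      exact Real.one_le_exp (by linarith [(abs_le.1 (hFN x)).1])
    set S := (v x + 1) ^ (p - 1) * Q + (v x + 1) ^ p * m with hS
    set W := (1 + T) * (v x + 1) ^ (p + 1 / 2) with hW
    have hW0 : 0 ≤ W := mul_nonneg (by linarith) (hpow _).le
    have hS0 : 0 ≤ S := add_nonneg hX hY
    have hκ0 : 0 ≤ c₁ * (1 + 1 / √c) := by positivity
    calc _ ≤ (p + 1 / 2) / 2 * S := h1
      _ = 1 / (2 * σ) * (p + 1 / 2) * (σ * S) := by field_simp
      _ ≤ 1 / (2 * σ) * (p + 1 / 2) * (Real.exp N * Real.exp (F x) * (σ * S)) := by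
          exact mul_le_mul_of_nonneg_left (le_mul_of_one_le_left (by positivity) hE2)
            (by positivity)
      _ ≤ 1 / (2 * σ) * (p + 1 / 2) * (Real.exp N * Real.exp (F x) *
            (p * ((v x + 1) ^ (p - 1) * Q) + (v x + 1) ^ p * Δ + c₁ * (1 + 1 / √c) * W)) := by
          gcongr
          exact h12.trans h7
      _ = Real.exp N / (2 * σ) * (p + 1 / 2) *
            ((p * ((v x + 1) ^ (p - 1) * Q) + (v x + 1) ^ p * Δ) * Real.exp (F x) +
              c₁ * (1 + 1 / √c) * Real.exp (F x) * W) := by ring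
      _ ≤ _ := by gcongr
  calc ∫ x, gradNorm g (fun y => (v y + 1) ^ (p + 1 / 2)) x ∂(gluedVol g P)
      ≤ ∫ x, Real.exp N / (2 * σ) * (p + 1 / 2) * (E x + c₁ * (1 + 1 / √c) * Real.exp N *
        ((1 + gradNorm g F x) * (v x + 1) ^ (p + 1 / 2))) ∂(gluedVol g P) :=
        integral_mono (hint ((hws _).continuous_gradNorm g))
          (hint (continuous_const.mul (hEc.add (continuous_const.mul hGc)))) hpt
    _ = _ := by
        have h1 : Integrable (fun x => c₁ * (1 + 1 / √c) * Real.exp N *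
            ((1 + gradNorm g F x) * (v x + 1) ^ (p + 1 / 2))) (gluedVol g P) :=
          hint (continuous_const.mul hGc)
        rw [integral_const_mul, integral_add (hint hEc) h1, hEn, zero_add, integral_const_mul]
        ring

/-- The gradient estimate in positive dimension. -/
theorem exists_gradNorm_le [T2Space M] (hn : 0 < n) (g : KahlerMetric n M) {p₀ : ℝ}
    (hp₀ : 2 * (n : ℝ) < p₀) (K : ℝ) {L : ℝ} (hL : 0 ≤ L) :
    ∃ C : ℝ, ∀ F φ : M → ℝ, IsSmoothSolution g F φ → (∀ x, |φ x| ≤ K) →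
      sobolevNorm g p₀ F ≤ ENNReal.ofReal L → ∀ x, gradNorm g φ x ≤ C := by
  obtain ⟨t, ⟨P⟩⟩ := exists_chartPartition (n := n) (M := M)
  have hn1 : (1 : ℝ) ≤ n := by exact_mod_cast hn
  have hp2 : 2 < p₀ := by linarith
  have hr : p₀.HolderConjugate p₀.conjExponent := Real.HolderConjugate.conjExponent (by linarith)
  set r := p₀.conjExponent with hrdef
  -- The energy exponent is p = q - 1/2, and the iteration starts at q = 1/r. As p₀ > 2 gives r < 2,
  -- p stays above a positive constant from the first step on.
  have hr2 : 0 < 1 / r - 1 / 2 := by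
    have h1 := hr.inv_add_inv_eq_one
    have h2 : p₀⁻¹ < (2 : ℝ)⁻¹ := inv_strictAnti₀ (by norm_num) hp2
    rw [one_div]
    linarith
  obtain ⟨N, hN⟩ := exists_abs_le_of_sobolevNorm_le hn g P hp₀ hL
  obtain ⟨D, c, c₁, hc, hc₁, hD⟩ := exists_weightedGrad_bounds hn g K N
  set R : ℝ := 2 ^ (p₀ - 1) * ((gluedVol g P).real Set.univ + L ^ p₀)
  set σ := min (1 / r - 1 / 2) c with hσdef
  have hσ : 0 < σ := lt_min hr2 hc
  obtain ⟨B, hB⟩ := exists_sup_bound hn g P hp₀ hr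
    (b := Real.exp N / (2 * σ) * (c₁ * (1 + 1 / √c) * Real.exp N)) (by positivity) R
    (c₁ * (2 / c * Real.exp N) * ((c₁ + c₁ ^ 2 / (2 * c)) * Real.exp N * R) +
      (gluedVol g P).real Set.univ)
  refine ⟨√(B / c), fun F φ h hφ hFL x => ?_⟩
  have hF := h.smoothFn_right
  have hFN := hN F hF hFL
  have hbounds := hD F φ h hφ fun x => (abs_le.1 (hFN x)).2
  have hv := smoothFn_weightedGrad g D h.smoothFn
  have hu0 : ∀ x, 0 ≤ contrM g.coeff (gradT φ) x := contrM_gradT_nonneg g.posDef φ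
  have hR : ∫ x, (1 + gradNorm g F x) ^ p₀ ∂(gluedVol g P) ≤ R :=
    integral_one_add_gradNorm_rpow_le P (by linarith) hL hF hFL
  have h1 : weightedGrad g D φ x + 1 ≤ B := by
    refine hB (fun x => weightedGrad g D φ x + 1) (fun x => 1 + gradNorm g F x) (hv.add_const 1)
      (fun x => ?_) (continuous_const.add (hF.continuous_gradNorm g))
      (fun x => le_add_of_nonneg_right (gradNorm_nonneg g F x)) hR (fun q hq => ?_)
      (h.integral_add_one_le hn P hv hp2.le hc hc₁ hFN hR (fun x => (hbounds x).2.1)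
        fun x => (hbounds x).2.2) x
    · linarith [(hbounds x).1, mul_nonneg hc.le (hu0 x)]
    · have h2 := h.integral_gradNorm_rpow_le hn P hv hc hc₁ hFN (fun x => (hbounds x).1)
        (fun x => (hbounds x).2.2) (p := q - 1 / 2) hσ (min_le_right _ _)
        ((min_le_left _ _).trans (by linarith))
      rwa [sub_add_cancel] at h2
  rw [gradNorm_eq_sqrt]
  refine Real.sqrt_le_sqrt ?_
  rw [le_div_iff₀ hc]
  linarith [(hbounds x).1]

end MainEstimate

end KahlerMA

end

theorem theorem1p4 (n : ℕ) (M : Type*) [TopologicalSpace M] [T2Space M] [CompactSpace M]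
    [ChartedSpace (KahlerMA.Cn n) M] [IsManifold 𝓘(ℂ, KahlerMA.Cn n) ω M]
    [MeasurableSpace M] [BorelSpace M] (g : KahlerMA.KahlerMetric n M)
    (p₀ : ℝ) (hp₀ : 2 * (n : ℝ) < p₀) (K L : ℝ) :
    ∃ C : ℝ, ∀ F φ : M → ℝ, KahlerMA.IsSmoothSolution g F φ →
      (∀ x, |φ x| ≤ K) → KahlerMA.sobolevNorm g p₀ F ≤ ENNReal.ofReal L →
      ∀ x, KahlerMA.gradNorm g φ x ≤ C := by
  -- In dimension zero the gradient is an empty sum.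
  rcases Nat.eq_zero_or_pos n with rfl | hn
  · exact ⟨0, fun F φ _ _ _ x => by simp [KahlerMA.gradNorm]⟩
  -- `ENNReal.ofReal` truncates negative values, so L may be replaced by max L 0.
  · obtain ⟨C, hC⟩ := KahlerMA.exists_gradNorm_le hn g hp₀ K (le_max_right L 0)
    exact ⟨C, fun F φ h hφ hF => hC F φ h hφ
      (hF.trans (ENNReal.ofReal_le_ofReal (le_max_left L 0)))⟩
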